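/- Let $f_\theta$, $\theta=(\mu,\sigma)^T\in\Theta=\mathbb R\times(0,\infty)$, be the $\mathcal N(\mu,\sigma^2)$ density, let $\beta,\gamma\ge 0$, and consider testing $H_0:\mu=\mu_0$ against $H_1:\mu\neq\mu_0$ with $\sigma$ unknown, i.e. $g(\theta)=\mu-\mu_0=0$. Let $\theta_0=(\mu_0,\sigma)^T$ with $\sigma>0$ be the true parameter under $H_0$. Write $u_\theta(x)=\frac{\partial}{\partial\theta}\log f_\theta(x)$, $\xi_\beta(\theta)=\int u_\theta f_\theta^{1+\beta}\,dx$, $J_\beta(\theta)=\int u_\theta u_\theta^T f_\theta^{1+\beta}\,dx$, $K_\beta(\theta)=\int u_\theta u_\theta^Tf_\theta^{1+2\beta}\,dx-\xi_\beta(\theta)\xi_\beta(\theta)^T$, $A_\gamma(\theta)=(1+\gamma)\left(\int f_\theta^{\gamma-1}\frac{\partial f_\theta}{\partial\theta_i}\frac{\partial f_\theta}{\partial\theta_j}\,dx\right)_{i,j}$, $G(\theta)=\frac{\partial g}{\partial\theta}$ and $B_\beta=J_\beta^{-1}G\,(G^TJ_\beta^{-1}G)^{-1}G^TJ_\beta^{-1}$.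 For densities $h,f$ let $d_\gamma(h,f)=\int\{f^{1+\gamma}-(1+\tfrac1\gamma)f^\gamma h+\tfrac1\gamma h^{1+\gamma}\}\,dx$ if $\gamma>0$, and $d_0(h,f)=\int h\log(h/f)\,dx$. Let $X_1,X_2,\dots$ be i.i.d. $\mathcal N(\mu_0,\sigma^2)$. Let $Q_n(\theta)=\int f_\theta^{1+\beta}dx-(1+\tfrac1\beta)\frac1n\sum_{k=1}^n f_\theta^\beta(X_k)$ for $\beta>0$, $Q_n(\theta)=-\frac1n\sum_{k=1}^n\log f_\theta(X_k)$ for $\beta=0$, and $\psi_n(\theta)=\frac1n\sum_{k=1}^n u_\theta(X_k)f_\theta^\beta(X_k)-\xi_\beta(\theta)$. Let $\widehat\theta_\beta$ be a (measurable) minimum density power divergence estimator: either, with probability tending to one, it minimizes $Q_n$ over $\Theta$ whenever the minimum is attained, or it is a sequence, consistent for $\theta_0$, of roots of $\psi_n(\theta)=0$ in $\Theta$ (with probability tending to one). Let $\widetilde\theta_\beta$ be a (measurable) restricted minimum density power divergence estimator: likewise either a minimizer of $Q_n$ over $\Theta_0=\{\theta\in\Theta: g(\theta)=0\}$, or a sequence,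 consistent for $\theta_0$, of solutions in $\Theta_0$ of the Lagrange equations $-n\psi_n(\theta)+G(\theta)\lambda_n=0$ for some $\lambda_n\in\mathbb R$. Put $T_\gamma(\widehat\theta_\beta,\widetilde\theta_\beta)=2n\,d_\gamma(f_{\widehat\theta_\beta},f_{\widetilde\theta_\beta})$. Then $$A_\gamma(\theta_0)B_\beta(\theta_0)K_\beta(\theta_0)B_\beta(\theta_0)=\begin{pmatrix}\lambda_1&0\\0&0\end{pmatrix},\qquad \lambda_1=\frac{1}{\sigma^\gamma}\,\frac{(\beta+1)^3}{\sqrt{\gamma+1}\,(2\beta+1)^{3/2}(2\pi)^{\gamma/2}},$$ $\lambda_1\ne 0$ is the only nonzero eigenvalue of this matrix, and as $n\to\infty$ the statistic $T_\gamma(\widehat\theta_\beta,\widetilde\theta_\beta)$ converges in distribution to $\lambda_1\chi^2(1)$, i.e. to $\lambda_1Z^2$ with $Z$ standard normal. In particular, for $\beta=\gamma=0$ one has $\lambda_1=1$ and $T_0(\widehat\theta_0,\widetilde\theta_0)$ converges in distribution to $\chi^2(1)$. -/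

import Mathlib

open MeasureTheory ProbabilityTheory Filter Topology

namespace DPD

noncomputable section

/-! A parametric model is a family of densities `f θ : ℝ → ℝ` (with respect to Lebesgue measure)
indexed by parameter vectors `θ : ι → ℝ`; the parameter space is a set of such vectors. -/

section Model

variable {ι κ : Type*} [Fintype ι] [DecidableEq ι] [Fintype κ] [DecidableEq κ]

/-- The density power divergence `d_γ(h, f)`; for `γ = 0` the Kullback-Leibler divergence. -/
def divergence (γ : ℝ) (h f : ℝ → ℝ) : ℝ :=
  if γ = 0 then ∫ x, h x * Real.log (h x / f x)
  else ∫ x, (f x ^ (1 + γ) - (1 + 1 / γ) * f x ^ γ * h x + 1 / γ * h x ^ (1 + γ))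

/-- The partial derivative `∂F/∂θ_i` at `θ`. -/
def partialDeriv (F : (ι → ℝ) → ℝ) (θ : ι → ℝ) (i : ι) : ℝ :=
  deriv (fun t => F (Function.update θ i t)) (θ i)

/-- The likelihood score `u_θ(x) = ∂/∂θ log f_θ(x)`. -/
def score (f : (ι → ℝ) → ℝ → ℝ) (θ : ι → ℝ) (x : ℝ) (i : ι) : ℝ :=
  partialDeriv (fun θ' => Real.log (f θ' x)) θ i

/-- `ξ_β(θ) = ∫ u_θ f_θ^{1+β}`. -/
def xi (β : ℝ) (f : (ι → ℝ) → ℝ → ℝ) (θ : ι → ℝ) (i : ι) : ℝ :=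
  ∫ x, score f θ x i * f θ x ^ (1 + β)

/-- `J_β(θ) = ∫ u_θ u_θᵀ f_θ^{1+β}`. -/
def matJ (β : ℝ) (f : (ι → ℝ) → ℝ → ℝ) (θ : ι → ℝ) : Matrix ι ι ℝ :=
  Matrix.of fun i j => ∫ x, score f θ x i * score f θ x j * f θ x ^ (1 + β)

/-- `K_β(θ) = ∫ u_θ u_θᵀ f_θ^{1+2β} - ξ ξᵀ`. -/
def matK (β : ℝ) (f : (ι → ℝ) → ℝ → ℝ) (θ : ι → ℝ) : Matrix ι ι ℝ :=
  Matrix.of fun i j =>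
    (∫ x, score f θ x i * score f θ x j * f θ x ^ (1 + 2 * β)) - xi β f θ i * xi β f θ j

/-- `A_γ(θ) = (1+γ) ∫ f_θ^{γ-1} (∂f_θ/∂θ_j) (∂f_θ/∂θ_i)`. -/
def matA (γ : ℝ) (f : (ι → ℝ) → ℝ → ℝ) (θ : ι → ℝ) : Matrix ι ι ℝ :=
  Matrix.of fun i j => (1 + γ) *
    ∫ x, f θ x ^ (γ - 1) * partialDeriv (fun θ' => f θ' x) θ j * partialDeriv (fun θ' => f θ' x) θ i

/-- `G(θ) = ∂gᵀ/∂θ`, for a null hypothesis `g(θ) = 0`. -/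
def matG (g : (ι → ℝ) → κ → ℝ) (θ : ι → ℝ) : Matrix ι κ ℝ :=
  Matrix.of fun i j => partialDeriv (fun θ' => g θ' j) θ i

/-- `B_β(θ) = J⁻¹ G (Gᵀ J⁻¹ G)⁻¹ Gᵀ J⁻¹`. -/
def matB (β : ℝ) (f : (ι → ℝ) → ℝ → ℝ) (g : (ι → ℝ) → κ → ℝ) (θ : ι → ℝ) : Matrix ι ι ℝ :=
  (matJ β f θ)⁻¹ * matG g θ * ((matG g θ).transpose * (matJ β f θ)⁻¹ * matG g θ)⁻¹ *
    (matG g θ).transpose * (matJ β f θ)⁻¹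

/-- The empirical objective function of the sample `x 0, …, x (n-1)`; for `β = 0` it is minus the
averaged log-likelihood. -/
def objective (β : ℝ) (f : (ι → ℝ) → ℝ → ℝ) (x : ℕ → ℝ) (n : ℕ) (θ : ι → ℝ) : ℝ :=
  if β = 0 then -(1 / (n : ℝ) * ∑ k ∈ Finset.range n, Real.log (f θ (x k)))
  else (∫ y, f θ y ^ (1 + β)) - (1 + 1 / β) * (1 / (n : ℝ) * ∑ k ∈ Finset.range n, f θ (x k) ^ β)

/-- The left-hand side of the estimating equation,
`n⁻¹ ∑ u_θ(x_k) f_θ(x_k)^β - ∫ u_θ f_θ^{1+β}`. -/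
def estimatingFun (β : ℝ) (f : (ι → ℝ) → ℝ → ℝ) (x : ℕ → ℝ) (n : ℕ) (θ : ι → ℝ) (i : ι) : ℝ :=
  1 / (n : ℝ) * ∑ k ∈ Finset.range n, score f θ (x k) i * f θ (x k) ^ β - xi β f θ i

variable {Ω : Type*} [MeasurableSpace Ω]

/-- With probability tending to one, `est n` minimizes the objective function over `S`
whenever the minimum over `S` is attained at all. -/
def IsMinimizing (P : Measure Ω) (β : ℝ) (f : (ι → ℝ) → ℝ → ℝ) (S : Set (ι → ℝ))
    (X : ℕ → Ω → ℝ) (est : ℕ → Ω → ι → ℝ) : Prop :=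
  Tendsto (fun n => P {ω |
    (∃ θ ∈ S, IsMinOn (objective β f (fun k => X k ω) n) S θ) ∧
    ¬ (est n ω ∈ S ∧ IsMinOn (objective β f (fun k => X k ω) n) S (est n ω))}) atTop (𝓝 0)

/-- The minimum density power divergence estimator over the parameter space `Θ`: a minimizer of
the objective function, or a sequence of roots (with probability tending to one) of the estimating
equation that is consistent for the true value `θ₀`. -/
def IsMDPDE (P : Measure Ω) (β : ℝ) (f : (ι → ℝ) → ℝ → ℝ) (Θ : Set (ι → ℝ)) (θ₀ : ι → ℝ)
    (X : ℕ → Ω → ℝ) (est : ℕ → Ω → ι → ℝ) : Prop :=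
  (∀ n, Measurable (est n)) ∧
  (IsMinimizing P β f Θ X est ∨
    (TendstoInMeasure P est atTop (fun _ => θ₀) ∧
      Tendsto (fun n => P {ω | ¬ (est n ω ∈ Θ ∧
        ∀ i, estimatingFun β f (fun k => X k ω) n (est n ω) i = 0)}) atTop (𝓝 0)))

/-- The restricted minimum density power divergence estimator under `g(θ) = 0`: a minimizer of
the objective function over `{θ ∈ Θ | g θ = 0}`, or a sequence of solutions (with probability
tending to one) of the Lagrange equations that is consistent for the true value `θ₀`. -/
def IsRMDPDE (P : Measure Ω) (β : ℝ) (f : (ι → ℝ) → ℝ → ℝ) (Θ : Set (ι → ℝ))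
    (g : (ι → ℝ) → κ → ℝ) (θ₀ : ι → ℝ) (X : ℕ → Ω → ℝ) (est : ℕ → Ω → ι → ℝ) : Prop :=
  (∀ n, Measurable (est n)) ∧
  (IsMinimizing P β f {θ ∈ Θ | g θ = 0} X est ∨
    (TendstoInMeasure P est atTop (fun _ => θ₀) ∧
      Tendsto (fun n => P {ω | ¬ (est n ω ∈ Θ ∧ g (est n ω) = 0 ∧ ∃ l : κ → ℝ, ∀ i,
        -((n : ℝ) * estimatingFun β f (fun k => X k ω) n (est n ω) i)
          + (matG g (est n ω)).mulVec l i = 0)}) atTop (𝓝 0)))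

/-- The density power divergence test statistic `T_γ = 2 n d_γ(f_{est}, f_{est₀})`. -/
def testStat (γ : ℝ) (f : (ι → ℝ) → ℝ → ℝ) (est est₀ : ℕ → Ω → ι → ℝ) (n : ℕ) (ω : Ω) : ℝ :=
  2 * (n : ℝ) * divergence γ (f (est n ω)) (f (est₀ n ω))

end Model

/-- The normal densities, with parameter `θ = (μ, σ)`. -/
def normalModel (θ : Fin 2 → ℝ) (x : ℝ) : ℝ :=
  gaussianPDFReal (θ 0) (Real.toNNReal (θ 1 ^ 2)) x

/-- The parameter space `μ ∈ ℝ`, `σ > 0`. -/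
def normalSpace : Set (Fin 2 → ℝ) := {θ | 0 < θ 1}

/-- The restriction function `g(μ, σ) = μ - μ₀`. -/
def normalNull (μ₀ : ℝ) (θ : Fin 2 → ℝ) : Fin 1 → ℝ := fun _ => θ 0 - μ₀

/-- `(β+1)³ / (σ^γ √(γ+1) (2β+1)^{3/2} (2π)^{γ/2})`. -/
def normalEigenvalue (σ β γ : ℝ) : ℝ :=
  1 / σ ^ γ * ((β + 1) ^ 3 /
    (Real.sqrt (γ + 1) * (2 * β + 1) ^ (3 / 2 : ℝ) * (2 * Real.pi) ^ (γ / 2)))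

end

end DPD

/-! Location and scale are orthogonal in the normal model. By parity `matJ` is diagonal, and the
gradient of the restriction is the first basis vector, so `matB` has only its corner entry. The
matrix product therefore collapses to the corner A₀₀ K₀₀ / J₀₀², where ξ drops out because its
location component vanishes. Gaussian moments then give `normalEigenvalue`.

For the limit law, write X = μ₀ + σZ and let S₁, S₂ be the sample averages of `locScore` and
`scaleScore`. With a = σ/σ̂ - 1 and b = (μ₀ - μ̂)/σ̂, the estimating equations linearize to S₁ + D₁b
= o(|a| + |b|) and S₂ + D₂a = o(|a| + |b|). The restricted estimator has b = 0 and solves the same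
scale equation. The two scale estimates thus agree to first order and the estimators differ
essentially in location, by S₁/D₁ in units of the scale (`isLittleO_divergence`). The divergence is
quadratic in that difference (`divergence_expansion`), so the statistic is a constant times n S₁²
plus a vanishing error. The central limit theorem for S₁ and Slutsky's theorem finish the argument.

All errors are measured against S₁² + S₂², whose expectation is O(1/n), and Markov's inequality
turns this into convergence in probability (`tendsto_mul_of_isLittleO`). Working along the filter
`inProb` makes the Landau calculus of deterministic limits available.

Estimators defined as minimizers must first be shown consistent. `objective_lt_objective` does this
by Wald's argument: outside a neighbourhood of the true value the sample objective uniformly exceeds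
its value there. This rests on the strict inequality `population_gap_pos` for β > 0 and on
`loglik_gap_pos` for β = 0. -/

namespace DPD

noncomputable section

/-! ### Convergence in probability as convergence along a filter -/

section InProb

variable {Ω : Type*} [MeasurableSpace Ω]

/-- The filter on `ℕ × Ω` of sequences of events whose probability tends to one. Convergence in
probability to a constant is convergence along this filter. -/
def inProb (P : Measure Ω) : Filter (ℕ × Ω) where
  sets := {s | Tendsto (fun n => P {ω | (n, ω) ∉ s}) atTop (𝓝 0)}
  univ_sets := by simp
  sets_of_superset {s t} hs hst := by
    refine tendsto_of_tendsto_of_tendsto_of_le_of_le tendsto_const_nhds hs (fun _ => zero_le)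
      fun n => measure_mono fun ω hω h => hω (hst h)
  inter_sets {s t} hs ht := by
    have h : Tendsto (fun n => P {ω | (n, ω) ∉ s} + P {ω | (n, ω) ∉ t}) atTop (𝓝 0) := by
      simpa using Tendsto.add hs ht
    refine tendsto_of_tendsto_of_tendsto_of_le_of_le tendsto_const_nhds h (fun _ => zero_le)
      fun n => ?_
    refine (measure_mono fun ω hω => ?_).trans (measure_union_le _ _)
    simp only [Set.mem_ofPred_eq, Set.mem_inter_iff, not_and_or, Set.mem_union] at hω ⊢
    exact hω

variable {P : Measure Ω}

lemma eventually_inProb_iff {A : ℕ × Ω → Prop} :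
    (∀ᶠ p in inProb P, A p) ↔ Tendsto (fun n => P {ω | ¬ A (n, ω)}) atTop (𝓝 0) :=
  Iff.rfl

lemma tendsto_fst_inProb : Tendsto Prod.fst (inProb P) atTop := by
  intro s hs
  refine tendsto_const_nhds.congr' ?_
  filter_upwards [hs] with n hn
  simp [hn]

lemma tendsto_inProb_iff {E : Type*} [PseudoMetricSpace E] {Y : ℕ × Ω → E} {c : E} :
    Tendsto Y (inProb P) (𝓝 c) ↔
      TendstoInMeasure P (fun n ω => Y (n, ω)) atTop (fun _ => c) := by
  rw [tendstoInMeasure_iff_dist, Metric.tendsto_nhds]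
  refine forall₂_congr fun ε _ => ?_
  rw [eventually_inProb_iff]
  simp only [not_lt]

/-- If `n E[R_n] ≤ V` and `Y = o(R)` in probability then `n Y_n → 0` in probability. -/
lemma tendsto_mul_of_isLittleO [IsProbabilityMeasure P] {Y R : ℕ × Ω → ℝ} {V : ℝ}
    (hR0 : ∀ p, 0 ≤ R p) (hRint : ∀ n, Integrable (fun ω => R (n, ω)) P)
    (hRV : ∀ n : ℕ, (n : ℝ) * ∫ ω, R (n, ω) ∂P ≤ V) (h : Y =o[inProb P] R) :
    Tendsto (fun p => (p.1 : ℝ) * Y p) (inProb P) (𝓝 0) := by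
  rw [Metric.tendsto_nhds]
  intro ε hε
  rw [eventually_inProb_iff]
  have hV : 0 ≤ V := by simpa using hRV 0
  rw [ENNReal.tendsto_nhds_zero]
  intro η hη
  rcases eq_or_ne η ⊤ with rfl | hηt
  · simp
  have hη' : 0 < η.toReal := ENNReal.toReal_pos hη.ne' hηt
  -- Chosen so that Markov's bound c V / ε is at most half of η; the 1 added to V avoids division by
  -- zero.
  set c : ℝ := ε * (η.toReal / 2) / (V + 1) with hc
  have hcpos : 0 < c := by positivity
  have h1 := h.def hcpos
  rw [eventually_inProb_iff] at h1
  have h2 := (ENNReal.tendsto_nhds_zero.1 h1) (η / 2) (ENNReal.half_pos hη.ne')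
  filter_upwards [h2] with n hn
  have hsub : {ω | ¬ dist ((n : ℝ) * Y (n, ω)) 0 < ε} ⊆
      {ω | ¬ ‖Y (n, ω)‖ ≤ c * ‖R (n, ω)‖} ∪ {ω | ε ≤ n * c * R (n, ω)} := by
    intro ω hω
    simp only [Set.mem_ofPred_eq, not_lt, Set.mem_union, dist_zero_right, norm_mul,
      Real.norm_natCast] at hω ⊢
    by_contra! hcon
    have h3 : (n : ℝ) * ‖Y (n, ω)‖ ≤ n * (c * ‖R (n, ω)‖) := by
      gcongr; exact hcon.1
    rw [Real.norm_of_nonneg (hR0 _)] at h3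
    nlinarith [hcon.2]
  have hmark := mul_meas_ge_le_integral_of_nonneg (μ := P) (f := fun ω => n * c * R (n, ω))
    (Eventually.of_forall fun ω => by have := hR0 (n, ω); positivity)
    ((hRint n).const_mul _) ε
  rw [integral_const_mul] at hmark
  have h4 : P.real {ω | ε ≤ n * c * R (n, ω)} ≤ η.toReal / 2 := by
    have : ε * P.real {ω | ε ≤ n * c * R (n, ω)} ≤ c * V := by
      refine hmark.trans ?_
      rw [mul_comm (n : ℝ) c, mul_assoc]
      exact mul_le_mul_of_nonneg_left (hRV n) hcpos.le
    have h5 : c * V ≤ ε * (η.toReal / 2) := by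
      rw [hc, div_mul_eq_mul_div, div_le_iff₀ (by positivity)]
      have : 0 ≤ ε * (η.toReal / 2) := by positivity
      nlinarith
    exact le_of_mul_le_mul_left (this.trans h5) hε
  have h6 : P {ω | ε ≤ n * c * R (n, ω)} ≤ η / 2 := by
    rw [Measure.real, ← ENNReal.toReal_ofNat, ← ENNReal.toReal_div,
      ENNReal.toReal_le_toReal (measure_ne_top _ _) (ENNReal.div_ne_top hηt (by simp))] at h4
    exact h4
  calc P {ω | ¬ dist ((n : ℝ) * Y (n, ω)) 0 < ε} ≤ _ := measure_mono hsub
    _ ≤ _ := measure_union_le _ _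
    _ ≤ η / 2 + η / 2 := add_le_add hn h6
    _ = η := ENNReal.add_halves η

end InProb

/-! ### Sample averages: law of large numbers and second moments -/

section Sample

variable {Ω : Type*} [MeasurableSpace Ω]

/-- The sample average of `g` over `x 0, …, x (n-1)`. -/
def avg (x : ℕ → ℝ) (n : ℕ) (g : ℝ → ℝ) : ℝ := 1 / (n : ℝ) * ∑ k ∈ Finset.range n, g (x k)

lemma avg_add (x : ℕ → ℝ) (n : ℕ) (g h : ℝ → ℝ) :
    avg x n (fun z => g z + h z) = avg x n g + avg x n h := by
  simp [avg, Finset.sum_add_distrib, mul_add]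

lemma avg_sub (x : ℕ → ℝ) (n : ℕ) (g h : ℝ → ℝ) :
    avg x n (fun z => g z - h z) = avg x n g - avg x n h := by
  simp [avg, Finset.sum_sub_distrib, mul_sub]

lemma avg_const_mul (x : ℕ → ℝ) (n : ℕ) (c : ℝ) (g : ℝ → ℝ) :
    avg x n (fun z => c * g z) = c * avg x n g := by
  simp only [avg, ← Finset.mul_sum]; ring

lemma avg_const (x : ℕ → ℝ) {n : ℕ} (hn : n ≠ 0) (c : ℝ) : avg x n (fun _ => c) = c := by
  have : (n : ℝ) ≠ 0 := by exact_mod_cast hn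
  simp [avg, this]

lemma avg_mono (x : ℕ → ℝ) (n : ℕ) {g h : ℝ → ℝ} (hgh : ∀ z, g z ≤ h z) :
    avg x n g ≤ avg x n h := by
  unfold avg; gcongr; exact hgh _

lemma abs_avg_le (x : ℕ → ℝ) (n : ℕ) {g h : ℝ → ℝ} (hgh : ∀ z, |g z| ≤ h z) :
    |avg x n g| ≤ avg x n h := by
  unfold avg
  rw [abs_mul, abs_of_nonneg (by positivity : 0 ≤ 1 / (n : ℝ))]
  gcongr
  exact (Finset.abs_sum_le_sum_abs _ _).trans (Finset.sum_le_sum fun _ _ => hgh _)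

variable {P : Measure Ω} {Z : ℕ → Ω → ℝ} {ν : Measure ℝ}

lemma identDistrib_of_map_eq (hZ : ∀ k, Measurable (Z k)) (hlaw : ∀ k, P.map (Z k) = ν)
    {g : ℝ → ℝ} (hg : Measurable g) (i : ℕ) :
    IdentDistrib (fun ω => g (Z i ω)) (fun ω => g (Z 0 ω)) P P :=
  (IdentDistrib.mk (hZ i).aemeasurable (hZ 0).aemeasurable
    ((hlaw i).trans (hlaw 0).symm)).comp hg

lemma integral_comp_sample (hZ : ∀ k, Measurable (Z k)) (hlaw : ∀ k, P.map (Z k) = ν)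
    {g : ℝ → ℝ} (hg : Measurable g) (k : ℕ) : ∫ ω, g (Z k ω) ∂P = ∫ z, g z ∂ν := by
  rw [← hlaw k, integral_map (hZ k).aemeasurable hg.aestronglyMeasurable]

lemma integrable_comp_sample (hZ : ∀ k, Measurable (Z k)) (hlaw : ∀ k, P.map (Z k) = ν)
    {g : ℝ → ℝ} (hint : Integrable g ν) (k : ℕ) : Integrable (fun ω => g (Z k ω)) P := by
  rw [← hlaw k] at hint
  exact hint.comp_measurable (hZ k)

variable [IsProbabilityMeasure P]

/-- The weak law of large numbers. -/
lemma tendsto_avg (hZ : ∀ k, Measurable (Z k)) (hindep : iIndepFun Z P)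
    (hlaw : ∀ k, P.map (Z k) = ν) {g : ℝ → ℝ} (hg : Measurable g) (hint : Integrable g ν) :
    Tendsto (fun p : ℕ × Ω => avg (fun k => Z k p.2) p.1 g) (inProb P) (𝓝 (∫ z, g z ∂ν)) := by
  rw [tendsto_inProb_iff]
  refine tendstoInMeasure_of_tendsto_ae (fun n => ?_) ?_
  · refine Measurable.aestronglyMeasurable ?_
    simp only [avg]
    exact (Finset.measurable_fun_sum (Finset.range n) fun k _ => hg.comp (hZ k)).const_mul
      (1 / (n : ℝ))
  · have := strong_law_ae_real (μ := P) (fun k ω => g (Z k ω))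
      (integrable_comp_sample hZ hlaw hint 0)
      (fun i j hij => (hindep.indepFun hij).comp hg hg)
      (identDistrib_of_map_eq hZ hlaw hg)
    rw [integral_comp_sample hZ hlaw hg 0] at this
    filter_upwards [this] with ω hω
    simpa [avg, div_eq_inv_mul] using hω

/-- The second moment of a centred sample average. -/
lemma integral_avg_sq (hZ : ∀ k, Measurable (Z k)) (hindep : iIndepFun Z P)
    (hlaw : ∀ k, P.map (Z k) = ν) {g : ℝ → ℝ} (hg : Measurable g)
    (hint : Integrable (fun z => g z ^ 2) ν) (h0 : ∫ z, g z ∂ν = 0) (n : ℕ) :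
    Integrable (fun ω => avg (fun k => Z k ω) n g ^ 2) P ∧
      (n : ℝ) * ∫ ω, avg (fun k => Z k ω) n g ^ 2 ∂P ≤ ∫ z, g z ^ 2 ∂ν := by
  have hgZ : ∀ k, Measurable fun ω => g (Z k ω) := fun k => hg.comp (hZ k)
  have hL2 : ∀ k, MemLp (fun ω => g (Z k ω)) 2 P := fun k => by
    rw [memLp_two_iff_integrable_sq (hgZ k).aestronglyMeasurable]
    exact integrable_comp_sample hZ hlaw hint k
  have hmean : ∀ k, ∫ ω, g (Z k ω) ∂P = 0 := fun k => by
    rw [integral_comp_sample hZ hlaw hg, h0]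
  have hvar : ∀ k, Var[fun ω => g (Z k ω); P] = ∫ z, g z ^ 2 ∂ν := fun k => by
    rw [variance_of_integral_eq_zero (hgZ k).aemeasurable (hmean k)]
    exact integral_comp_sample (g := fun z => g z ^ 2) hZ hlaw (hg.pow_const 2) k
  have hsumL2 : MemLp (fun ω => ∑ k ∈ Finset.range n, g (Z k ω)) 2 P :=
    memLp_finsetSum _ fun k _ => hL2 k
  have hsum : ∫ ω, (∑ k ∈ Finset.range n, g (Z k ω)) ^ 2 ∂P = n * ∫ z, g z ^ 2 ∂ν := by
    have h1 := IndepFun.variance_sum (μ := P) (X := fun k ω => g (Z k ω)) (s := Finset.range n)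
      (fun k _ => hL2 k) (fun i _ j _ hij => (hindep.indepFun hij).comp hg hg)
    have h2 : (∑ k ∈ Finset.range n, fun ω => g (Z k ω)) =
        fun ω => ∑ k ∈ Finset.range n, g (Z k ω) := by ext; simp
    rw [h2, variance_of_integral_eq_zero hsumL2.aestronglyMeasurable.aemeasurable] at h1
    · rw [h1]; simp [hvar]
    · rw [integral_finsetSum _ fun k _ => (hL2 k).integrable (by norm_num)]
      simp [hmean]
  have hsq : (fun ω => avg (fun k => Z k ω) n g ^ 2) =
      fun ω => (1 / (n : ℝ)) ^ 2 * (∑ k ∈ Finset.range n, g (Z k ω)) ^ 2 := by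
    ext ω; simp only [avg]; ring
  rw [hsq]
  refine ⟨hsumL2.integrable_sq.const_mul _, ?_⟩
  rw [integral_const_mul, hsum]
  -- At n = 0 the factor n makes the left side zero.
  rcases eq_or_ne n 0 with rfl | hn
  · simpa using integral_nonneg fun z => sq_nonneg (g z)
  · have : (n : ℝ) ≠ 0 := by exact_mod_cast hn
    apply le_of_eq; field_simp

end Sample

/-! ### Integrals of polynomials against Gaussian weights -/

section GaussianMoments

lemma integrable_pow_mul_exp (k : ℕ) {c : ℝ} (hc : 0 < c) :
    Integrable fun z : ℝ => z ^ k * Real.exp (-(c * z ^ 2 / 2)) := by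
  have h := integrable_rpow_mul_exp_neg_mul_sq (half_pos hc) (s := k)
    (by have : (0 : ℝ) ≤ k := k.cast_nonneg
        linarith)
  refine h.congr (Eventually.of_forall fun z => ?_)
  simp only [Real.rpow_natCast]
  ring_nf

/-- The moments of a Gaussian weight. -/
def gaussMoment (k : ℕ) (c : ℝ) : ℝ := ∫ z : ℝ, z ^ k * Real.exp (-(c * z ^ 2 / 2))

lemma hasDerivAt_exp_neg_sq (c z : ℝ) :
    HasDerivAt (fun z : ℝ => Real.exp (-(c * z ^ 2 / 2)))
      (-(c * z) * Real.exp (-(c * z ^ 2 / 2))) z := by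
  have h : HasDerivAt (fun z : ℝ => -(c * z ^ 2 / 2)) (-(c * z)) z := by
    have := (((hasDerivAt_pow 2 z).const_mul c).div_const 2).neg
    convert! this using 1; simp; ring
  convert! h.exp using 1; ring

lemma gaussMoment_zero (c : ℝ) : gaussMoment 0 c = √(2 * Real.pi / c) := by
  have := integral_gaussian (c / 2)
  rw [show Real.pi / (c / 2) = 2 * Real.pi / c by rw [div_div_eq_mul_div, mul_comm]] at this
  rw [← this, gaussMoment]
  congr 1; ext z; ring_nf

lemma gaussMoment_one {c : ℝ} (hc : 0 < c) : gaussMoment 1 c = 0 := by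
  have h := integral_eq_zero_of_hasDerivAt_of_integrable
    (f' := fun z : ℝ => -(c * z) * Real.exp (-(c * z ^ 2 / 2)))
    (hasDerivAt_exp_neg_sq c)
    (((integrable_pow_mul_exp 1 hc).const_mul (-c)).congr
      (Eventually.of_forall fun z => by simp only; ring))
    ((integrable_pow_mul_exp 0 hc).congr (Eventually.of_forall fun z => by simp))
  have h2 : (fun z : ℝ => -(c * z) * Real.exp (-(c * z ^ 2 / 2))) =
      fun z => -c * (z ^ 1 * Real.exp (-(c * z ^ 2 / 2))) := by ext z; ring
  rw [h2, integral_const_mul] at h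
  exact (mul_eq_zero.1 h).resolve_left (by linarith)

/-- Integration by parts, in the form that the derivative of z ^ (k + 1) times the weight integrates
to zero. -/
lemma gaussMoment_add_two (k : ℕ) {c : ℝ} (hc : 0 < c) :
    gaussMoment (k + 2) c = (k + 1) / c * gaussMoment k c := by
  have h := integral_eq_zero_of_hasDerivAt_of_integrable
    (f := fun z : ℝ => z ^ (k + 1) * Real.exp (-(c * z ^ 2 / 2)))
    (f' := fun z : ℝ => (k + 1) * (z ^ k * Real.exp (-(c * z ^ 2 / 2))) -
      c * (z ^ (k + 2) * Real.exp (-(c * z ^ 2 / 2))))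
    (fun z => by
      convert! (hasDerivAt_pow (k + 1) z).mul (hasDerivAt_exp_neg_sq c z) using 1
      push_cast; simp; ring)
    (((integrable_pow_mul_exp k hc).const_mul _).sub
      ((integrable_pow_mul_exp (k + 2) hc).const_mul _))
    (integrable_pow_mul_exp (k + 1) hc)
  rw [integral_sub ((integrable_pow_mul_exp k hc).const_mul _)
      ((integrable_pow_mul_exp (k + 2) hc).const_mul _), integral_const_mul,
    integral_const_mul] at h
  change (k + 1) * gaussMoment k c - c * gaussMoment (k + 2) c = 0 at h
  field_simp; linarith

lemma gaussMoment_two {c : ℝ} (hc : 0 < c) : gaussMoment 2 c = gaussMoment 0 c / c := by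
  rw [gaussMoment_add_two 0 hc]; simp; ring

lemma gaussMoment_three {c : ℝ} (hc : 0 < c) : gaussMoment 3 c = 0 := by
  rw [gaussMoment_add_two 1 hc, gaussMoment_one hc, mul_zero]

lemma gaussMoment_four {c : ℝ} (hc : 0 < c) : gaussMoment 4 c = 3 * gaussMoment 0 c / c ^ 2 := by
  rw [gaussMoment_add_two 2 hc, gaussMoment_two hc]; field_simp; push_cast; ring

/-- The integral of a quartic polynomial against a Gaussian weight. -/
lemma integral_quartic_mul_exp {c : ℝ} (hc : 0 < c) (a₀ a₁ a₂ a₃ a₄ : ℝ) :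
    Integrable (fun z : ℝ => (a₀ + a₁ * z + a₂ * z ^ 2 + a₃ * z ^ 3 + a₄ * z ^ 4) *
      Real.exp (-(c * z ^ 2 / 2))) ∧
    ∫ z : ℝ, (a₀ + a₁ * z + a₂ * z ^ 2 + a₃ * z ^ 3 + a₄ * z ^ 4) * Real.exp (-(c * z ^ 2 / 2)) =
      (a₀ + a₂ / c + 3 * a₄ / c ^ 2) * gaussMoment 0 c := by
  have hi := fun k a => (integrable_pow_mul_exp k hc).const_mul a
  have h0 := hi 0 a₀
  have h1 := h0.add (hi 1 a₁)
  have h2 := h1.add (hi 2 a₂)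
  have h3 := h2.add (hi 3 a₃)
  have h4 := h3.add (hi 4 a₄)
  have he : (fun z : ℝ => (a₀ + a₁ * z + a₂ * z ^ 2 + a₃ * z ^ 3 + a₄ * z ^ 4) *
      Real.exp (-(c * z ^ 2 / 2))) = ((((fun z : ℝ => a₀ * (z ^ 0 * Real.exp (-(c * z ^ 2 / 2)))) +
        fun z : ℝ => a₁ * (z ^ 1 * Real.exp (-(c * z ^ 2 / 2)))) +
        fun z : ℝ => a₂ * (z ^ 2 * Real.exp (-(c * z ^ 2 / 2)))) +
        fun z : ℝ => a₃ * (z ^ 3 * Real.exp (-(c * z ^ 2 / 2)))) +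
        fun z : ℝ => a₄ * (z ^ 4 * Real.exp (-(c * z ^ 2 / 2))) := by
    ext z; simp only [Pi.add_apply]; ring
  rw [he]
  refine ⟨h4, ?_⟩
  rw [integral_add' h3 (hi 4 a₄), integral_add' h2 (hi 3 a₃), integral_add' h1 (hi 2 a₂),
    integral_add' h0 (hi 1 a₁)]
  simp only [integral_const_mul]
  change a₀ * gaussMoment 0 c + a₁ * gaussMoment 1 c + a₂ * gaussMoment 2 c +
    a₃ * gaussMoment 3 c + a₄ * gaussMoment 4 c = _
  rw [gaussMoment_one hc, gaussMoment_two hc, gaussMoment_three hc, gaussMoment_four hc]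
  ring

lemma integral_stdGaussian (g : ℝ → ℝ) :
    ∫ z, g z ∂gaussianReal 0 1 = (√(2 * Real.pi))⁻¹ * ∫ z, g z * Real.exp (-(z ^ 2 / 2)) := by
  rw [integral_gaussianReal_eq_integral_smul one_ne_zero, ← integral_const_mul]
  congr 1; ext z
  simp [gaussianPDFReal]; ring_nf

lemma integrable_stdGaussian {g : ℝ → ℝ}
    (hg : Integrable fun z : ℝ => g z * Real.exp (-(z ^ 2 / 2))) :
    Integrable g (gaussianReal 0 1) := by
  rw [gaussianReal_of_var_ne_zero _ one_ne_zero,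
    integrable_withDensity_iff_integrable_smul₀' (measurable_gaussianPDF 0 1).aemeasurable
      (Eventually.of_forall fun _ => gaussianPDF_lt_top)]
  refine (hg.const_mul (√(2 * Real.pi))⁻¹).congr (Eventually.of_forall fun z => ?_)
  simp [toReal_gaussianPDF, gaussianPDFReal]; ring_nf

/-- The standard Gaussian expectation of a quartic polynomial times a Gaussian weight. -/
lemma integral_stdGaussian_quartic {β : ℝ} (hβ : 0 ≤ β) (a₀ a₁ a₂ a₃ a₄ : ℝ) :
    Integrable (fun z : ℝ => (a₀ + a₁ * z + a₂ * z ^ 2 + a₃ * z ^ 3 + a₄ * z ^ 4) *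
      Real.exp (-(β * z ^ 2 / 2))) (gaussianReal 0 1) ∧
    ∫ z : ℝ, (a₀ + a₁ * z + a₂ * z ^ 2 + a₃ * z ^ 3 + a₄ * z ^ 4) * Real.exp (-(β * z ^ 2 / 2))
        ∂gaussianReal 0 1 =
      (a₀ + a₂ / (1 + β) + 3 * a₄ / (1 + β) ^ 2) / √(1 + β) := by
  have h := integral_quartic_mul_exp (c := 1 + β) (by linarith) a₀ a₁ a₂ a₃ a₄
  have he : (fun z : ℝ => (a₀ + a₁ * z + a₂ * z ^ 2 + a₃ * z ^ 3 + a₄ * z ^ 4) *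
      Real.exp (-(β * z ^ 2 / 2)) * Real.exp (-(z ^ 2 / 2))) =
      fun z : ℝ => (a₀ + a₁ * z + a₂ * z ^ 2 + a₃ * z ^ 3 + a₄ * z ^ 4) *
        Real.exp (-((1 + β) * z ^ 2 / 2)) := by
    ext z; rw [mul_assoc, ← Real.exp_add]; ring_nf
  refine ⟨integrable_stdGaussian (he ▸ h.1), ?_⟩
  rw [integral_stdGaussian, he, h.2, gaussMoment_zero, Real.sqrt_div (by positivity)]
  have : √(2 * Real.pi) ≠ 0 := by have := Real.pi_pos; positivity
  field_simp

/-- Completing the square merges the two weights into one of precision 1 + p centred at p m / (1 +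
p). It evaluates both the cross term of the divergence and the population objective. -/
lemma integral_exp_mul_exp {p : ℝ} (hp : 0 ≤ p) (m : ℝ) :
    Integrable (fun z : ℝ => Real.exp (-(p * (z - m) ^ 2 / 2)) * Real.exp (-(z ^ 2 / 2))) ∧
    ∫ z : ℝ, Real.exp (-(p * (z - m) ^ 2 / 2)) * Real.exp (-(z ^ 2 / 2)) =
      √(2 * Real.pi) / √(1 + p) * Real.exp (-(p * m ^ 2 / (2 * (1 + p)))) := by
  have h1 : 0 < 1 + p := by linarith
  have he : (fun z : ℝ => Real.exp (-(p * (z - m) ^ 2 / 2)) * Real.exp (-(z ^ 2 / 2))) =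
      fun z => (fun y : ℝ => Real.exp (-(p * m ^ 2 / (2 * (1 + p)))) *
        (y ^ 0 * Real.exp (-((1 + p) * y ^ 2 / 2)))) (z - p * m / (1 + p)) := by
    ext z
    simp only [pow_zero, one_mul]
    rw [← Real.exp_add, ← Real.exp_add]
    congr 1; field_simp; ring
  rw [he]
  refine ⟨((integrable_pow_mul_exp 0 h1).const_mul _).comp_sub_right _, ?_⟩
  rw [integral_sub_right_eq_self
    (fun y : ℝ => Real.exp (-(p * m ^ 2 / (2 * (1 + p)))) *
        (y ^ 0 * Real.exp (-((1 + p) * y ^ 2 / 2)))), integral_const_mul]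
  change _ * gaussMoment 0 (1 + p) = _
  rw [gaussMoment_zero, Real.sqrt_div (by positivity)]
  ring

lemma integral_standardize (F : ℝ → ℝ) (m : ℝ) {s : ℝ} (hs : 0 < s) :
    ∫ x, F ((x - m) / s) = s * ∫ z, F z := by
  rw [integral_sub_right_eq_self (fun x => F (x / s)), Measure.integral_comp_div, abs_of_pos hs,
    smul_eq_mul]

lemma integrable_standardize {F : ℝ → ℝ} (hF : Integrable F) (m : ℝ) {s : ℝ} (hs : 0 < s) :
    Integrable fun x => F ((x - m) / s) :=
  (hF.comp_div hs.ne').comp_sub_right m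

end GaussianMoments

/-! ### Scores and matrices of the normal model -/

section NormalModel

variable {θ : Fin 2 → ℝ}

lemma normalModel_eq (hθ : 0 < θ 1) (x : ℝ) :
    normalModel θ x = (√(2 * Real.pi) * θ 1)⁻¹ * Real.exp (-(((x - θ 0) / θ 1) ^ 2 / 2)) := by
  rw [normalModel, gaussianPDFReal, Real.coe_toNNReal _ (sq_nonneg _),
    Real.sqrt_mul (by positivity), Real.sqrt_sq hθ.le]
  congr 2; field_simp

lemma normalModel_pos (hθ : 0 < θ 1) (x : ℝ) : 0 < normalModel θ x := by
  rw [normalModel_eq hθ]; have := Real.pi_pos; positivity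

lemma log_normalModel (hθ : 0 < θ 1) (x : ℝ) :
    Real.log (normalModel θ x) =
      -Real.log √(2 * Real.pi) - Real.log (θ 1) - ((x - θ 0) / θ 1) ^ 2 / 2 := by
  have h1 : √(2 * Real.pi) ≠ 0 := by have := Real.pi_pos; positivity
  rw [normalModel_eq hθ, Real.log_mul (by positivity) (Real.exp_pos _).ne', Real.log_exp,
    Real.log_inv, Real.log_mul h1 hθ.ne']
  ring

lemma normalModel_rpow (hθ : 0 < θ 1) (x q : ℝ) :
    normalModel θ x ^ q =
      (√(2 * Real.pi) * θ 1) ^ (-q) * Real.exp (-(q * ((x - θ 0) / θ 1) ^ 2 / 2)) := by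
  have h1 : 0 < √(2 * Real.pi) * θ 1 := by have := Real.pi_pos; positivity
  rw [normalModel_eq hθ, Real.mul_rpow (by positivity) (Real.exp_pos _).le, Real.inv_rpow h1.le,
    Real.rpow_neg h1.le, ← Real.exp_mul]
  congr 2; ring

lemma hasDerivAt_log_normalModel_loc (hθ : 0 < θ 1) (x : ℝ) :
    HasDerivAt (fun t => Real.log (normalModel (Function.update θ 0 t) x))
      ((x - θ 0) / θ 1 / θ 1) (θ 0) := by
  have he : (fun t => Real.log (normalModel (Function.update θ 0 t) x)) =
      fun t => -Real.log √(2 * Real.pi) - Real.log (θ 1) - ((x - t) / θ 1) ^ 2 / 2 := by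
    ext t
    rw [log_normalModel (by simpa using hθ)]
    simp
  rw [he]
  have h := (((((hasDerivAt_id (θ 0)).const_sub x).div_const (θ 1)).pow 2).div_const 2).const_sub
    (-Real.log √(2 * Real.pi) - Real.log (θ 1))
  convert! h using 1
  simp; ring

lemma hasDerivAt_log_normalModel_scale (hθ : 0 < θ 1) (x : ℝ) :
    HasDerivAt (fun t => Real.log (normalModel (Function.update θ 1 t) x))
      ((((x - θ 0) / θ 1) ^ 2 - 1) / θ 1) (θ 1) := by
  have he : (fun t => Real.log (normalModel (Function.update θ 1 t) x)) =ᶠ[𝓝 (θ 1)]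
      fun t => -Real.log √(2 * Real.pi) - Real.log t - ((x - θ 0) / t) ^ 2 / 2 := by
    filter_upwards [lt_mem_nhds hθ] with t ht
    rw [log_normalModel (by simpa using ht)]
    simp
  refine HasDerivAt.congr_of_eventuallyEq ?_ he
  have h := ((Real.hasDerivAt_log hθ.ne').const_sub (-Real.log √(2 * Real.pi))).sub
    (((((hasDerivAt_inv hθ.ne').const_mul (x - θ 0))).pow 2).div_const 2)
  refine (h.congr_deriv ?_).congr_of_eventuallyEq (Eventually.of_forall fun t => ?_)
  · simp; field_simp; ring
  · simp [div_eq_mul_inv]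

lemma score_normalModel (hθ : 0 < θ 1) (x : ℝ) :
    score normalModel θ x 0 = (x - θ 0) / θ 1 / θ 1 ∧
    score normalModel θ x 1 = (((x - θ 0) / θ 1) ^ 2 - 1) / θ 1 :=
  ⟨(hasDerivAt_log_normalModel_loc hθ x).deriv, (hasDerivAt_log_normalModel_scale hθ x).deriv⟩

lemma hasDerivAt_log_normalModel (hθ : 0 < θ 1) (x : ℝ) (i : Fin 2) :
    HasDerivAt (fun t => Real.log (normalModel (Function.update θ i t) x))
      (score normalModel θ x i) (θ i) := by
  fin_cases i
  · exact (score_normalModel hθ x).1 ▸ hasDerivAt_log_normalModel_loc hθ x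
  · exact (score_normalModel hθ x).2 ▸ hasDerivAt_log_normalModel_scale hθ x

lemma eventually_update_pos (hθ : 0 < θ 1) (i : Fin 2) :
    ∀ᶠ t in 𝓝 (θ i), 0 < Function.update θ i t 1 := by
  fin_cases i
  · exact Eventually.of_forall fun t => by simpa using hθ
  · filter_upwards [lt_mem_nhds hθ] with t ht; simpa using ht

/-- Obtained from f ^ q = exp (q log f), which holds only while the perturbed scale is positive,
hence only near the point. -/
lemma hasDerivAt_normalModel_rpow (hθ : 0 < θ 1) (x q : ℝ) (i : Fin 2) :
    HasDerivAt (fun t => normalModel (Function.update θ i t) x ^ q)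
      (q * (score normalModel θ x i * normalModel θ x ^ q)) (θ i) := by
  have h := ((hasDerivAt_log_normalModel hθ x i).const_mul q).exp
  have he : (fun t => normalModel (Function.update θ i t) x ^ q) =ᶠ[𝓝 (θ i)]
      fun t => Real.exp (q * Real.log (normalModel (Function.update θ i t) x)) := by
    filter_upwards [eventually_update_pos hθ i] with t ht
    rw [Real.rpow_def_of_pos (normalModel_pos ht x), mul_comm]
  refine (h.congr_deriv ?_).congr_of_eventuallyEq he
  rw [Function.update_eq_self, mul_comm q (Real.log _), ← Real.rpow_def_of_pos
    (normalModel_pos hθ x)]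
  ring

lemma partialDeriv_normalModel (hθ : 0 < θ 1) (x : ℝ) (i : Fin 2) :
    partialDeriv (fun θ' => normalModel θ' x) θ i =
      score normalModel θ x i * normalModel θ x := by
  have h := hasDerivAt_normalModel_rpow hθ x 1 i
  simp only [Real.rpow_one, one_mul] at h
  exact h.deriv

lemma integral_mul_normalModel_rpow (hθ : 0 < θ 1) (F : ℝ → ℝ) (q : ℝ) :
    ∫ x, F ((x - θ 0) / θ 1) * normalModel θ x ^ q =
      θ 1 * (√(2 * Real.pi) * θ 1) ^ (-q) * ∫ z, F z * Real.exp (-(q * z ^ 2 / 2)) := by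
  have he : (fun x => F ((x - θ 0) / θ 1) * normalModel θ x ^ q) = fun x =>
      (fun z => (√(2 * Real.pi) * θ 1) ^ (-q) * (F z * Real.exp (-(q * z ^ 2 / 2))))
        ((x - θ 0) / θ 1) := by
    ext x; rw [normalModel_rpow hθ]; ring
  rw [he, integral_standardize (fun z => (√(2 * Real.pi) * θ 1) ^ (-q) *
    (F z * Real.exp (-(q * z ^ 2 / 2)))) _ hθ, integral_const_mul]; ring

lemma integrable_mul_normalModel_rpow (hθ : 0 < θ 1) {F : ℝ → ℝ} {q : ℝ}
    (hF : Integrable fun z => F z * Real.exp (-(q * z ^ 2 / 2))) :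
    Integrable fun x => F ((x - θ 0) / θ 1) * normalModel θ x ^ q := by
  have he : (fun x => F ((x - θ 0) / θ 1) * normalModel θ x ^ q) = fun x =>
      (fun z => (√(2 * Real.pi) * θ 1) ^ (-q) * (F z * Real.exp (-(q * z ^ 2 / 2))))
        ((x - θ 0) / θ 1) := by
    ext x; rw [normalModel_rpow hθ]; ring
  rw [he]
  exact integrable_standardize (hF.const_mul _) _ hθ

/-- The scores are polynomials of degree at most two in the standardized variable, so their products
are quartic and this single formula evaluates ξ, J and K. -/
lemma integral_quartic_mul_normalModel_rpow (hθ : 0 < θ 1) {q : ℝ} (hq : 0 < q) {F : ℝ → ℝ}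
    {a₀ a₁ a₂ a₃ a₄ : ℝ}
    (hF : ∀ x, F x = a₀ + a₁ * ((x - θ 0) / θ 1) + a₂ * ((x - θ 0) / θ 1) ^ 2 +
      a₃ * ((x - θ 0) / θ 1) ^ 3 + a₄ * ((x - θ 0) / θ 1) ^ 4) :
    ∫ x, F x * normalModel θ x ^ q =
      θ 1 * (√(2 * Real.pi) * θ 1) ^ (-q) *
        ((a₀ + a₂ / q + 3 * a₄ / q ^ 2) * (√(2 * Real.pi) / √q)) := by
  simp_rw [hF]
  rw [integral_mul_normalModel_rpow hθ
    (fun z => a₀ + a₁ * z + a₂ * z ^ 2 + a₃ * z ^ 3 + a₄ * z ^ 4) q,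
    (integral_quartic_mul_exp hq a₀ a₁ a₂ a₃ a₄).2, gaussMoment_zero,
    Real.sqrt_div (by positivity)]

lemma integral_normalModel_rpow (hθ : 0 < θ 1) {q : ℝ} (hq : 0 < q) :
    ∫ x, normalModel θ x ^ q =
      θ 1 * (√(2 * Real.pi) * θ 1) ^ (-q) * (√(2 * Real.pi) / √q) := by
  have h := integral_quartic_mul_normalModel_rpow hθ hq (F := fun _ => 1) (a₀ := 1) (a₁ := 0)
    (a₂ := 0) (a₃ := 0) (a₄ := 0) (fun x => by simp)
  simpa using h

lemma xi_normalModel (hθ : 0 < θ 1) {β : ℝ} (hβ : 0 ≤ β) :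
    xi β normalModel θ 0 = 0 ∧
    xi β normalModel θ 1 = (√(2 * Real.pi) * θ 1) ^ (-(1 + β)) *
      ((1 / (1 + β) - 1) * (√(2 * Real.pi) / √(1 + β))) := by
  constructor
  · rw [xi, integral_quartic_mul_normalModel_rpow hθ (by linarith) (a₀ := 0) (a₁ := 1 / θ 1)
      (a₂ := 0) (a₃ := 0) (a₄ := 0)
      (fun x => by rw [(score_normalModel hθ x).1]; ring)]
    simp
  · rw [xi, integral_quartic_mul_normalModel_rpow hθ (by linarith) (a₀ := -1 / θ 1) (a₁ := 0)
      (a₂ := 1 / θ 1) (a₃ := 0) (a₄ := 0)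
      (fun x => by rw [(score_normalModel hθ x).2]; ring)]
    field_simp; ring

/-- The off-diagonal entries vanish because the product of the two scores is odd in the standardized
variable. -/
lemma matJ_normalModel (hθ : 0 < θ 1) {β : ℝ} (hβ : 0 ≤ β) :
    matJ β normalModel θ = ((θ 1)⁻¹ * (√(2 * Real.pi) * θ 1) ^ (-(1 + β)) *
        (√(2 * Real.pi) / √(1 + β))) •
      !![1 / (1 + β), 0; 0, 1 - 2 / (1 + β) + 3 / (1 + β) ^ 2] := by
  have h1 : 0 < 1 + β := by linarith
  ext i j
  fin_cases i <;> fin_cases j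
  · simp only [matJ, Matrix.of_apply, Fin.zero_eta]
    rw [integral_quartic_mul_normalModel_rpow hθ h1 (a₀ := 0) (a₁ := 0) (a₂ := 1 / θ 1 ^ 2)
      (a₃ := 0) (a₄ := 0) (fun x => by rw [(score_normalModel hθ x).1]; ring)]
    simp; field_simp
  · simp only [matJ, Matrix.of_apply, Fin.zero_eta, Fin.mk_one]
    rw [integral_quartic_mul_normalModel_rpow hθ h1 (a₀ := 0) (a₁ := -1 / θ 1 ^ 2) (a₂ := 0)
      (a₃ := 1 / θ 1 ^ 2) (a₄ := 0)
      (fun x => by rw [(score_normalModel hθ x).1, (score_normalModel hθ x).2]; ring)]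
    simp
  · simp only [matJ, Matrix.of_apply, Fin.zero_eta, Fin.mk_one]
    rw [integral_quartic_mul_normalModel_rpow hθ h1 (a₀ := 0) (a₁ := -1 / θ 1 ^ 2) (a₂ := 0)
      (a₃ := 1 / θ 1 ^ 2) (a₄ := 0)
      (fun x => by rw [(score_normalModel hθ x).1, (score_normalModel hθ x).2]; ring)]
    simp
  · simp only [matJ, Matrix.of_apply, Fin.mk_one]
    rw [integral_quartic_mul_normalModel_rpow hθ h1 (a₀ := 1 / θ 1 ^ 2) (a₁ := 0)
      (a₂ := -2 / θ 1 ^ 2) (a₃ := 0) (a₄ := 1 / θ 1 ^ 2)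
      (fun x => by rw [(score_normalModel hθ x).2]; ring)]
    simp; field_simp; ring

lemma matA_normalModel (hθ : 0 < θ 1) (γ : ℝ) :
    matA γ normalModel θ = (1 + γ) • matJ γ normalModel θ := by
  ext i j
  simp only [matA, matJ, Matrix.of_apply, Matrix.smul_apply, smul_eq_mul]
  congr 2; ext x
  rw [partialDeriv_normalModel hθ, partialDeriv_normalModel hθ]
  have : normalModel θ x ^ (1 + γ) = normalModel θ x ^ (γ - 1) * normalModel θ x ^ 2 := by
    rw [← Real.rpow_natCast, ← Real.rpow_add (normalModel_pos hθ x)]; congr 1; push_cast; ring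
  rw [this]; ring

lemma matK_normalModel (β : ℝ) (θ : Fin 2 → ℝ) :
    matK β normalModel θ = matJ (2 * β) normalModel θ -
      Matrix.of fun i j => xi β normalModel θ i * xi β normalModel θ j := by
  ext i j; simp [matK, matJ]

lemma matG_normalNull (μ₀ : ℝ) (θ : Fin 2 → ℝ) : matG (normalNull μ₀) θ = !![1; 0] := by
  ext i j
  fin_cases i <;> fin_cases j
  · simp only [matG, partialDeriv, normalNull, Matrix.of_apply]
    simp
  · simp only [matG, partialDeriv, normalNull, Matrix.of_apply]
    simp

/-- As J is diagonal and G is the first basis vector, the projection in B isolates the location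
entry of J. -/
lemma matB_normalModel (hθ : 0 < θ 1) {β : ℝ} (hβ : 0 ≤ β) (μ₀ : ℝ) :
    matB β normalModel (normalNull μ₀) θ =
      !![(matJ β normalModel θ 0 0)⁻¹, 0; 0, 0] := by
  have hpi : 0 < √(2 * Real.pi) := by have := Real.pi_pos; positivity
  have h1 : 0 < 1 + β := by linarith
  set c := (θ 1)⁻¹ * (√(2 * Real.pi) * θ 1) ^ (-(1 + β)) * (√(2 * Real.pi) / √(1 + β)) with hc
  have hcpos : 0 < c := by positivity
  have hJ : matJ β normalModel θ = Matrix.diagonal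
      ![c * (1 / (1 + β)), c * (1 - 2 / (1 + β) + 3 / (1 + β) ^ 2)] := by
    rw [matJ_normalModel hθ hβ, ← hc]
    ext i j; fin_cases i <;> fin_cases j <;> simp
  -- The scale entry of J is nonzero, being a square plus a positive term.
  have h2 : 0 < 1 - 2 / (1 + β) + 3 / (1 + β) ^ 2 := by
    have : 1 - 2 / (1 + β) + 3 / (1 + β) ^ 2 = (1 - 1 / (1 + β)) ^ 2 + 2 / (1 + β) ^ 2 := by
      field_simp; ring
    rw [this]; positivity
  set j₀ := c * (1 / (1 + β)) with hj0
  set j₁ := c * (1 - 2 / (1 + β) + 3 / (1 + β) ^ 2)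
  have hj0 : j₀ ≠ 0 := by positivity
  have hj1 : j₁ ≠ 0 := by positivity
  have hinv : (matJ β normalModel θ)⁻¹ = !![j₀⁻¹, 0; 0, j₁⁻¹] := by
    apply Matrix.inv_eq_right_inv
    rw [hJ]
    ext i j; fin_cases i <;> fin_cases j <;> simp [Matrix.mul_apply, Fin.sum_univ_two, hj0, hj1]
  have hmid : (Matrix.transpose !![(1 : ℝ); 0] * !![j₀⁻¹, 0; 0, j₁⁻¹] * !![(1 : ℝ); 0])⁻¹ =
      !![j₀] := by
    apply Matrix.inv_eq_right_inv
    ext i j; fin_cases i; fin_cases j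
    simp [Matrix.mul_apply, Fin.sum_univ_two, hj0]
  rw [matB, matG_normalNull, hinv, hmid, hJ]
  ext i j; fin_cases i <;> fin_cases j <;>
    simp [Matrix.mul_apply, Matrix.vecMul, dotProduct, Fin.sum_univ_two, hj0]

lemma normalEigenvalue_pos {σ β γ : ℝ} (hσ : 0 < σ) (hβ : 0 ≤ β) (hγ : 0 ≤ γ) :
    0 < normalEigenvalue σ β γ := by
  unfold normalEigenvalue; have := Real.pi_pos; positivity

lemma matA_matB_matK_matB {μ₀ σ β γ : ℝ} (hσ : 0 < σ) (hβ : 0 ≤ β) (hγ : 0 ≤ γ) :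
    matA γ normalModel ![μ₀, σ] * matB β normalModel (normalNull μ₀) ![μ₀, σ] *
        matK β normalModel ![μ₀, σ] * matB β normalModel (normalNull μ₀) ![μ₀, σ] =
      !![normalEigenvalue σ β γ, 0; 0, 0] := by
  have hθ : 0 < (![μ₀, σ] : Fin 2 → ℝ) 1 := hσ
  rw [matA_normalModel hθ, matB_normalModel hθ hβ, matK_normalModel, matJ_normalModel hθ hβ,
    matJ_normalModel hθ hγ, matJ_normalModel hθ (by positivity : 0 ≤ 2 * β)]
  have hpi : 0 < √(2 * Real.pi) := by have := Real.pi_pos; positivity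
  have hx := (xi_normalModel hθ hβ).1
  ext i j
  fin_cases i <;> fin_cases j
  · simp only [normalEigenvalue, Matrix.mul_apply, Fin.sum_univ_two]
    simp [hx]
    have hA : 0 < √(2 * Real.pi) * σ := by positivity
    have e1 : (√(2 * Real.pi) * σ) ^ (-γ + -1) =
        (√(2 * Real.pi) * σ)⁻¹ * ((2 * Real.pi) ^ (γ / 2))⁻¹ * (σ ^ γ)⁻¹ := by
      rw [Real.rpow_add hA, Real.rpow_neg_one, Real.rpow_neg hA.le, Real.mul_rpow hpi.le hσ.le,
        Real.sqrt_eq_rpow, ← Real.rpow_mul (by positivity)]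
      rw [show (1 / 2 * γ) = γ / 2 by ring, mul_inv]; ring
    have e2 : (√(2 * Real.pi) * σ) ^ (-(2 * β) + -1) =
        (√(2 * Real.pi) * σ)⁻¹ * ((√(2 * Real.pi) * σ) ^ (-β)) ^ 2 := by
      rw [Real.rpow_add hA, Real.rpow_neg_one, ← Real.rpow_natCast, ← Real.rpow_mul hA.le]
      push_cast; rw [mul_comm]; congr 2; ring
    have e3 : (√(2 * Real.pi) * σ) ^ (-β + -1) =
        (√(2 * Real.pi) * σ)⁻¹ * (√(2 * Real.pi) * σ) ^ (-β) := by
      rw [Real.rpow_add hA, Real.rpow_neg_one]; ring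
    have e4 : (2 * β + 1) ^ (3 / 2 : ℝ) = (2 * β + 1) * √(1 + 2 * β) := by
      rw [show (3 / 2 : ℝ) = 1 + 1 / 2 by norm_num, Real.rpow_add (by positivity), Real.rpow_one,
        ← Real.sqrt_eq_rpow, add_comm 1]
    have hp := Real.rpow_pos_of_pos hA (-β)
    have hs := Real.rpow_pos_of_pos hσ γ
    have hpp : 0 < (2 * Real.pi) ^ (γ / 2) := by have := Real.pi_pos; positivity
    have hw : √(2 * Real.pi) = √2 * √Real.pi := Real.sqrt_mul (by norm_num) _
    rw [← hw, e1, e2, e3, e4, add_comm γ 1, add_comm β 1, add_comm (2 * β) 1]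
    -- With the real powers replaced by letters, a rational identity remains, up to the square of
    -- √(1 + β).
    generalize (√(2 * Real.pi) * σ) ^ (-β) = u at hp
    generalize (2 * Real.pi) ^ (γ / 2) = v at hpp
    generalize √(2 * Real.pi) = w at hpi
    have hq := Real.sq_sqrt (show 0 ≤ 1 + β by positivity)
    have hq0 : 0 < √(1 + β) := by positivity
    have hg0 : 0 < √(1 + γ) := by positivity
    have hd0 : 0 < √(1 + 2 * β) := by positivity
    field_simp
    linear_combination hq
  all_goals simp [Matrix.mul_apply, Fin.sum_univ_two]

lemma hasEigenvalue_toLin'_single {l r : ℝ} (hl : l ≠ 0) (hr : r ≠ 0) :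
    Module.End.HasEigenvalue (Matrix.toLin' !![l, 0; 0, 0]) r ↔ r = l := by
  constructor
  · intro h
    obtain ⟨v, hv⟩ := h.exists_hasEigenvector
    have h1 := hv.apply_eq_smul
    have h2 := congrFun h1 0
    have h3 := congrFun h1 1
    simp [Matrix.toLin'_apply, Matrix.mulVec, dotProduct, Fin.sum_univ_two] at h2 h3
    have hv1 : v 1 = 0 := h3.resolve_left hr
    have hv0 : v 0 ≠ 0 := fun h0 => hv.2 (by ext i; fin_cases i <;> simp [h0, hv1])
    rcases h2 with h2 | h2
    · exact h2.symm
    · exact absurd h2 hv0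
  · rintro rfl
    refine Module.End.hasEigenvalue_of_hasEigenvector (x := ![1, 0]) ⟨?_, ?_⟩
    · rw [Module.End.mem_eigenspace_iff]
      ext i; fin_cases i <;>
        simp [Matrix.toLin'_apply, Matrix.mulVec, dotProduct, Fin.sum_univ_two]
    · intro h; simpa using congrFun h 0

end NormalModel

/-! ### Standardized estimating equations and the gradient of the objective -/

section EstimatingEquations

variable {θ : Fin 2 → ℝ} {β : ℝ}

/-- The standardized location component of the estimating function. -/
def locScore (β z : ℝ) : ℝ := z * Real.exp (-(β * z ^ 2 / 2))

/-- The standardized scale component of the estimating function. -/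
def scaleScore (β z : ℝ) : ℝ :=
  (z ^ 2 - 1) * Real.exp (-(β * z ^ 2 / 2)) + β / (1 + β) / √(1 + β)

lemma sqrt_two_pi_mul_pos {s : ℝ} (hs : 0 < s) : 0 < √(2 * Real.pi) * s := by
  have := Real.pi_pos; positivity

lemma integral_normalModel_rpow_one_add (hθ : 0 < θ 1) (hβ : 0 ≤ β) :
    ∫ x, normalModel θ x ^ (1 + β) = (√(2 * Real.pi) * θ 1) ^ (-β) / √(1 + β) := by
  have hA := sqrt_two_pi_mul_pos hθ
  rw [integral_normalModel_rpow hθ (by linarith), neg_add, Real.rpow_add hA, Real.rpow_neg_one]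
  have : √(2 * Real.pi) ≠ 0 := by have := Real.pi_pos; positivity
  field_simp

lemma estimatingFun_loc (hθ : 0 < θ 1) (hβ : 0 ≤ β) (x : ℕ → ℝ) (n : ℕ) :
    estimatingFun β normalModel x n θ 0 = (√(2 * Real.pi) * θ 1) ^ (-β) / θ 1 *
      avg x n (fun y => locScore β ((y - θ 0) / θ 1)) := by
  rw [estimatingFun, (xi_normalModel hθ hβ).1, sub_zero, ← avg_const_mul, avg]
  congr 2; ext k
  rw [(score_normalModel hθ _).1, normalModel_rpow hθ, locScore]
  ring

lemma estimatingFun_scale (hθ : 0 < θ 1) (hβ : 0 ≤ β) (x : ℕ → ℝ) {n : ℕ} (hn : n ≠ 0) :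
    estimatingFun β normalModel x n θ 1 = (√(2 * Real.pi) * θ 1) ^ (-β) / θ 1 *
      avg x n (fun y => scaleScore β ((y - θ 0) / θ 1)) := by
  have hA := sqrt_two_pi_mul_pos hθ
  simp only [scaleScore]
  rw [avg_add, avg_const x hn, mul_add, ← avg_const_mul, estimatingFun, (xi_normalModel hθ hβ).2,
    sub_eq_add_neg, avg]
  congr 1
  · congr 2; ext k
    rw [(score_normalModel hθ _).2, normalModel_rpow hθ]
    ring
  · rw [neg_add, Real.rpow_add hA, Real.rpow_neg_one]
    have : √(2 * Real.pi) ≠ 0 := by have := Real.pi_pos; positivity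
    have : 0 < 1 + β := by linarith
    field_simp; ring

lemma avg_locScore_eq_zero (hθ : 0 < θ 1) (hβ : 0 ≤ β) {x : ℕ → ℝ} {n : ℕ}
    (h : estimatingFun β normalModel x n θ 0 = 0) :
    avg x n (fun y => locScore β ((y - θ 0) / θ 1)) = 0 := by
  rw [estimatingFun_loc hθ hβ] at h
  have := sqrt_two_pi_mul_pos hθ
  exact (mul_eq_zero.1 h).resolve_left (by positivity)

lemma avg_scaleScore_eq_zero (hθ : 0 < θ 1) (hβ : 0 ≤ β) {x : ℕ → ℝ} {n : ℕ} (hn : n ≠ 0)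
    (h : estimatingFun β normalModel x n θ 1 = 0) :
    avg x n (fun y => scaleScore β ((y - θ 0) / θ 1)) = 0 := by
  rw [estimatingFun_scale hθ hβ x hn] at h
  have := sqrt_two_pi_mul_pos hθ
  exact (mul_eq_zero.1 h).resolve_left (by positivity)

lemma objective_of_ne_zero (hθ : 0 < θ 1) (hβ : 0 ≤ β) (hβ0 : β ≠ 0) (x : ℕ → ℝ) (n : ℕ) :
    objective β normalModel x n θ = (√(2 * Real.pi) * θ 1) ^ (-β) *
      (1 / √(1 + β) - (1 + 1 / β) *
        avg x n (fun y => Real.exp (-(β * ((y - θ 0) / θ 1) ^ 2 / 2)))) := by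
  rw [objective, if_neg hβ0, integral_normalModel_rpow_one_add hθ hβ, avg]
  simp_rw [normalModel_rpow hθ, ← Finset.mul_sum]
  ring

lemma objective_zero (hθ : 0 < θ 1) (x : ℕ → ℝ) {n : ℕ} (hn : n ≠ 0) :
    objective 0 normalModel x n θ = Real.log √(2 * Real.pi) + Real.log (θ 1) +
      avg x n (fun y => ((y - θ 0) / θ 1) ^ 2) / 2 := by
  rw [objective, if_pos rfl]
  change - avg x n (fun y => Real.log (normalModel θ y)) = _
  simp_rw [log_normalModel hθ]
  rw [avg_sub, avg_const x hn]
  have : (fun y => ((y - θ 0) / θ 1) ^ 2 / 2) = fun y => 1 / 2 * ((y - θ 0) / θ 1) ^ 2 := by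
    ext y; ring
  rw [this, avg_const_mul]; ring

/-- Needed for the existence of a minimizer on a compact box. The empty sample is separate because
`objective_zero` averages constants, which requires n ≠ 0. -/
lemma continuousOn_objective (hβ : 0 ≤ β) (x : ℕ → ℝ) (n : ℕ) :
    ContinuousOn (objective β normalModel x n) {θ | 0 < θ 1} := by
  rcases eq_or_ne n 0 with rfl | hn
  · have h : Set.EqOn (objective β normalModel x 0)
        (fun θ => if β = 0 then 0 else (√(2 * Real.pi) * θ 1) ^ (-β) / √(1 + β)) {θ | 0 < θ 1} := by
      intro θ hθ
      simp [objective, integral_normalModel_rpow_one_add hθ hβ]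
    refine ContinuousOn.congr ?_ h
    split_ifs
    · exact continuousOn_const
    · refine ContinuousOn.div_const (ContinuousOn.rpow_const (by fun_prop) fun θ hθ => Or.inl ?_) _
      exact (sqrt_two_pi_mul_pos hθ).ne'
  rcases eq_or_ne β 0 with rfl | hβ0
  · refine ContinuousOn.congr ?_ fun θ hθ => objective_zero hθ x hn
    unfold avg
    refine ContinuousOn.add (ContinuousOn.add continuousOn_const
      (ContinuousOn.log (by fun_prop) fun θ hθ => (ne_of_gt hθ))) (ContinuousOn.div_const
      (ContinuousOn.mul continuousOn_const (continuousOn_finsetSum _ fun k _ => ?_)) _)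
    exact (ContinuousOn.div (by fun_prop) (by fun_prop) fun θ hθ => (ne_of_gt hθ)).pow 2
  · refine ContinuousOn.congr ?_ fun θ hθ => objective_of_ne_zero hθ hβ hβ0 x n
    unfold avg
    refine ContinuousOn.mul (ContinuousOn.rpow_const (by fun_prop) fun θ hθ =>
      Or.inl (sqrt_two_pi_mul_pos hθ).ne') (continuousOn_const.sub (continuousOn_const.mul
      (continuousOn_const.mul (continuousOn_finsetSum _ fun k _ =>
        Real.continuous_exp.comp_continuousOn ?_))))
    exact ((continuousOn_const.mul ((ContinuousOn.div (by fun_prop) (by fun_prop)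
      fun θ hθ => (ne_of_gt hθ)).pow 2)).div_const 2).neg

/-- No differentiation under the integral sign is involved: the integral is an explicit power of the
scale and does not depend on the location. -/
lemma hasDerivAt_integral_normalModel_rpow (hθ : 0 < θ 1) (hβ : 0 ≤ β) (i : Fin 2) :
    HasDerivAt (fun t => ∫ y, normalModel (Function.update θ i t) y ^ (1 + β))
      ((1 + β) * xi β normalModel θ i) (θ i) := by
  have he : (fun t => ∫ y, normalModel (Function.update θ i t) y ^ (1 + β)) =ᶠ[𝓝 (θ i)]
      fun t => (√(2 * Real.pi) * Function.update θ i t 1) ^ (-β) / √(1 + β) := by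
    filter_upwards [eventually_update_pos hθ i] with t ht
    exact integral_normalModel_rpow_one_add ht hβ
  refine HasDerivAt.congr_of_eventuallyEq ?_ he
  have hA := sqrt_two_pi_mul_pos hθ
  fin_cases i
  · simp only [Fin.zero_eta, (xi_normalModel hθ hβ).1]
    simpa using hasDerivAt_const (θ 0) ((√(2 * Real.pi) * θ 1) ^ (-β) / √(1 + β))
  · simp only [Fin.mk_one, (xi_normalModel hθ hβ).2, Function.update_self]
    have h := (((hasDerivAt_id (θ 1)).const_mul √(2 * Real.pi)).rpow_const (p := -β)
      (Or.inl hA.ne')).div_const √(1 + β)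
    refine h.congr_deriv ?_
    have : 0 < 1 + β := by linarith
    rw [show -β - 1 = -(1 + β) by ring]
    simp only [id]
    field_simp; ring

lemma hasDerivAt_objective (hθ : 0 < θ 1) (hβ : 0 ≤ β) (x : ℕ → ℝ) (n : ℕ) (i : Fin 2) :
    HasDerivAt (fun t => objective β normalModel x n (Function.update θ i t))
      (-(1 + β) * estimatingFun β normalModel x n θ i) (θ i) := by
  rcases eq_or_ne β 0 with rfl | hβ0
  -- For β = 0 the objective has no integral term; correspondingly the expected score is zero.
  · have hxi : xi 0 normalModel θ i = 0 := by
      fin_cases i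
      · exact (xi_normalModel hθ le_rfl).1
      · simpa using (xi_normalModel hθ le_rfl).2
    simp only [objective, if_true]
    have h := ((HasDerivAt.fun_sum (u := Finset.range n) fun k _ =>
      hasDerivAt_log_normalModel hθ (x k) i).const_mul (1 / (n : ℝ))).neg
    refine h.congr_deriv ?_
    simp [estimatingFun, hxi]
  · simp only [objective, if_neg hβ0]
    have h := (hasDerivAt_integral_normalModel_rpow hθ hβ i).sub
      (((HasDerivAt.fun_sum (u := Finset.range n) fun k _ =>
        hasDerivAt_normalModel_rpow hθ (x k) β i).const_mul (1 / (n : ℝ))).const_mul (1 + 1 / β))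
    refine h.congr_deriv ?_
    rw [← Finset.mul_sum, estimatingFun]
    field_simp; ring

/-- The estimating equations hold at a minimizer, in each coordinate direction that can be varied
inside the set over which one minimizes. -/
lemma estimatingFun_eq_zero_of_isMinOn (hθ : 0 < θ 1) (hβ : 0 ≤ β) {x : ℕ → ℝ} {n : ℕ}
    {S : Set (Fin 2 → ℝ)} (hmin : IsMinOn (objective β normalModel x n) S θ) (i : Fin 2)
    (hS : ∀ᶠ t in 𝓝 (θ i), Function.update θ i t ∈ S) :
    estimatingFun β normalModel x n θ i = 0 := by
  have hloc : IsLocalMin (fun t => objective β normalModel x n (Function.update θ i t)) (θ i) := by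
    filter_upwards [hS] with t ht
    simpa using hmin ht
  have h := hloc.hasDerivAt_eq_zero (hasDerivAt_objective hθ hβ x n i)
  exact (mul_eq_zero.1 h).resolve_left (by linarith)

end EstimatingEquations

/-! ### Closed form and measurability of the divergence -/

section Divergence

variable {θ θ' : Fin 2 → ℝ} {γ : ℝ}

/-- In the variable standardized by θ, the factor with θ' is a shifted Gaussian weight of precision
γ (σ/σ')², so `integral_exp_mul_exp` applies. -/
lemma integral_normalModel_rpow_mul (hθ : 0 < θ 1) (hθ' : 0 < θ' 1) (hγ : 0 ≤ γ) :
    Integrable (fun x => normalModel θ' x ^ γ * normalModel θ x) ∧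
    ∫ x, normalModel θ' x ^ γ * normalModel θ x = (√(2 * Real.pi) * θ' 1) ^ (-γ) *
      (1 / √(1 + γ * (θ 1 / θ' 1) ^ 2) * Real.exp (-(γ * ((θ 0 - θ' 0) / θ' 1) ^ 2 /
        (2 * (1 + γ * (θ 1 / θ' 1) ^ 2))))) := by
  have hp : 0 ≤ γ * (θ 1 / θ' 1) ^ 2 := by positivity
  obtain ⟨hi, hv⟩ := integral_exp_mul_exp hp (-(θ 0 - θ' 0) / θ 1)
  have he : (fun x => normalModel θ' x ^ γ * normalModel θ x) = fun x =>
      (fun z => (√(2 * Real.pi) * θ' 1) ^ (-γ) *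
        Real.exp (-(γ * (θ 1 / θ' 1) ^ 2 * (z - -(θ 0 - θ' 0) / θ 1) ^ 2 / 2)))
        ((x - θ 0) / θ 1) * normalModel θ x ^ (1 : ℝ) := by
    ext x
    rw [normalModel_rpow hθ', Real.rpow_one]
    congr 3
    field_simp; ring
  have hi' : Integrable fun z => (√(2 * Real.pi) * θ' 1) ^ (-γ) *
        Real.exp (-(γ * (θ 1 / θ' 1) ^ 2 * (z - -(θ 0 - θ' 0) / θ 1) ^ 2 / 2)) *
          Real.exp (-(1 * z ^ 2 / 2)) := by
    refine (hi.const_mul ((√(2 * Real.pi) * θ' 1) ^ (-γ))).congr (Eventually.of_forall fun z => ?_)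
    simp only [one_mul]; ring
  rw [he]
  refine ⟨integrable_mul_normalModel_rpow hθ hi', ?_⟩
  rw [integral_mul_normalModel_rpow hθ (fun z => (√(2 * Real.pi) * θ' 1) ^ (-γ) *
    Real.exp (-(γ * (θ 1 / θ' 1) ^ 2 * (z - -(θ 0 - θ' 0) / θ 1) ^ 2 / 2)))]
  simp only [one_mul, mul_assoc]
  simp only [mul_assoc] at hv
  rw [integral_const_mul, hv, Real.rpow_neg_one]
  have hw : √(2 * Real.pi) ≠ 0 := by have := Real.pi_pos; positivity
  have hexp : -(γ * ((θ 1 / θ' 1) ^ 2 * (-(θ 0 - θ' 0) / θ 1) ^ 2) /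
      (2 * (1 + γ * (θ 1 / θ' 1) ^ 2))) = -(γ * ((θ 0 - θ' 0) / θ' 1) ^ 2 /
        (2 * (1 + γ * (θ 1 / θ' 1) ^ 2))) := by
    congr 2; field_simp
  rw [hexp]
  field_simp

lemma integrable_normalModel_rpow (hθ : 0 < θ 1) {q : ℝ} (hq : 0 < q) :
    Integrable fun x => normalModel θ x ^ q := by
  have := integrable_mul_normalModel_rpow hθ (F := fun _ => 1) (q := q)
    ((integrable_pow_mul_exp 0 hq).congr (Eventually.of_forall fun z => by simp))
  simpa using this

lemma divergence_normalModel (hθ : 0 < θ 1) (hθ' : 0 < θ' 1) (hγ : 0 ≤ γ) (hγ0 : γ ≠ 0) :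
    divergence γ (normalModel θ) (normalModel θ') = (√(2 * Real.pi) * θ' 1) ^ (-γ) *
      ((1 + 1 / γ * (θ 1 / θ' 1) ^ (-γ)) / √(1 + γ) - (1 + 1 / γ) *
        (1 / √(1 + γ * (θ 1 / θ' 1) ^ 2) * Real.exp (-(γ * ((θ 0 - θ' 0) / θ' 1) ^ 2 /
          (2 * (1 + γ * (θ 1 / θ' 1) ^ 2)))))) := by
  obtain ⟨hi, hv⟩ := integral_normalModel_rpow_mul hθ hθ' hγ
  have h1 := integrable_normalModel_rpow hθ' (q := 1 + γ) (by linarith)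
  have h2 := (integrable_normalModel_rpow hθ (q := 1 + γ) (by linarith)).const_mul (1 / γ)
  rw [divergence, if_neg hγ0]
  simp_rw [mul_assoc (1 + 1 / γ)]
  have h12 : Integrable fun x => normalModel θ' x ^ (1 + γ) -
      (1 + 1 / γ) * (normalModel θ' x ^ γ * normalModel θ x) := h1.sub (hi.const_mul _)
  rw [integral_add h12 h2, integral_sub h1 (hi.const_mul _),
    integral_const_mul, integral_const_mul, hv, integral_normalModel_rpow_one_add hθ hγ,
    integral_normalModel_rpow_one_add hθ' hγ]
  have hs : (√(2 * Real.pi) * θ 1) ^ (-γ) =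
      (√(2 * Real.pi) * θ' 1) ^ (-γ) * (θ 1 / θ' 1) ^ (-γ) := by
    rw [← Real.mul_rpow (sqrt_two_pi_mul_pos hθ').le (by positivity)]
    congr 1; field_simp
  rw [hs]; ring

/-- The log-ratio of two normal densities is a quadratic polynomial in the standardized variable, so
only Gaussian moments enter. -/
lemma divergence_zero_normalModel (hθ : 0 < θ 1) (hθ' : 0 < θ' 1) :
    divergence 0 (normalModel θ) (normalModel θ') =
      ((θ 1 / θ' 1) ^ 2 - 1 - 2 * Real.log (θ 1 / θ' 1) + ((θ 0 - θ' 0) / θ' 1) ^ 2) / 2 := by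
  rw [divergence, if_pos rfl]
  have h := integral_quartic_mul_normalModel_rpow hθ one_pos
    (F := fun x => Real.log (normalModel θ x / normalModel θ' x))
    (a₀ := -Real.log (θ 1 / θ' 1) + ((θ 0 - θ' 0) / θ' 1) ^ 2 / 2)
    (a₁ := (θ 1 / θ' 1) * ((θ 0 - θ' 0) / θ' 1)) (a₂ := ((θ 1 / θ' 1) ^ 2 - 1) / 2)
    (a₃ := 0) (a₄ := 0) (fun x => by
      rw [Real.log_div (normalModel_pos hθ x).ne' (normalModel_pos hθ' x).ne', log_normalModel hθ,
        log_normalModel hθ', Real.log_div hθ.ne' hθ'.ne']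
      field_simp; ring)
  simp only [Real.rpow_one] at h
  simp_rw [mul_comm (normalModel θ _)]
  rw [h, Real.rpow_neg_one]
  have hw : √(2 * Real.pi) ≠ 0 := by have := Real.pi_pos; positivity
  simp only [Real.sqrt_one]
  field_simp; ring

lemma measurable_normalModel {α : Type*} [MeasurableSpace α] {a : α → Fin 2 → ℝ} {b : α → ℝ}
    (ha : Measurable a) (hb : Measurable b) : Measurable fun q => normalModel (a q) (b q) := by
  have h : Measurable fun q => (a q 0, Real.toNNReal (a q 1 ^ 2), b q) := by fun_prop
  exact measurable_uncurry_gaussianPDFReal.comp h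

/-- The statistic is a parametric integral of a jointly measurable function; Slutsky's theorem needs
this measurability. -/
lemma measurable_testStat {Ω : Type*} [MeasurableSpace Ω] {est est₀ : ℕ → Ω → Fin 2 → ℝ}
    (h : ∀ n, Measurable (est n)) (h₀ : ∀ n, Measurable (est₀ n)) (n : ℕ) :
    Measurable (testStat γ normalModel est est₀ n) := by
  have m1 : Measurable fun q : Ω × ℝ => normalModel (est n q.1) q.2 :=
    measurable_normalModel ((h n).comp measurable_fst) measurable_snd
  have m2 : Measurable fun q : Ω × ℝ => normalModel (est₀ n q.1) q.2 :=
    measurable_normalModel ((h₀ n).comp measurable_fst) measurable_snd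
  have hd : Measurable fun ω => divergence γ (normalModel (est n ω)) (normalModel (est₀ n ω)) := by
    unfold divergence
    by_cases hγ : γ = 0
    · have hm : Measurable fun q : Ω × ℝ => normalModel (est n q.1) q.2 *
          Real.log (normalModel (est n q.1) q.2 / normalModel (est₀ n q.1) q.2) :=
        m1.mul (Real.measurable_log.comp (m1.div m2))
      simp only [hγ, if_true]
      exact hm.stronglyMeasurable.integral_prod_right'.measurable
    · have hm : Measurable fun q : Ω × ℝ => normalModel (est₀ n q.1) q.2 ^ (1 + γ) -
          (1 + 1 / γ) * normalModel (est₀ n q.1) q.2 ^ γ * normalModel (est n q.1) q.2 +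
          1 / γ * normalModel (est n q.1) q.2 ^ (1 + γ) :=
        ((m2.pow_const _).sub (((m2.pow_const _).const_mul _).mul m1)).add
          ((m1.pow_const _).const_mul _)
      simp only [hγ, if_false]
      exact hm.stronglyMeasurable.integral_prod_right'.measurable
  exact hd.const_mul _

end Divergence

/-! ### Strict positivity of the objective gap -/

section Positivity

/-- Strict positivity of the standardized population objective gap, away from the true value. -/
lemma population_gap_pos {β m τ : ℝ} (hβ : 0 < β) (hτ : 0 < τ) (h : m ≠ 0 ∨ τ ≠ 1) :
    0 < 1 / √(1 + β) - (1 + 1 / β) * (1 / √(1 + β / τ ^ 2) *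
      Real.exp (-(β / τ ^ 2 * m ^ 2 / (2 * (1 + β / τ ^ 2))))) +
      τ ^ β * (1 / √(1 + β) / β) := by
  have h1 : 0 < 1 + β := by linarith
  have hr : 0 < √(1 + β) := by positivity
  have hp0 : 0 < 1 / (1 + β) := by positivity
  have hp1 : 1 / (1 + β) < 1 := by rw [div_lt_one h1]; linarith
  have hτβ : 0 < τ ^ β := by positivity
  -- Up to a positive factor the gap is (β + τ ^ β) / (1 + β) - √((1 + β) / c) E, with c and E as
  -- set below. The number u separates the two terms. Bernoulli's inequality with exponent 1 / (1 +
  -- β) bounds u above through τ ^ β; applied to τ ^ 2 it bounds y above and hence, as u ^ 2 * y = τ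
  -- ^ 2, u below.
  set u : ℝ := (τ ^ β) ^ (1 / (1 + β)) with hu
  set y : ℝ := (τ ^ 2) ^ (1 / (1 + β)) with hy
  have hupos : 0 < u := by positivity
  have hypos : 0 < y := by positivity
  have huy : u ^ 2 * y = τ ^ 2 := by
    rw [hu, hy, ← Real.rpow_natCast, ← Real.rpow_natCast τ 2, ← Real.rpow_mul hτ.le,
      ← Real.rpow_mul hτ.le, ← Real.rpow_mul hτ.le, ← Real.rpow_add hτ]
    congr 1; push_cast; field_simp; ring
  have hu1 : u ≤ 1 + 1 / (1 + β) * (τ ^ β - 1) := by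
    have := rpow_one_add_le_one_add_mul_self (s := τ ^ β - 1) (by linarith) hp0.le hp1.le
    simpa [hu] using this
  have hy1 : y ≤ 1 + 1 / (1 + β) * (τ ^ 2 - 1) := by
    have := rpow_one_add_le_one_add_mul_self (s := τ ^ 2 - 1) (by nlinarith) hp0.le hp1.le
    simpa [hy] using this
  have hy2 : τ ≠ 1 → y < 1 + 1 / (1 + β) * (τ ^ 2 - 1) := fun hne => by
    have := rpow_one_add_lt_one_add_mul_self (s := τ ^ 2 - 1) (by nlinarith)
      (by intro h0; apply hne; nlinarith [sq_nonneg (τ - 1)]) hp0 hp1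
    simpa [hy] using this
  set c : ℝ := 1 + β / τ ^ 2 with hc
  have hcpos : 0 < c := by positivity
  have hcy : 1 + 1 / (1 + β) * (τ ^ 2 - 1) = c * τ ^ 2 / (1 + β) := by
    rw [hc]; field_simp; ring
  rw [hcy] at hy1 hy2
  have hle : √(1 + β) / √c ≤ u := by
    rw [← Real.sqrt_div h1.le, Real.sqrt_le_left hupos.le, div_le_iff₀ hcpos]
    have h3 : u ^ 2 * y ≤ u ^ 2 * (c * τ ^ 2 / (1 + β)) := by gcongr
    rw [huy, ← mul_div_assoc, le_div_iff₀ h1] at h3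
    have : 0 < τ ^ 2 := by positivity
    nlinarith
  have hlt : τ ≠ 1 → √(1 + β) / √c < u := fun hne => by
    rw [← Real.sqrt_div h1.le, Real.sqrt_lt' hupos, div_lt_iff₀ hcpos]
    have h3 : u ^ 2 * y < u ^ 2 * (c * τ ^ 2 / (1 + β)) :=
      mul_lt_mul_of_pos_left (hy2 hne) (by positivity)
    rw [huy, ← mul_div_assoc, lt_div_iff₀ h1] at h3
    have : 0 < τ ^ 2 := by positivity
    nlinarith
  set E : ℝ := Real.exp (-(β / τ ^ 2 * m ^ 2 / (2 * c))) with hE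
  have hEpos : 0 < E := Real.exp_pos _
  have hE1 : E ≤ 1 := by
    rw [hE, Real.exp_le_one_iff]
    have : 0 ≤ β / τ ^ 2 * m ^ 2 / (2 * c) := by positivity
    linarith
  have hq : 0 < √(1 + β) / √c := by positivity
  -- Strictness comes from the exponential factor when τ = 1, and from strict Bernoulli otherwise.
  have key : √(1 + β) / √c * E < u := by
    by_cases hne : τ = 1
    · have hm : m ≠ 0 := h.resolve_right (by simpa using hne)
      have hE2 : E < 1 := by
        rw [hE, Real.exp_lt_one_iff]
        have : 0 < β / τ ^ 2 * m ^ 2 / (2 * c) := by positivity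
        linarith
      nlinarith
    · have := hlt hne
      nlinarith
  have key2 : √(1 + β) / √c * E < 1 + 1 / (1 + β) * (τ ^ β - 1) := key.trans_le hu1
  have hfin : 1 / √(1 + β) - (1 + 1 / β) * (1 / √c * E) + τ ^ β * (1 / √(1 + β) / β) =
      (1 + β) / (β * √(1 + β)) *
        (1 + 1 / (1 + β) * (τ ^ β - 1) - √(1 + β) / √c * E) := by
    field_simp; ring
  rw [hfin]
  have : 0 < 1 + 1 / (1 + β) * (τ ^ β - 1) - √(1 + β) / √c * E := by linarith
  positivity

/-- The log-likelihood gap is positive away from the true value as soon as the first two sample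
moments are close to those of the standard normal distribution. -/
lemma loglik_gap_pos {ε : ℝ} (hε : 0 < ε) : ∃ κ > 0, ∀ z q m τ : ℝ, |z| < κ → |q - 1| < κ →
    0 < τ → (ε ≤ |m| ∨ ε ≤ |τ - 1|) →
    0 < 2 * Real.log τ + (q - 2 * m * z + m ^ 2) / τ ^ 2 - q := by
  -- For |τ - 1| ≥ ε one has τ² + 1 ≤ 2 (τ - 1)² + 3 ≤ (2 + 3/ε²)(τ - 1)², which gives this c. The d
  -- below is 1 - 1 / (1 + ε²/4), the gain when |m| ≥ ε.
  set c : ℝ := 1 / (2 + 3 / ε ^ 2) with hc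
  have hcpos : 0 < c := by positivity
  set d : ℝ := ε ^ 2 / 4 / (1 + ε ^ 2 / 4) with hd
  have hdpos : 0 < d := by positivity
  refine ⟨min (min (ε / 4) (ε ^ 2 / 4)) (min (min 1 (c / 2)) d), by positivity, ?_⟩
  intro z q m τ hz hq hτ h
  simp only [lt_min_iff] at hz hq
  obtain ⟨⟨hz1, hz2⟩, ⟨hz3, hz4⟩, hz5⟩ := hz
  obtain ⟨⟨hq1, hq2⟩, ⟨hq3, hq4⟩, hq5⟩ := hq
  set w : ℝ := 1 / τ with hw
  have hwpos : 0 < w := by positivity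
  have hlog : 2 - 2 * w ≤ 2 * Real.log τ := by
    have := Real.log_le_sub_one_of_pos hwpos
    rw [hw, Real.log_div one_ne_zero hτ.ne', Real.log_one, zero_sub] at this
    linarith
  set A : ℝ := q - 2 * m * z + m ^ 2 with hA
  have hAw : A / τ ^ 2 = A * w ^ 2 := by rw [hw]; field_simp
  rw [hAw]
  rw [abs_lt] at hq1 hq2 hq3 hq4 hq5 hz3
  rcases h with h | h
  · have hA1 : 1 + ε ^ 2 / 4 ≤ A := by
      have h1 : m * z ≤ |m| * (ε / 4) := (le_abs_self _).trans (by rw [abs_mul]; gcongr)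
      have h2 : m ^ 2 = |m| ^ 2 := (sq_abs m).symm
      nlinarith [abs_nonneg m]
    have hApos : 0 < A := by nlinarith
    -- Completing the square in w gives A w² - 2w ≥ -1/A, uniformly in the scale.
    have h3 : 0 ≤ (A * w - 1) ^ 2 / A := by positivity
    have h4 : (A * w - 1) ^ 2 / A = A * w ^ 2 - 2 * w + 1 / A := by field_simp; ring
    have h5 : 1 / A ≤ 1 / (1 + ε ^ 2 / 4) := one_div_le_one_div_of_le (by positivity) hA1
    have h6 : 1 / (1 + ε ^ 2 / 4) = 1 - d := by rw [hd]; field_simp; ring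
    linarith
  · have hz2' : z ^ 2 ≤ |z| := by
      rw [← sq_abs]; nlinarith [abs_nonneg z, abs_lt.2 hz3]
    -- Minimizing A over m leaves q - z², so the bound is uniform in the location.
    have hA1 : q - |z| ≤ A := by nlinarith [sq_nonneg (m - z)]
    have h1 : c * (1 + w ^ 2) ≤ (w - 1) ^ 2 := by
      have h2 : (w - 1) ^ 2 = (τ - 1) ^ 2 / τ ^ 2 := by rw [hw]; field_simp; ring
      have h3 : 1 + w ^ 2 = (τ ^ 2 + 1) / τ ^ 2 := by rw [hw]; field_simp
      rw [h2, h3, hc, ← mul_div_assoc]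
      gcongr
      rw [div_mul_eq_mul_div, one_mul, div_le_iff₀ (by positivity)]
      have h4 : ε ^ 2 ≤ (τ - 1) ^ 2 := by rw [← sq_abs (τ - 1)]; gcongr
      have h5 : 3 ≤ (τ - 1) ^ 2 * (3 / ε ^ 2) := by
        rw [← mul_div_assoc, le_div_iff₀ (by positivity)]; linarith
      nlinarith [sq_nonneg (τ - 2)]
    nlinarith [sq_nonneg w]

end Positivity

/-! ### Uniform separation of the sample objective from its value at the truth -/

section Separation

variable {Ω : Type*} [MeasurableSpace Ω] {P : Measure Ω} [IsProbabilityMeasure P]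
  {Z : ℕ → Ω → ℝ} {β : ℝ}

lemma measurable_exp_neg_sq (β : ℝ) : Measurable fun z : ℝ => Real.exp (-(β * z ^ 2 / 2)) := by
  fun_prop

/-- The standardized sample objective gap. -/
def sampleGap (β : ℝ) (x : ℕ → ℝ) (n : ℕ) (m τ : ℝ) : ℝ :=
  1 / √(1 + β) - (1 + 1 / β) * avg x n (fun z => Real.exp (-(β * ((z - m) / τ) ^ 2 / 2))) +
    τ ^ β * ((1 + 1 / β) * avg x n (fun z => Real.exp (-(β * z ^ 2 / 2))) - 1 / √(1 + β))

/-- This is the coefficient of τ ^ β in `sampleGap`. Its limit is positive, so it makes the gap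
increase with the scale. -/
lemma tendsto_avg_exp (hZ : ∀ k, Measurable (Z k)) (hindep : iIndepFun Z P)
    (hlaw : ∀ k, P.map (Z k) = gaussianReal 0 1) (hβ : 0 < β) :
    Tendsto (fun p : ℕ × Ω => (1 + 1 / β) *
      avg (fun k => Z k p.2) p.1 (fun z => Real.exp (-(β * z ^ 2 / 2))) - 1 / √(1 + β))
      (inProb P) (𝓝 (1 / √(1 + β) / β)) := by
  obtain ⟨hi, hv⟩ := integral_stdGaussian_quartic hβ.le 1 0 0 0 0
  simp only [zero_mul, add_zero, one_mul, mul_zero, zero_div] at hi hv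
  have h := ((tendsto_avg hZ hindep hlaw (measurable_exp_neg_sq β) hi).const_mul
    (1 + 1 / β)).sub_const (1 / √(1 + β))
  rw [hv] at h
  convert! h using 2
  field_simp; ring

/-- A dominating function that is uniformly close to the extended weight function around a point
of the closed parameter half-plane. -/
def weightBound (β m τ δ z : ℝ) : ℝ :=
  Real.exp (-(β * (max 0 (|z - m| - δ) / (τ + δ)) ^ 2 / 2))

/-- Moving the centre by at most δ shortens the distance to it by at most δ, and enlarging the scale
only raises the weight. -/
lemma weight_le_weightBound (hβ : 0 ≤ β) {m τ δ m' τ' : ℝ} (hm : |m' - m| ≤ δ) (hτ' : 0 < τ')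
    (hτ : τ' ≤ τ + δ) (z : ℝ) :
    Real.exp (-(β * ((z - m') / τ') ^ 2 / 2)) ≤ weightBound β m τ δ z := by
  have h1 : max 0 (|z - m| - δ) ≤ |z - m'| := by
    refine max_le (abs_nonneg _) ?_
    have : |z - m| ≤ |z - m'| + |m' - m| := by
      simpa using abs_sub_le z m' m
    linarith
  have h2 : max 0 (|z - m| - δ) / (τ + δ) ≤ |(z - m') / τ'| := by
    rw [abs_div, abs_of_pos hτ']
    gcongr
  unfold weightBound
  rw [← sq_abs ((z - m') / τ')]
  gcongr
  exact div_nonneg (le_max_left _ _) (hτ'.le.trans hτ)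

lemma measurable_weightBound (β m τ δ : ℝ) : Measurable (weightBound β m τ δ) := by
  unfold weightBound; fun_prop

lemma weightBound_le_one (hβ : 0 ≤ β) (m τ δ z : ℝ) : |weightBound β m τ δ z| ≤ 1 := by
  unfold weightBound
  rw [abs_of_pos (Real.exp_pos _), Real.exp_le_one_iff]
  have : 0 ≤ β * (max 0 (|z - m| - δ) / (τ + δ)) ^ 2 / 2 := by positivity
  linarith

lemma integrable_of_abs_le_one {ν : Measure ℝ} [IsFiniteMeasure ν] {g : ℝ → ℝ}
    (hg : Measurable g) (h : ∀ z, |g z| ≤ 1) : Integrable g ν :=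
  Integrable.of_bound hg.aestronglyMeasurable 1 (Eventually.of_forall h)

lemma tendsto_exp_neg_sq_atTop (hβ : 0 < β) {l : Filter ℝ} {f : ℝ → ℝ} (hf : Tendsto f l atTop) :
    Tendsto (fun t => Real.exp (-(β * f t ^ 2 / 2))) l (𝓝 0) := by
  refine Real.tendsto_exp_neg_atTop_nhds_zero.comp ?_
  exact (((tendsto_pow_atTop two_ne_zero).comp hf).const_mul_atTop hβ).atTop_div_const two_pos

/-- The limit of `∫ weightBound` as the neighbourhood shrinks. -/
lemma tendsto_integral_weightBound (hβ : 0 < β) (m : ℝ) {τ : ℝ} (hτ : 0 ≤ τ) :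
    Tendsto (fun δ => ∫ z, weightBound β m τ δ z ∂gaussianReal 0 1) (𝓝[>] 0)
      (𝓝 (if τ = 0 then 0 else 1 / √(1 + β / τ ^ 2) *
        Real.exp (-(β / τ ^ 2 * m ^ 2 / (2 * (1 + β / τ ^ 2)))))) := by
  have hdom : ∀ f : ℝ → ℝ, (∀ᵐ z ∂gaussianReal 0 1,
      Tendsto (fun δ => weightBound β m τ δ z) (𝓝[>] 0) (𝓝 (f z))) →
      Tendsto (fun δ => ∫ z, weightBound β m τ δ z ∂gaussianReal 0 1) (𝓝[>] 0)
        (𝓝 (∫ z, f z ∂gaussianReal 0 1)) := fun f hf =>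
    tendsto_integral_filter_of_dominated_convergence (fun _ => 1)
      (Eventually.of_forall fun δ => (measurable_weightBound β m τ δ).aestronglyMeasurable)
      (Eventually.of_forall fun δ => Eventually.of_forall (weightBound_le_one hβ.le m τ δ))
      (integrable_const _) hf
  split_ifs with h0
  -- On the boundary τ = 0 the weights shrink to zero off the single point m, which is a Gaussian
  -- null set.
  · subst h0
    have hne : ∀ᵐ z ∂gaussianReal 0 1, z ≠ m := by
      have := nullSingletonClass_gaussianReal (μ := 0) one_ne_zero
      exact measure_eq_zero_iff_ae_notMem.1 (measure_singleton (μ := gaussianReal 0 1) m)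
    have h := hdom (fun _ => 0) ?_
    · simpa using h
    filter_upwards [hne] with z hz
    have hpos : 0 < |z - m| := abs_pos.2 (sub_ne_zero.2 hz)
    refine tendsto_exp_neg_sq_atTop hβ ?_
    have h1 : Tendsto (fun δ : ℝ => |z - m| * δ⁻¹ - 1) (𝓝[>] 0) atTop :=
      tendsto_atTop_add_const_right _ _ (tendsto_inv_nhdsGT_zero.const_mul_atTop hpos)
    refine tendsto_atTop_mono' _ ?_ h1
    filter_upwards [self_mem_nhdsWithin] with δ hδ
    have hδ' : (0 : ℝ) < δ := hδ
    have h2 : |z - m| * δ⁻¹ - 1 = (|z - m| - δ) / (0 + δ) := by field_simp; ring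
    rw [h2]
    gcongr
    exact le_max_right _ _
  · have hτpos : 0 < τ := lt_of_le_of_ne hτ (Ne.symm h0)
    have hlim : ∫ z, Real.exp (-(β / τ ^ 2 * (z - m) ^ 2 / 2)) ∂gaussianReal 0 1 =
        1 / √(1 + β / τ ^ 2) * Real.exp (-(β / τ ^ 2 * m ^ 2 / (2 * (1 + β / τ ^ 2)))) := by
      rw [integral_stdGaussian, (integral_exp_mul_exp (by positivity) m).2]
      have : √(2 * Real.pi) ≠ 0 := by have := Real.pi_pos; positivity
      field_simp
    rw [← hlim]
    refine hdom _ (Eventually.of_forall fun z => ?_)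
    have hcont : ContinuousAt (fun δ => weightBound β m τ δ z) 0 := by
      unfold weightBound
      refine Real.continuous_exp.continuousAt.comp ?_
      refine ((continuousAt_const.mul ((ContinuousAt.div (by fun_prop) (by fun_prop)
        (by simpa using hτpos.ne')).pow 2)).div_const 2).neg
    have h := hcont.tendsto.mono_left (nhdsWithin_le_nhds (s := Set.Ioi 0))
    convert! h using 2
    simp only [weightBound, sub_zero, add_zero, max_eq_right (abs_nonneg (z - m)), div_pow, sq_abs]
    ring_nf

variable (hZ : ∀ k, Measurable (Z k)) (hindep : iIndepFun Z P)
  (hlaw : ∀ k, P.map (Z k) = gaussianReal 0 1)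

include hZ hindep hlaw

/-- Wald's local step: replacing the weight by its envelope and τ' ^ β by its infimum reduces a
whole neighbourhood to the law of large numbers for fixed functions. As δ decreases to 0 the
resulting limit tends to the population gap, which is positive. -/
lemma sampleGap_pos_nhds (hβ : 0 < β) {m τ : ℝ} (hτ : 0 ≤ τ) (h : m ≠ 0 ∨ τ ≠ 1) :
    ∃ δ > 0, ∀ᶠ p in inProb P, ∀ m' τ', |m' - m| < δ → |τ' - τ| < δ → 0 < τ' →
      0 < sampleGap β (fun k => Z k p.2) p.1 m' τ' := by
  have hc0 : 0 < 1 / √(1 + β) / β := by positivity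
  have hlim : Tendsto (fun δ => 1 / √(1 + β) - (1 + 1 / β) *
      (∫ z, weightBound β m τ δ z ∂gaussianReal 0 1) +
      (max 0 (τ - δ)) ^ β * (1 / √(1 + β) / β)) (𝓝[>] 0)
      (𝓝 (1 / √(1 + β) - (1 + 1 / β) * (if τ = 0 then 0 else 1 / √(1 + β / τ ^ 2) *
        Real.exp (-(β / τ ^ 2 * m ^ 2 / (2 * (1 + β / τ ^ 2))))) +
        τ ^ β * (1 / √(1 + β) / β))) := by
    refine ((tendsto_integral_weightBound hβ m hτ).const_mul _).const_sub _ |>.add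
      (Tendsto.mul_const _ ?_)
    have hcont : ContinuousAt (fun δ : ℝ => (max 0 (τ - δ)) ^ β) 0 :=
      ContinuousAt.rpow_const (by fun_prop) (Or.inr hβ.le)
    have h := hcont.tendsto.mono_left (nhdsWithin_le_nhds (s := Set.Ioi 0))
    simpa [max_eq_right hτ] using h
  have hpos : 0 < 1 / √(1 + β) - (1 + 1 / β) * (if τ = 0 then 0 else 1 / √(1 + β / τ ^ 2) *
        Real.exp (-(β / τ ^ 2 * m ^ 2 / (2 * (1 + β / τ ^ 2))))) +
        τ ^ β * (1 / √(1 + β) / β) := by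
    split_ifs with h0
    · rw [h0, Real.zero_rpow hβ.ne']; simp; positivity
    · exact population_gap_pos hβ (lt_of_le_of_ne hτ (Ne.symm h0)) h
  obtain ⟨δ, hδpos, hδ⟩ := ((hlim.eventually (lt_mem_nhds hpos)).and self_mem_nhdsWithin).exists.imp
    fun δ h => And.symm h
  refine ⟨δ, hδpos, ?_⟩
  have hc := tendsto_avg_exp hZ hindep hlaw hβ
  have hU := tendsto_avg hZ hindep hlaw (measurable_weightBound β m τ δ)
    (integrable_of_abs_le_one (measurable_weightBound β m τ δ) (weightBound_le_one hβ.le m τ δ))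
  have hall := ((hU.const_mul (1 + 1 / β)).const_sub (1 / √(1 + β))).add
    (hc.const_mul ((max 0 (τ - δ)) ^ β))
  filter_upwards [hc.eventually (lt_mem_nhds hc0), hall.eventually (lt_mem_nhds hδ)]
    with p hp1 hp2 m' τ' hm' hτ' hτ'0
  refine hp2.trans_le ?_
  unfold sampleGap
  rw [abs_lt] at hτ'
  have h1 := avg_mono (fun k => Z k p.2) p.1
    (weight_le_weightBound hβ.le (τ := τ) hm'.le hτ'0 (by linarith))
  have h2 : (max 0 (τ - δ)) ^ β ≤ τ' ^ β :=
    Real.rpow_le_rpow (le_max_left _ _) (max_le hτ'0.le (by linarith)) hβ.le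
  gcongr

/-- The average of weights is at most 1 whatever the location, while the term in τ ^ β grows without
bound. -/
lemma sampleGap_pos_of_large_scale (hβ : 0 < β) :
    ∃ T > 0, ∀ᶠ p in inProb P, ∀ m τ, T ≤ τ →
      0 < sampleGap β (fun k => Z k p.2) p.1 m τ := by
  have hc0 : 0 < 1 / √(1 + β) / β := by positivity
  -- Beyond T, half the limiting coefficient times τ ^ β already outweighs 1 + 1 / β.
  obtain ⟨T, hT1, hT0⟩ := (((tendsto_rpow_atTop hβ).eventually_ge_atTop
    ((1 + 1 / β) / (1 / √(1 + β) / β / 2))).and (eventually_gt_atTop 0)).exists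
  refine ⟨T, hT0, ?_⟩
  have hc := tendsto_avg_exp hZ hindep hlaw hβ
  filter_upwards [hc.eventually (lt_mem_nhds (half_lt_self hc0)),
    tendsto_fst_inProb.eventually (eventually_ne_atTop 0)] with p hp hn m τ hτ
  unfold sampleGap
  have h1 : avg (fun k => Z k p.2) p.1 (fun z => Real.exp (-(β * ((z - m) / τ) ^ 2 / 2))) ≤ 1 := by
    have h := avg_mono (fun k => Z k p.2) p.1
      (g := fun z => Real.exp (-(β * ((z - m) / τ) ^ 2 / 2))) (h := fun _ => 1) (fun z => by
        rw [Real.exp_le_one_iff]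
        have : 0 ≤ β * ((z - m) / τ) ^ 2 / 2 := by positivity
        linarith)
    rwa [avg_const _ hn] at h
  have h2 : (1 + 1 / β) / (1 / √(1 + β) / β / 2) ≤ τ ^ β :=
    hT1.trans (Real.rpow_le_rpow hT0.le hτ hβ.le)
  rw [div_le_iff₀ (by positivity)] at h2
  have h3 : (1 + 1 / β) * avg (fun k => Z k p.2) p.1
      (fun z => Real.exp (-(β * ((z - m) / τ) ^ 2 / 2))) ≤ (1 + 1 / β) * 1 := by gcongr
  have h4 : 0 < τ ^ β := Real.rpow_pos_of_pos (hT0.trans_le hτ) _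
  have h5 := mul_lt_mul_of_pos_left hp h4
  have h6 : 0 < 1 / √(1 + β) := by positivity
  linarith

/-- With the scale bounded by T, distant centres give weights below the envelope V M, whose mean
tends to 0 with M; the constant 1 / √(1 + β) then dominates. -/
lemma sampleGap_pos_of_large_loc (hβ : 0 < β) {T : ℝ} (hT : 0 < T) :
    ∃ M, ∀ᶠ p in inProb P, ∀ m τ, M ≤ |m| → 0 < τ → τ ≤ T →
      0 < sampleGap β (fun k => Z k p.2) p.1 m τ := by
  have hc0 : 0 < 1 / √(1 + β) / β := by positivity
  set V : ℝ → ℝ → ℝ := fun M z => Real.exp (-(β * (max 0 (M - |z|) / T) ^ 2 / 2)) with hV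
  have hVm : ∀ M, Measurable (V M) := fun M => by simp only [hV]; fun_prop
  have hV1 : ∀ M z, |V M z| ≤ 1 := fun M z => by
    simp only [hV]
    rw [abs_of_pos (Real.exp_pos _), Real.exp_le_one_iff]
    have : 0 ≤ β * (max 0 (M - |z|) / T) ^ 2 / 2 := by positivity
    linarith
  have hlim : Tendsto (fun M => ∫ z, V M z ∂gaussianReal 0 1) atTop (𝓝 0) := by
    have h := tendsto_integral_filter_of_dominated_convergence (μ := gaussianReal 0 1)
      (F := V) (f := fun _ => 0) (l := atTop) (fun _ => 1)
      (Eventually.of_forall fun M => (hVm M).aestronglyMeasurable)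
      (Eventually.of_forall fun M => Eventually.of_forall (hV1 M))
      (integrable_const _) (Eventually.of_forall fun z => ?_)
    · simpa using h
    refine tendsto_exp_neg_sq_atTop hβ (Tendsto.atTop_div_const hT ?_)
    exact tendsto_atTop_mono (fun M => le_max_right 0 (M - |z|))
      (tendsto_atTop_add_const_right _ _ tendsto_id)
  have hpos : 0 < 1 / √(1 + β) - (1 + 1 / β) * 0 := by simp; positivity
  obtain ⟨M, hM⟩ := (((hlim.const_mul (1 + 1 / β)).const_sub (1 / √(1 + β))).eventually
    (lt_mem_nhds hpos)).exists
  refine ⟨M, ?_⟩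
  have hc := tendsto_avg_exp hZ hindep hlaw hβ
  have hU := tendsto_avg hZ hindep hlaw (hVm M) (integrable_of_abs_le_one (hVm M) (hV1 M))
  filter_upwards [hc.eventually (lt_mem_nhds hc0),
    ((hU.const_mul (1 + 1 / β)).const_sub (1 / √(1 + β))).eventually (lt_mem_nhds hM)]
    with p hp1 hp2 m τ hm hτ0 hτ
  unfold sampleGap
  have h1 := avg_mono (fun k => Z k p.2) p.1
    (g := fun z => Real.exp (-(β * ((z - m) / τ) ^ 2 / 2))) (h := V M) (fun z => by
      simp only [hV]
      rw [← sq_abs ((z - m) / τ), abs_div, abs_of_pos hτ0]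
      gcongr
      refine max_le (abs_nonneg _) ?_
      have := abs_sub_abs_le_abs_sub m z
      rw [abs_sub_comm] at this
      linarith)
  have h2 : 0 ≤ τ ^ β * ((1 + 1 / β) *
      avg (fun k => Z k p.2) p.1 (fun z => Real.exp (-(β * z ^ 2 / 2))) - 1 / √(1 + β)) := by
    positivity
  have h3 : (1 + 1 / β) * avg (fun k => Z k p.2) p.1
      (fun z => Real.exp (-(β * ((z - m) / τ) ^ 2 / 2))) ≤
      (1 + 1 / β) * avg (fun k => Z k p.2) p.1 (V M) := by gcongr
  linarith

/-- Finitely many neighbourhoods suffice, and finitely many events of probability tending to one may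
be intersected. -/
lemma sampleGap_pos_of_isCompact (hβ : 0 < β) {K : Set (ℝ × ℝ)} (hK : IsCompact K)
    (hK' : ∀ q ∈ K, 0 ≤ q.2 ∧ (q.1 ≠ 0 ∨ q.2 ≠ 1)) :
    ∀ᶠ p in inProb P, ∀ q ∈ K, 0 < q.2 →
      0 < sampleGap β (fun k => Z k p.2) p.1 q.1 q.2 := by
  apply hK.induction_on (p := fun S => ∀ᶠ p in inProb P, ∀ q ∈ S, 0 < q.2 →
      0 < sampleGap β (fun k => Z k p.2) p.1 q.1 q.2)
  · exact Eventually.of_forall fun p q hq => absurd hq (Set.notMem_empty q)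
  · intro s t hst ht
    filter_upwards [ht] with p hp q hq using hp q (hst hq)
  · intro s t hs ht
    filter_upwards [hs, ht] with p hp1 hp2 q hq
    rcases hq with hq | hq
    · exact hp1 q hq
    · exact hp2 q hq
  · intro q hq
    obtain ⟨δ, hδ, hev⟩ := sampleGap_pos_nhds hZ hindep hlaw hβ (hK' q hq).1 (hK' q hq).2
    refine ⟨Metric.ball q δ, mem_nhdsWithin_of_mem_nhds (Metric.ball_mem_nhds _ hδ), ?_⟩
    filter_upwards [hev] with p hp q' hq' hq0
    rw [Metric.mem_ball, Prod.dist_eq, max_lt_iff] at hq'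
    exact hp q'.1 q'.2 hq'.1 hq'.2 hq0

/-- Uniform positivity of the sample gap outside a neighbourhood of the true value. -/
lemma sampleGap_pos (hβ : 0 < β) {ε : ℝ} (hε : 0 < ε) :
    ∀ᶠ p in inProb P, ∀ m τ, 0 < τ → (ε ≤ |m| ∨ ε ≤ |τ - 1|) →
      0 < sampleGap β (fun k => Z k p.2) p.1 m τ := by
  obtain ⟨T, hT, h1⟩ := sampleGap_pos_of_large_scale hZ hindep hlaw hβ
  obtain ⟨M, h2⟩ := sampleGap_pos_of_large_loc hZ hindep hlaw hβ hT
  -- The remaining region is compact only once τ = 0 is included; this is why the gap carries the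
  -- factor τ ^ β, which keeps it controlled there.
  have hcl : IsClosed ({q : ℝ × ℝ | ε ≤ |q.1|} ∪ {q : ℝ × ℝ | ε ≤ |q.2 - 1|}) :=
    (isClosed_le (f := fun _ : ℝ × ℝ => ε) (g := fun q => |q.1|) continuous_const
      (by fun_prop)).union (isClosed_le (f := fun _ : ℝ × ℝ => ε) (g := fun q => |q.2 - 1|)
        continuous_const (by fun_prop))
  have h3 := sampleGap_pos_of_isCompact hZ hindep hlaw hβ
    ((isCompact_Icc (a := -M) (b := M)).prod (isCompact_Icc (a := 0) (b := T)) |>.inter_right hcl)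
    (by
      rintro ⟨m, τ⟩ ⟨⟨-, hτ⟩, hne⟩
      refine ⟨hτ.1, ?_⟩
      rcases hne with h | h
      · left; rintro rfl; simp at h; linarith
      · right; rintro rfl; simp at h; linarith)
  filter_upwards [h1, h2, h3] with p hp1 hp2 hp3 m τ hτ hne
  rcases le_total T τ with hTτ | hTτ
  · exact hp1 m τ hTτ
  rcases le_total M |m| with hMm | hMm
  · exact hp2 m τ hMm hτ hTτ
  · exact hp3 (m, τ) ⟨⟨abs_le.1 hMm, hτ.le, hTτ⟩, hne⟩ hτ

/-- With probability tending to one the objective function exceeds its value at the true parameter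
everywhere outside a given neighbourhood of it. -/
lemma objective_lt_objective {μ₀ σ : ℝ} (hσ : 0 < σ) (hβ : 0 ≤ β) {ε : ℝ} (hε : 0 < ε) :
    ∀ᶠ p in inProb P, ∀ θ : Fin 2 → ℝ, 0 < θ 1 → (ε ≤ |θ 0 - μ₀| ∨ ε ≤ |θ 1 - σ|) →
      objective β normalModel (fun k => μ₀ + σ * Z k p.2) p.1 ![μ₀, σ] <
        objective β normalModel (fun k => μ₀ + σ * Z k p.2) p.1 θ := by
  have hstd : ∀ (x : ℕ → ℝ) (n : ℕ) (g : ℝ → ℝ) (θ : Fin 2 → ℝ), 0 < θ 1 →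
      avg (fun k => μ₀ + σ * x k) n (fun y => g ((y - θ 0) / θ 1)) =
        avg x n (fun z => g ((z - (θ 0 - μ₀) / σ) / (θ 1 / σ))) := by
    intro x n g θ hθ
    unfold avg
    congr 2; ext k; beta_reduce; congr 1; field_simp; ring
  have hstd0 : ∀ (x : ℕ → ℝ) (n : ℕ) (g : ℝ → ℝ),
      avg (fun k => μ₀ + σ * x k) n (fun y => g ((y - (![μ₀, σ] : Fin 2 → ℝ) 0) /
        (![μ₀, σ] : Fin 2 → ℝ) 1)) = avg x n g := by
    intro x n g
    unfold avg
    congr 2; ext k; beta_reduce; congr 1; simp; field_simp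
  have hθ₀ : 0 < (![μ₀, σ] : Fin 2 → ℝ) 1 := hσ
  have hdist : ∀ θ : Fin 2 → ℝ, (ε ≤ |θ 0 - μ₀| ∨ ε ≤ |θ 1 - σ|) →
      (ε / σ ≤ |(θ 0 - μ₀) / σ| ∨ ε / σ ≤ |θ 1 / σ - 1|) := by
    intro θ h
    have : θ 1 / σ - 1 = (θ 1 - σ) / σ := by field_simp
    rw [this, abs_div, abs_div, abs_of_pos hσ]
    exact h.imp (fun h => by gcongr) (fun h => by gcongr)
  rcases hβ.eq_or_lt with rfl | hβ0
  -- The log-likelihood depends on the data only through the first two sample moments, so two laws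
  -- of large numbers give uniformity over all parameters.
  · obtain ⟨κ, hκ, hgap⟩ := loglik_gap_pos (div_pos hε hσ)
    have hm1 := integral_stdGaussian_quartic le_rfl 0 1 0 0 0
    have hm2 := integral_stdGaussian_quartic le_rfl 0 0 1 0 0
    simp only [zero_mul, add_zero, zero_add, one_mul, mul_zero, zero_div, neg_zero, Real.exp_zero,
      mul_one, Real.sqrt_one, div_one] at hm1 hm2
    have hl1 := tendsto_avg hZ hindep hlaw measurable_id' hm1.1
    have hl2 := tendsto_avg hZ hindep hlaw (measurable_id'.pow_const 2) hm2.1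
    rw [hm1.2] at hl1
    rw [hm2.2] at hl2
    filter_upwards [hl1.eventually (Metric.ball_mem_nhds _ hκ),
      hl2.eventually (Metric.ball_mem_nhds _ hκ),
      tendsto_fst_inProb.eventually (eventually_ne_atTop 0)] with p hp1 hp2 hn θ hθ hd
    rw [Real.dist_eq] at hp1 hp2
    rw [sub_zero] at hp1
    have h := hgap _ _ ((θ 0 - μ₀) / σ) (θ 1 / σ) hp1 hp2 (by positivity) (hdist θ hd)
    rw [objective_zero hθ _ hn, objective_zero hθ₀ _ hn, hstd _ _ (fun z => z ^ 2) _ hθ,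
      hstd0 _ _ (fun z => z ^ 2)]
    have hexp : avg (fun k => Z k p.2) p.1
        (fun z => ((z - (θ 0 - μ₀) / σ) / (θ 1 / σ)) ^ 2) =
        (avg (fun k => Z k p.2) p.1 (fun z => z ^ 2) - 2 * ((θ 0 - μ₀) / σ) *
          avg (fun k => Z k p.2) p.1 (fun z => z) + ((θ 0 - μ₀) / σ) ^ 2) / (θ 1 / σ) ^ 2 := by
      have : (fun z : ℝ => ((z - (θ 0 - μ₀) / σ) / (θ 1 / σ)) ^ 2) = fun z =>
          (1 / (θ 1 / σ) ^ 2) * (z ^ 2 - (2 * ((θ 0 - μ₀) / σ)) * z + ((θ 0 - μ₀) / σ) ^ 2) := by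
        ext z; field_simp; ring
      rw [this, avg_const_mul, avg_add, avg_const _ hn, avg_sub, avg_const_mul]
      ring
    rw [hexp]
    rw [Real.log_div hθ.ne' hσ.ne'] at h
    simp only [Matrix.cons_val_one, Matrix.cons_val_fin_one]
    linarith
  · filter_upwards [sampleGap_pos hZ hindep hlaw hβ0 (div_pos hε hσ)] with p hp θ hθ hd
    have hτ : 0 < θ 1 / σ := by positivity
    have h := hp ((θ 0 - μ₀) / σ) (θ 1 / σ) hτ (hdist θ hd)
    rw [objective_of_ne_zero hθ hβ hβ0.ne', objective_of_ne_zero hθ₀ hβ hβ0.ne',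
      hstd _ _ (fun z => Real.exp (-(β * z ^ 2 / 2))) _ hθ,
      hstd0 _ _ (fun z => Real.exp (-(β * z ^ 2 / 2)))]
    unfold sampleGap at h
    have hA := sqrt_two_pi_mul_pos hσ
    -- Clearing the ratio of the two prefactors turns the inequality into positivity of `sampleGap`.
    have hs : (√(2 * Real.pi) * θ 1) ^ (-β) =
        (√(2 * Real.pi) * σ) ^ (-β) * ((θ 1 / σ) ^ β)⁻¹ := by
      rw [← Real.rpow_neg hτ.le, ← Real.mul_rpow hA.le hτ.le]
      congr 1; field_simp
    have hτβ : 0 < (θ 1 / σ) ^ β := by positivity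
    simp only [Matrix.cons_val_one, Matrix.cons_val_fin_one]
    rw [hs, mul_assoc]
    refine mul_lt_mul_of_pos_left ?_ (by positivity)
    rw [inv_mul_eq_div, lt_div_iff₀ hτβ]
    linarith

end Separation

/-! ### Existence and consistency of the estimators -/

section Estimators

variable {Ω : Type*} [MeasurableSpace Ω] {P : Measure Ω} [IsProbabilityMeasure P]
  {Z : ℕ → Ω → ℝ} {β μ₀ σ : ℝ} {est : ℕ → Ω → Fin 2 → ℝ}

/-- If the objective function exceeds its value at an admissible point everywhere outside a small
box around that point, then it has a minimizer, and all minimizers lie in the box. -/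
lemma exists_isMinOn_of_separated {Q : (Fin 2 → ℝ) → ℝ} (hQ : ContinuousOn Q {θ | 0 < θ 1})
    {C : Set (Fin 2 → ℝ)} (hC : IsClosed C) (hmem : ![μ₀, σ] ∈ C) (hσ : 0 < σ) {ε : ℝ}
    (hε : 0 < ε) (hεσ : ε < σ)
    (hsep : ∀ θ : Fin 2 → ℝ, 0 < θ 1 → (ε ≤ |θ 0 - μ₀| ∨ ε ≤ |θ 1 - σ|) → Q ![μ₀, σ] < Q θ) :
    (∃ θ ∈ normalSpace ∩ C, IsMinOn Q (normalSpace ∩ C) θ) ∧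
    ∀ θ ∈ normalSpace ∩ C, IsMinOn Q (normalSpace ∩ C) θ → |θ 0 - μ₀| < ε ∧ |θ 1 - σ| < ε := by
  have h0 : ![μ₀, σ] ∈ normalSpace ∩ C := ⟨hσ, hmem⟩
  have hlast : ∀ θ ∈ normalSpace ∩ C, Q θ ≤ Q ![μ₀, σ] → |θ 0 - μ₀| < ε ∧ |θ 1 - σ| < ε := by
    intro θ hθ hle
    by_contra hcon
    rw [not_and_or, not_lt, not_lt] at hcon
    exact absurd (hsep θ hθ.1 hcon) (not_lt.2 hle)
  refine ⟨?_, fun θ hθ hmin => hlast θ hθ (hmin h0)⟩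
  -- Since ε < σ this compact box stays inside the half-plane. A minimizer over it is global,
  -- because outside it the objective exceeds its value at the centre.
  set K : Set (Fin 2 → ℝ) := Set.Icc ![μ₀ - ε, σ - ε] ![μ₀ + ε, σ + ε] ∩ C with hK
  have hKc : IsCompact K := isCompact_Icc.inter_right hC
  have hKpos : ∀ θ ∈ K, 0 < θ 1 := fun θ hθ => by
    have h := hθ.1.1 1
    simp only [Matrix.cons_val_one, Matrix.cons_val_fin_one] at h
    linarith
  have h0K : ![μ₀, σ] ∈ K := by
    refine ⟨⟨fun i => ?_, fun i => ?_⟩, hmem⟩ <;> fin_cases i <;> simp [hε.le]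
  obtain ⟨θ, hθK, hθ⟩ := hKc.exists_isMinOn ⟨_, h0K⟩ (hQ.mono fun θ hθ => hKpos θ hθ)
  refine ⟨θ, ⟨hKpos θ hθK, hθK.2⟩, fun θ' hθ' => ?_⟩
  rcases le_or_gt (Q θ') (Q ![μ₀, σ]) with hle | hgt
  · obtain ⟨h1, h2⟩ := hlast θ' hθ' hle
    rw [abs_lt] at h1 h2
    refine hθ ⟨⟨fun i => ?_, fun i => ?_⟩, hθ'.2⟩ <;> fin_cases i <;> simp <;> linarith
  · exact (hθ h0K).trans hgt.le

variable (hZ : ∀ k, Measurable (Z k)) (hindep : iIndepFun Z P)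
  (hlaw : ∀ k, P.map (Z k) = gaussianReal 0 1)

include hZ hindep hlaw

/-- Minimizing estimators are consistent. -/
lemma IsMinimizing.eventually_isMinOn (hσ : 0 < σ) (hβ : 0 ≤ β) {C : Set (Fin 2 → ℝ)}
    (hC : IsClosed C) (hmem : ![μ₀, σ] ∈ C)
    (h : IsMinimizing P β normalModel (normalSpace ∩ C) (fun k ω => μ₀ + σ * Z k ω) est) {ε : ℝ}
    (hε : 0 < ε) :
    ∀ᶠ p in inProb P, est p.1 p.2 ∈ normalSpace ∩ C ∧
      IsMinOn (objective β normalModel (fun k => μ₀ + σ * Z k p.2) p.1) (normalSpace ∩ C)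
        (est p.1 p.2) ∧ |est p.1 p.2 0 - μ₀| < ε ∧ |est p.1 p.2 1 - σ| < ε := by
  have hm : ∀ᶠ p in inProb P, (∃ θ ∈ normalSpace ∩ C,
      IsMinOn (objective β normalModel (fun k => μ₀ + σ * Z k p.2) p.1) (normalSpace ∩ C) θ) →
      (est p.1 p.2 ∈ normalSpace ∩ C ∧
        IsMinOn (objective β normalModel (fun k => μ₀ + σ * Z k p.2) p.1) (normalSpace ∩ C)
          (est p.1 p.2)) := by
    rw [eventually_inProb_iff]
    simp only [Classical.not_imp]
    exact h
  have hε' : 0 < min ε (σ / 2) := by positivity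
  filter_upwards [hm, objective_lt_objective (μ₀ := μ₀) hZ hindep hlaw hσ hβ hε'] with p hp1 hp2
  obtain ⟨hex, hloc⟩ := exists_isMinOn_of_separated (continuousOn_objective hβ _ _) hC hmem hσ hε'
    ((min_le_right _ _).trans_lt (by linarith)) hp2
  obtain ⟨hS, hmin⟩ := hp1 hex
  obtain ⟨h1, h2⟩ := hloc _ hS hmin
  exact ⟨hS, hmin, h1.trans_le (min_le_left _ _), h2.trans_le (min_le_left _ _)⟩

lemma IsMinimizing.tendsto (hσ : 0 < σ) (hβ : 0 ≤ β) {C : Set (Fin 2 → ℝ)}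
    (hC : IsClosed C) (hmem : ![μ₀, σ] ∈ C)
    (h : IsMinimizing P β normalModel (normalSpace ∩ C) (fun k ω => μ₀ + σ * Z k ω) est) :
    Tendsto (fun p : ℕ × Ω => est p.1 p.2 0) (inProb P) (𝓝 μ₀) ∧
    Tendsto (fun p : ℕ × Ω => est p.1 p.2 1) (inProb P) (𝓝 σ) := by
  refine ⟨Metric.tendsto_nhds.2 fun ε hε => ?_, Metric.tendsto_nhds.2 fun ε hε => ?_⟩
  · exact (h.eventually_isMinOn hZ hindep hlaw hσ hβ hC hmem hε).mono fun p hp => hp.2.2.1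
  · exact (h.eventually_isMinOn hZ hindep hlaw hσ hβ hC hmem hε).mono fun p hp => hp.2.2.2

omit [IsProbabilityMeasure P] hZ hindep hlaw in
lemma tendsto_coord_of_tendstoInMeasure
    (h : TendstoInMeasure P est atTop (fun _ => ![μ₀, σ])) :
    Tendsto (fun p : ℕ × Ω => est p.1 p.2 0) (inProb P) (𝓝 μ₀) ∧
    Tendsto (fun p : ℕ × Ω => est p.1 p.2 1) (inProb P) (𝓝 σ) := by
  have h' : Tendsto (fun p : ℕ × Ω => est p.1 p.2) (inProb P) (𝓝 ![μ₀, σ]) :=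
    tendsto_inProb_iff.2 h
  rw [tendsto_pi_nhds] at h'
  exact ⟨h' 0, h' 1⟩

/-- The minimum density power divergence estimator is a consistent root of the standardized
estimating equations. -/
lemma IsMDPDE.consistent_root (hσ : 0 < σ) (hβ : 0 ≤ β)
    (h : IsMDPDE P β normalModel normalSpace ![μ₀, σ] (fun k ω => μ₀ + σ * Z k ω) est) :
    Tendsto (fun p : ℕ × Ω => est p.1 p.2 0) (inProb P) (𝓝 μ₀) ∧
    Tendsto (fun p : ℕ × Ω => est p.1 p.2 1) (inProb P) (𝓝 σ) ∧
    ∀ᶠ p in inProb P, 0 < est p.1 p.2 1 ∧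
      avg (fun k => μ₀ + σ * Z k p.2) p.1
        (fun y => locScore β ((y - est p.1 p.2 0) / est p.1 p.2 1)) = 0 ∧
      avg (fun k => μ₀ + σ * Z k p.2) p.1
        (fun y => scaleScore β ((y - est p.1 p.2 0) / est p.1 p.2 1)) = 0 := by
  have hroot : ∀ᶠ p in inProb P, est p.1 p.2 ∈ normalSpace ∧
      ∀ i, estimatingFun β normalModel (fun k => μ₀ + σ * Z k p.2) p.1 (est p.1 p.2) i = 0 := by
    rcases h.2 with h | h
    · have hu : (normalSpace : Set (Fin 2 → ℝ)) = normalSpace ∩ Set.univ := by simp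
      rw [hu] at h
      filter_upwards [h.eventually_isMinOn hZ hindep hlaw hσ hβ isClosed_univ trivial one_pos]
        with p hp
      refine ⟨hp.1.1, fun i => estimatingFun_eq_zero_of_isMinOn hp.1.1 hβ hp.2.1 i ?_⟩
      filter_upwards [eventually_update_pos hp.1.1 i] with t ht using ⟨ht, trivial⟩
    · exact eventually_inProb_iff.2 h.2
  have hcons : Tendsto (fun p : ℕ × Ω => est p.1 p.2 0) (inProb P) (𝓝 μ₀) ∧
      Tendsto (fun p : ℕ × Ω => est p.1 p.2 1) (inProb P) (𝓝 σ) := by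
    rcases h.2 with h | h
    · have hu : (normalSpace : Set (Fin 2 → ℝ)) = normalSpace ∩ Set.univ := by simp
      rw [hu] at h
      exact h.tendsto hZ hindep hlaw hσ hβ isClosed_univ trivial
    · exact tendsto_coord_of_tendstoInMeasure h.1
  refine ⟨hcons.1, hcons.2, ?_⟩
  filter_upwards [hroot, tendsto_fst_inProb.eventually (eventually_ne_atTop 0)] with p hp hn
  exact ⟨hp.1, avg_locScore_eq_zero hp.1 hβ (hp.2 0), avg_scaleScore_eq_zero hp.1 hβ hn (hp.2 1)⟩

/-- The restricted minimum density power divergence estimator is a consistent root of the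
standardized scale equation. -/
lemma IsRMDPDE.consistent_root (hσ : 0 < σ) (hβ : 0 ≤ β)
    (h : IsRMDPDE P β normalModel normalSpace (normalNull μ₀) ![μ₀, σ]
      (fun k ω => μ₀ + σ * Z k ω) est) :
    Tendsto (fun p : ℕ × Ω => est p.1 p.2 1) (inProb P) (𝓝 σ) ∧
    ∀ᶠ p in inProb P, 0 < est p.1 p.2 1 ∧ est p.1 p.2 0 = μ₀ ∧
      avg (fun k => μ₀ + σ * Z k p.2) p.1
        (fun y => scaleScore β ((y - est p.1 p.2 0) / est p.1 p.2 1)) = 0 := by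
  have hset : {θ ∈ normalSpace | normalNull μ₀ θ = 0} =
      normalSpace ∩ {θ : Fin 2 → ℝ | θ 0 = μ₀} := by
    ext θ
    simp only [Set.mem_inter_iff, Set.mem_ofPred_eq, normalNull, funext_iff, Pi.zero_apply,
      forall_const, sub_eq_zero]
  have hC : IsClosed {θ : Fin 2 → ℝ | θ 0 = μ₀} := isClosed_eq (by fun_prop) continuous_const
  have hmem : ![μ₀, σ] ∈ {θ : Fin 2 → ℝ | θ 0 = μ₀} := rfl
  have hroot : ∀ᶠ p in inProb P, (est p.1 p.2 ∈ normalSpace ∧ est p.1 p.2 0 = μ₀) ∧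
      estimatingFun β normalModel (fun k => μ₀ + σ * Z k p.2) p.1 (est p.1 p.2) 1 = 0 := by
    rcases h.2 with h | h
    · rw [hset] at h
      filter_upwards [h.eventually_isMinOn hZ hindep hlaw hσ hβ hC hmem one_pos] with p hp
      -- Only the scale can be varied inside the null hypothesis, so only its equation is available.
      refine ⟨hp.1, estimatingFun_eq_zero_of_isMinOn hp.1.1 hβ hp.2.1 1 ?_⟩
      filter_upwards [eventually_update_pos hp.1.1 1] with t ht
      exact ⟨ht, by simpa using hp.1.2⟩
    · have hlag : ∀ᶠ p in inProb P, est p.1 p.2 ∈ normalSpace ∧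
          normalNull μ₀ (est p.1 p.2) = 0 ∧ ∃ l : Fin 1 → ℝ, ∀ i,
            -((p.1 : ℝ) * estimatingFun β normalModel (fun k => μ₀ + σ * Z k p.2) p.1
              (est p.1 p.2) i) + (matG (normalNull μ₀) (est p.1 p.2)).mulVec l i = 0 :=
        eventually_inProb_iff.2 h.2
      filter_upwards [hlag,
        tendsto_fst_inProb.eventually (eventually_ne_atTop 0)] with p hp hn
      obtain ⟨h1, h2, l, hl⟩ := hp
      -- The second entry of G is zero, so the multiplier is absent from the scale equation.
      have h3 := hl 1
      rw [matG_normalNull] at h3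
      have hn' : (p.1 : ℝ) ≠ 0 := by exact_mod_cast hn
      refine ⟨⟨h1, sub_eq_zero.1 (congrFun h2 0)⟩, ?_⟩
      simpa [Matrix.mulVec, dotProduct, hn'] using h3
  have hcons : Tendsto (fun p : ℕ × Ω => est p.1 p.2 1) (inProb P) (𝓝 σ) := by
    rcases h.2 with h | h
    · rw [hset] at h
      exact (h.tendsto hZ hindep hlaw hσ hβ hC hmem).2
    · exact (tendsto_coord_of_tendstoInMeasure h.1).2
  refine ⟨hcons, ?_⟩
  filter_upwards [hroot, tendsto_fst_inProb.eventually (eventually_ne_atTop 0)] with p hp hn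
  exact ⟨hp.1.1, hp.1.2, avg_scaleScore_eq_zero hp.1.1 hβ hn hp.2⟩

end Estimators

/-! ### Taylor bounds for the score functions -/

section Taylor

/-- The mean value inequality is used twice, which gives C in place of C / 2. What matters is
uniformity in z, which allows averaging over the sample. -/
lemma abs_taylor_remainder_le {h h' h'' : ℝ → ℝ} {C : ℝ} (hd : ∀ z, HasDerivAt h (h' z) z)
    (hd' : ∀ z, HasDerivAt h' (h'' z) z) (hC : ∀ z, |h'' z| ≤ C) (z t : ℝ) :
    |h (z + t) - h z - t * h' z| ≤ C * t ^ 2 := by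
  have hlip : ∀ s, |h' (z + s) - h' z| ≤ C * |s| := fun s => by
    have := convex_univ.norm_image_sub_le_of_norm_hasDerivWithin_le (f := h') (f' := h'')
      (fun x _ => (hd' x).hasDerivWithinAt) (fun x _ => hC x) (Set.mem_univ z)
      (Set.mem_univ (z + s))
    simpa using this
  have hC0 : 0 ≤ C := (abs_nonneg _).trans (hC 0)
  have hg : ∀ s, HasDerivAt (fun s => h (z + s) - s * h' z) (h' (z + s) - h' z) s := fun s => by
    have h1 := ((hd (z + s)).comp_const_add z s).fun_sub ((hasDerivAt_id' s).mul_const (h' z))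
    simpa using h1
  have := (convex_Icc (-|t|) |t|).norm_image_sub_le_of_norm_hasDerivWithin_le
    (f := fun s => h (z + s) - s * h' z) (f' := fun s => h' (z + s) - h' z) (C := C * |t|)
    (fun s _ => (hg s).hasDerivWithinAt)
    (fun s hs => (hlip s).trans (mul_le_mul_of_nonneg_left (abs_le.2 hs) hC0))
    (x := 0) (y := t) ⟨neg_nonpos.2 (abs_nonneg t), abs_nonneg t⟩ ⟨neg_abs_le t, le_abs_self t⟩
  simp only [add_zero, zero_mul, sub_zero, Real.norm_eq_abs] at this
  calc |h (z + t) - h z - t * h' z| = |h (z + t) - t * h' z - h z| := by congr 1; ring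
    _ ≤ C * |t| * |t| := this
    _ = C * t ^ 2 := by rw [mul_assoc, ← sq, sq_abs]

/-- A function that vanishes to first order at a point is quadratically small there. -/
lemma isBigO_sq_of_deriv_eq_zero {f f' : ℝ → ℝ} {a : ℝ} (hf : ∀ᶠ x in 𝓝 a, HasDerivAt f (f' x) x)
    (hf' : DifferentiableAt ℝ f' a) (h0 : f a = 0) (h1 : f' a = 0) :
    f =O[𝓝 a] fun x => (x - a) ^ 2 := by
  have hO := hf'.isBigO_sub
  simp only [h1, sub_zero] at hO
  obtain ⟨C, hC⟩ := hO.bound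
  obtain ⟨r, hr, hball⟩ := Metric.eventually_nhds_iff_ball.1 (hf.and hC)
  refine Asymptotics.IsBigO.of_bound C ?_
  filter_upwards [Metric.ball_mem_nhds a hr] with x hx
  have hsub : Metric.closedBall a (dist x a) ⊆ Metric.ball a r :=
    Metric.closedBall_subset_ball hx
  have := (convex_closedBall a (dist x a)).norm_image_sub_le_of_norm_hasDerivWithin_le
    (f := f) (f' := f') (C := C * ‖x - a‖)
    (fun y hy => (hball y (hsub hy)).1.hasDerivWithinAt)
    (fun y hy => ((hball y (hsub hy)).2).trans (by
      rcases eq_or_lt_of_le (norm_nonneg (y - a)) with h | h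
      · rw [← h, mul_zero]
        have hCx := (norm_nonneg _).trans (hball x hx).2
        exact hCx
      · have hC0 : 0 ≤ C := nonneg_of_mul_nonneg_left ((norm_nonneg _).trans
          (hball y (hsub hy)).2) h
        gcongr
        simpa [dist_eq_norm] using hy))
    (x := a) (y := x) (by simp) (by simp)
  rw [h0, sub_zero] at this
  rwa [norm_pow, sq, ← mul_assoc]

variable {β : ℝ}

lemma hasDerivAt_poly_mul_exp {q : ℝ → ℝ} {q' z : ℝ} (hq : HasDerivAt q q' z) :
    HasDerivAt (fun z => q z * Real.exp (-(β * z ^ 2 / 2)))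
      ((q' - β * z * q z) * Real.exp (-(β * z ^ 2 / 2))) z := by
  refine (hq.mul (hasDerivAt_exp_neg_sq β z)).congr_deriv ?_
  ring

/-- The derivative of `locScore`. -/
def locScoreDeriv (β z : ℝ) : ℝ := (1 - β * z ^ 2) * Real.exp (-(β * z ^ 2 / 2))

/-- The derivative of `scaleScore`. -/
def scaleScoreDeriv (β z : ℝ) : ℝ :=
  ((2 + β) * z - β * z ^ 3) * Real.exp (-(β * z ^ 2 / 2))

lemma hasDerivAt_locScore (z : ℝ) : HasDerivAt (locScore β) (locScoreDeriv β z) z := by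
  refine (hasDerivAt_poly_mul_exp (hasDerivAt_id z)).congr_deriv ?_
  simp only [locScoreDeriv, id]; ring

lemma hasDerivAt_scaleScore (z : ℝ) : HasDerivAt (scaleScore β) (scaleScoreDeriv β z) z := by
  have h := (hasDerivAt_poly_mul_exp (β := β) ((hasDerivAt_pow 2 z).sub_const 1)).add_const
    (β / (1 + β) / √(1 + β))
  refine h.congr_deriv ?_
  simp only [scaleScoreDeriv]; push_cast; ring

lemma hasDerivAt_locScoreDeriv (z : ℝ) : HasDerivAt (locScoreDeriv β)
    ((β ^ 2 * z ^ 3 - 3 * β * z) * Real.exp (-(β * z ^ 2 / 2))) z := by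
  refine (hasDerivAt_poly_mul_exp (((hasDerivAt_pow 2 z).const_mul β).const_sub 1)).congr_deriv ?_
  push_cast; ring

lemma hasDerivAt_scaleScoreDeriv (z : ℝ) : HasDerivAt (scaleScoreDeriv β)
    (((2 + β) - 3 * β * z ^ 2 - (2 + β) * β * z ^ 2 + β ^ 2 * z ^ 4) *
      Real.exp (-(β * z ^ 2 / 2))) z := by
  refine (hasDerivAt_poly_mul_exp (((hasDerivAt_id' z).const_mul (2 + β)).fun_sub
    ((hasDerivAt_pow 3 z).const_mul β))).congr_deriv ?_
  push_cast; ring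

lemma exp_neg_bounds {w : ℝ} (hw : 0 ≤ w) : Real.exp (-w) ≤ 1 ∧ w * Real.exp (-w) ≤ 1 ∧
    w ^ 2 * Real.exp (-w) ≤ 2 := by
  have h1 := Real.pow_div_factorial_le_exp w hw 1
  have h2 := Real.pow_div_factorial_le_exp w hw 2
  norm_num [Nat.factorial] at h1 h2
  have he : 0 < Real.exp w := Real.exp_pos w
  rw [Real.exp_neg]
  refine ⟨inv_le_one_of_one_le₀ (Real.one_le_exp hw), ?_, ?_⟩
  · rw [← div_eq_mul_inv, div_le_one he]; exact h1
  · rw [← div_eq_mul_inv, div_le_iff₀ he]; linarith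

/-- With w = β z² / 2 the polynomial is β z (2 w - 3) and β |z| ≤ β / 2 + w, so everything is
bounded by powers of w against exp (-w). Powers of z always come with factors β, so the bound
survives at β = 0, where there is no decay. -/
lemma abs_locScoreDeriv_deriv_le (hβ : 0 ≤ β) (z : ℝ) :
    |(β ^ 2 * z ^ 3 - 3 * β * z) * Real.exp (-(β * z ^ 2 / 2))| ≤ 3 * β / 2 + (β + 3) + 4 := by
  set w : ℝ := β * z ^ 2 / 2 with hw
  have hw0 : 0 ≤ w := by positivity
  obtain ⟨h1, h2, h3⟩ := exp_neg_bounds hw0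
  have he : 0 < Real.exp (-w) := Real.exp_pos _
  have hp : |β ^ 2 * z ^ 3 - 3 * β * z| ≤ 3 * β / 2 + (β + 3) * w + 2 * w ^ 2 := by
    have hz : β * |z| ≤ β / 2 + w := by
      have : |z| ≤ (1 + z ^ 2) / 2 := by rw [← sq_abs]; nlinarith [sq_nonneg (|z| - 1)]
      rw [hw]; nlinarith
    have hfac : β ^ 2 * z ^ 3 - 3 * β * z = (β * z) * (2 * w - 3) := by rw [hw]; ring
    rw [hfac, abs_mul, abs_mul, abs_of_nonneg hβ]
    have : |2 * w - 3| ≤ 2 * w + 3 := by rw [abs_le]; constructor <;> linarith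
    calc β * |z| * |2 * w - 3| ≤ (β / 2 + w) * (2 * w + 3) := by gcongr
      _ = _ := by ring
  rw [abs_mul, abs_of_pos he]
  calc _ ≤ (3 * β / 2 + (β + 3) * w + 2 * w ^ 2) * Real.exp (-w) := by gcongr
    _ = 3 * β / 2 * Real.exp (-w) + (β + 3) * (w * Real.exp (-w)) +
        2 * (w ^ 2 * Real.exp (-w)) := by ring
    _ ≤ 3 * β / 2 * 1 + (β + 3) * 1 + 2 * 2 := by gcongr
    _ = _ := by ring

lemma abs_scaleScoreDeriv_deriv_le (hβ : 0 ≤ β) (z : ℝ) :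
    |((2 + β) - 3 * β * z ^ 2 - (2 + β) * β * z ^ 2 + β ^ 2 * z ^ 4) *
      Real.exp (-(β * z ^ 2 / 2))| ≤ (2 + β) + (10 + 2 * β) + 8 := by
  set w : ℝ := β * z ^ 2 / 2 with hw
  have hw0 : 0 ≤ w := by positivity
  obtain ⟨h1, h2, h3⟩ := exp_neg_bounds hw0
  have he : 0 < Real.exp (-w) := Real.exp_pos _
  have hp : |(2 + β) - 3 * β * z ^ 2 - (2 + β) * β * z ^ 2 + β ^ 2 * z ^ 4| ≤
      (2 + β) + (10 + 2 * β) * w + 4 * w ^ 2 := by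
    have hfac : (2 + β) - 3 * β * z ^ 2 - (2 + β) * β * z ^ 2 + β ^ 2 * z ^ 4 =
      (2 + β) - (10 + 2 * β) * w + 4 * w ^ 2 := by rw [hw]; ring
    rw [hfac]
    have : 0 ≤ (10 + 2 * β) * w := by positivity
    rw [abs_le]; constructor <;> nlinarith [sq_nonneg w]
  rw [abs_mul, abs_of_pos he]
  calc _ ≤ ((2 + β) + (10 + 2 * β) * w + 4 * w ^ 2) * Real.exp (-w) := by gcongr
    _ = (2 + β) * Real.exp (-w) + (10 + 2 * β) * (w * Real.exp (-w)) +
        4 * (w ^ 2 * Real.exp (-w)) := by ring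
    _ ≤ (2 + β) * 1 + (10 + 2 * β) * 1 + 4 * 2 := by gcongr
    _ = _ := by ring

end Taylor

/-! ### Linearization of a sample estimating equation -/

section Linearization

variable {Ω : Type*} [MeasurableSpace Ω] {P : Measure Ω} {Z : ℕ → Ω → ℝ}

/-- Linearization of an estimating equation around the true value. -/
lemma isLittleO_avg_add {h h' : ℝ → ℝ} {C D₁ D₂ v : ℝ}
    (htaylor : ∀ z t, |h (z + t) - h z - t * h' z| ≤ C * t ^ 2)
    (hv : Tendsto (fun p : ℕ × Ω => avg (fun k => Z k p.2) p.1 fun z => z ^ 2) (inProb P) (𝓝 v))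
    (hD₁ : Tendsto (fun p : ℕ × Ω => avg (fun k => Z k p.2) p.1 fun z => z * h' z)
      (inProb P) (𝓝 D₁))
    (hD₂ : Tendsto (fun p : ℕ × Ω => avg (fun k => Z k p.2) p.1 h') (inProb P) (𝓝 D₂))
    {a b : ℕ × Ω → ℝ} (ha : Tendsto a (inProb P) (𝓝 0)) (hb : Tendsto b (inProb P) (𝓝 0))
    (hroot : ∀ᶠ p in inProb P,
      avg (fun k => Z k p.2) p.1 (fun z => h (z + (a p * z + b p))) = 0) :
    (fun p => avg (fun k => Z k p.2) p.1 h + (a p * D₁ + b p * D₂)) =o[inProb P]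
      fun p => |a p| + |b p| := by
  have hC0 : 0 ≤ C := by simpa using (abs_nonneg _).trans (htaylor 0 1)
  have haO : a =O[inProb P] fun p => |a p| + |b p| :=
    Asymptotics.IsBigO.of_bound 1 (Eventually.of_forall fun p => by
      rw [one_mul, Real.norm_eq_abs, Real.norm_of_nonneg (by positivity)]
      linarith [abs_nonneg (b p)])
  have hbO : b =O[inProb P] fun p => |a p| + |b p| :=
    Asymptotics.IsBigO.of_bound 1 (Eventually.of_forall fun p => by
      rw [one_mul, Real.norm_eq_abs, Real.norm_of_nonneg (by positivity)]
      linarith [abs_nonneg (a p)])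
  have ho : ∀ {u w : ℕ × Ω → ℝ}, Tendsto u (inProb P) (𝓝 0) →
      w =O[inProb P] (fun p => |a p| + |b p|) →
      (fun p => u p * w p) =o[inProb P] fun p => |a p| + |b p| := fun {u w} hu hw => by
    have := ((Asymptotics.isLittleO_one_iff ℝ).2 hu).mul_isBigO hw
    simpa using this
  -- The averaged Taylor remainder is at most 2C (a² avg z² + b²), written here as vanishing factors
  -- times a and b.
  have hq : (fun p => 2 * C * (a p * avg (fun k => Z k p.2) p.1 (fun z => z ^ 2)) * a p +
      2 * C * b p * b p) =o[inProb P] fun p => |a p| + |b p| := by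
    refine (ho ?_ haO).add (ho ?_ hbO)
    · simpa using (ha.mul hv).const_mul (2 * C)
    · simpa using hb.const_mul (2 * C)
  have hrem : (fun p => avg (fun k => Z k p.2) p.1 h +
      (a p * avg (fun k => Z k p.2) p.1 (fun z => z * h' z) +
        b p * avg (fun k => Z k p.2) p.1 h')) =o[inProb P] fun p => |a p| + |b p| := by
    refine Asymptotics.IsBigO.trans_isLittleO (Asymptotics.IsBigO.of_bound 1 ?_) hq
    filter_upwards [hroot, tendsto_fst_inProb.eventually (eventually_ne_atTop 0)] with p hp hn
    set x := fun k => Z k p.2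
    have h1 : avg x p.1 (fun z => h (z + (a p * z + b p)) - h z - (a p * z + b p) * h' z) =
        -(avg x p.1 h + (a p * avg x p.1 (fun z => z * h' z) + b p * avg x p.1 h')) := by
      have : (fun z => (a p * z + b p) * h' z) = fun z => a p * (z * h' z) + b p * h' z := by
        ext z; ring
      rw [avg_sub, avg_sub, hp, this, avg_add, avg_const_mul, avg_const_mul]
      ring
    have h2 := abs_avg_le x p.1
      (g := fun z => h (z + (a p * z + b p)) - h z - (a p * z + b p) * h' z)
      (h := fun z => 2 * C * a p ^ 2 * z ^ 2 + 2 * C * b p ^ 2) (fun z => by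
        refine (htaylor z _).trans ?_
        nlinarith [mul_nonneg hC0 (sq_nonneg (a p * z - b p))])
    rw [h1, abs_neg, avg_add, avg_const_mul, avg_const x hn] at h2
    rw [one_mul, Real.norm_eq_abs]
    refine h2.trans ((le_of_eq ?_).trans (le_abs_self _))
    ring
  -- Replacing sample averages by their limits costs a vanishing factor times a or b.
  have e1 := ho (u := fun p => avg (fun k => Z k p.2) p.1 (fun z => z * h' z) - D₁)
    (by simpa using hD₁.sub_const D₁) haO
  have e2 := ho (u := fun p => avg (fun k => Z k p.2) p.1 h' - D₂)
    (by simpa using hD₂.sub_const D₂) hbO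
  refine ((hrem.sub e1).sub e2).congr_left fun p => ?_
  ring

end Linearization

/-! ### Second-order expansion of the divergence -/

section DivergenceExpansion

lemma isBigO_log_remainder :
    (fun r : ℝ => r ^ 2 - 1 - 2 * Real.log r) =O[𝓝 1] fun r => (r - 1) ^ 2 := by
  refine isBigO_sq_of_deriv_eq_zero (f' := fun r => 2 * r - 2 * r⁻¹) ?_ ?_ (by simp) (by simp)
  · filter_upwards [lt_mem_nhds one_pos] with r hr
    refine (((hasDerivAt_pow 2 r).sub_const 1).sub
      ((Real.hasDerivAt_log (ne_of_gt hr)).const_mul 2)).congr_deriv ?_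
    simp
  · exact (by fun_prop : DifferentiableAt ℝ (fun r : ℝ => 2 * r) 1).sub
      ((differentiableAt_inv one_ne_zero).const_mul 2)

/-- This is the divergence at equal locations, up to a prefactor, as a function of the ratio of
scales. Value and derivative both vanish at r = 1, so a merely quadratic bound holds, and no second
derivative need be computed. -/
lemma isBigO_scale_remainder {γ : ℝ} (hγ : 0 < γ) :
    (fun r : ℝ => (1 + 1 / γ * r ^ (-γ)) / √(1 + γ) - (1 + 1 / γ) * (1 / √(1 + γ * r ^ 2)))
      =O[𝓝 1] fun r => (r - 1) ^ 2 := by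
  have h1 : 0 < 1 + γ := by linarith
  have hs : 0 < √(1 + γ) := by positivity
  have hpos : ∀ r : ℝ, 0 < 1 + γ * r ^ 2 := fun r => by positivity
  refine isBigO_sq_of_deriv_eq_zero (f' := fun r => -(r ^ (-γ - 1)) / √(1 + γ) +
    (1 + γ) * r / ((1 + γ * r ^ 2) * √(1 + γ * r ^ 2))) ?_ ?_ ?_ ?_
  · filter_upwards [lt_mem_nhds one_pos] with r hr
    have hr' : r ≠ 0 := ne_of_gt hr
    have d1 := (((Real.hasDerivAt_rpow_const (p := -γ) (Or.inl hr')).const_mul (1 / γ)).const_add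
      1).div_const √(1 + γ)
    have d2 := ((((hasDerivAt_pow 2 r).const_mul γ).const_add 1).sqrt (hpos r).ne').inv
      (Real.sqrt_pos.2 (hpos r)).ne'
    have d3 := d1.sub (d2.const_mul (1 + 1 / γ))
    refine (d3.congr_deriv ?_).congr_of_eventuallyEq (Eventually.of_forall fun t => ?_)
    · have hq := Real.sq_sqrt (hpos r).le
      have hq0 := Real.sqrt_pos.2 (hpos r)
      rw [hq]
      have := hpos r
      push_cast
      field_simp
      ring
    · simp [one_div]
  · have hsq : DifferentiableAt ℝ (fun r : ℝ => √(1 + γ * r ^ 2)) 1 :=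
      DifferentiableAt.sqrt (by fun_prop) (hpos 1).ne'
    have hden : (1 + γ * (1 : ℝ) ^ 2) * √(1 + γ * 1 ^ 2) ≠ 0 :=
      (mul_pos (hpos 1) (Real.sqrt_pos.2 (hpos 1))).ne'
    have hrp : DifferentiableAt ℝ (fun r : ℝ => r ^ (-γ - 1)) 1 :=
      (Real.hasDerivAt_rpow_const (Or.inl one_ne_zero)).differentiableAt
    exact (hrp.neg.div_const _).add (DifferentiableAt.div (by fun_prop)
      (DifferentiableAt.mul (by fun_prop) hsq) hden)
  · simp only [Real.one_rpow, one_pow, mul_one]; ring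
  · simp only [Real.one_rpow, one_pow, mul_one]; field_simp; ring

/-- The quadratic expansion of the density power divergence between two nearby normal densities. -/
lemma divergence_expansion {ι : Type*} {l : Filter ι} {θ θ' : ι → Fin 2 → ℝ} {Q : ι → ℝ}
    {σ γ : ℝ} (hσ : 0 < σ) (hγ : 0 ≤ γ) (hθ : ∀ᶠ i in l, 0 < θ i 1) (hθ' : ∀ᶠ i in l, 0 < θ' i 1)
    (hs : Tendsto (fun i => θ' i 1) l (𝓝 σ)) (hr : Tendsto (fun i => θ i 1 / θ' i 1) l (𝓝 1))
    (hδ : Tendsto (fun i => (θ i 0 - θ' i 0) / θ' i 1) l (𝓝 0))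
    (hδQ : (fun i => ((θ i 0 - θ' i 0) / θ' i 1) ^ 2) =O[l] Q)
    (hrQ : (fun i => (θ i 1 / θ' i 1 - 1) ^ 2) =o[l] Q) :
    (fun i => 2 * divergence γ (normalModel (θ i)) (normalModel (θ' i)) -
      (√(2 * Real.pi) * σ) ^ (-γ) / √(1 + γ) * ((θ i 0 - θ' i 0) / θ' i 1) ^ 2) =o[l] Q := by
  rcases hγ.eq_or_lt with rfl | hγ0
  -- For γ = 0 the location part is exactly quadratic, so only the scale remainder is left.
  · refine ((isBigO_log_remainder.comp_tendsto hr).trans_isLittleO hrQ).congr' ?_ EventuallyEq.rfl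
    filter_upwards [hθ, hθ'] with i h1 h2
    rw [divergence_zero_normalModel h1 h2]
    simp
    ring
  · set r : ι → ℝ := fun i => θ i 1 / θ' i 1 with hrdef
    set δ : ι → ℝ := fun i => (θ i 0 - θ' i 0) / θ' i 1 with hδdef
    set A : ι → ℝ := fun i => (√(2 * Real.pi) * θ' i 1) ^ (-γ) with hA
    have hc : ∀ x : ℝ, 0 < 1 + γ * x ^ 2 := fun x => by positivity
    have h1γ : 0 < 1 + γ := by linarith
    have hAlim : Tendsto A l (𝓝 ((√(2 * Real.pi) * σ) ^ (-γ))) :=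
      (hs.const_mul _).rpow_const (Or.inl (sqrt_two_pi_mul_pos hσ).ne')
    have hB : ContinuousAt (fun x : ℝ => (1 + 1 / γ) / √(1 + γ * x ^ 2)) 1 :=
      ContinuousAt.div (by fun_prop) (by fun_prop) (Real.sqrt_pos.2 (hc 1)).ne'
    have hE : ContinuousAt (fun x : ℝ => γ / (2 * (1 + γ * x ^ 2))) 1 :=
      ContinuousAt.div (by fun_prop) (by fun_prop) (mul_pos two_pos (hc 1)).ne'
    have hBlim := hB.tendsto.comp hr
    have hElim := hE.tendsto.comp hr
    -- The exponent of the location factor; 1 - exp (-u) is replaced by u at the cost of u².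
    set u : ι → ℝ := fun i => γ / (2 * (1 + γ * r i ^ 2)) * δ i ^ 2 with hu
    have hδ2 : Tendsto (fun i => δ i ^ 2) l (𝓝 0) := by simpa using hδ.pow 2
    have hulim : Tendsto u l (𝓝 0) := by simpa using hElim.mul hδ2
    have huQ : u =O[l] Q := by
      simpa using (hElim.isBigO_one ℝ).mul hδQ
    have hoQ : ∀ {f g : ι → ℝ}, Tendsto f l (𝓝 0) → g =O[l] Q →
        (fun i => f i * g i) =o[l] Q := fun {f g} hf hg => by
      simpa using ((Asymptotics.isLittleO_one_iff ℝ).2 hf).mul_isBigO hg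
    have hexp : (fun i => 1 - Real.exp (-u i) - u i) =o[l] Q := by
      refine Asymptotics.IsBigO.trans_isLittleO (Asymptotics.IsBigO.of_bound 1 ?_) (hoQ hulim huQ)
      filter_upwards [hulim.eventually (Metric.ball_mem_nhds 0 one_pos)] with i hi
      rw [Real.dist_eq, sub_zero] at hi
      have := Real.abs_exp_sub_one_sub_id_le (x := -u i) (by rw [abs_neg]; exact hi.le)
      rw [one_mul, Real.norm_eq_abs, Real.norm_eq_abs,
        abs_of_nonneg (mul_self_nonneg (u i)), abs_sub_comm]
      calc |u i - (1 - Real.exp (-u i))| = |Real.exp (-u i) - 1 - -u i| := by congr 1; ring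
        _ ≤ (-u i) ^ 2 := this
        _ = u i * u i := by ring
    have hP := (isBigO_scale_remainder hγ0).comp_tendsto hr |>.trans_isLittleO hrQ
    have t1 := ((hAlim.isBigO_one ℝ).mul_isLittleO hP)
    have t2 := ((hAlim.isBigO_one ℝ).mul (hBlim.isBigO_one ℝ)).mul_isLittleO hexp
    simp only [one_mul] at t1 t2
    -- At r = 1 the factors (1 + 1/γ) and γ / (1 + γ) cancel, leaving the stated constant.
    have hcoef : Tendsto (fun i => 2 * (A i * ((1 + 1 / γ) / √(1 + γ * r i ^ 2)) *
        (γ / (2 * (1 + γ * r i ^ 2)))) - (√(2 * Real.pi) * σ) ^ (-γ) / √(1 + γ)) l (𝓝 0) := by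
      have := (((hAlim.mul hBlim).mul hElim).const_mul 2).sub_const
        ((√(2 * Real.pi) * σ) ^ (-γ) / √(1 + γ))
      convert! this using 2
      simp only [one_pow, mul_one]
      field_simp; ring
    have t3 := hoQ hcoef hδQ
    refine (((t1.add t2).const_mul_left 2).add t3).congr' ?_ EventuallyEq.rfl
    filter_upwards [hθ, hθ'] with i h1 h2
    rw [divergence_normalModel h1 h2 hγ hγ0.ne']
    have hexpi : Real.exp (-(γ * ((θ i 0 - θ' i 0) / θ' i 1) ^ 2 /
          (2 * (1 + γ * (θ i 1 / θ' i 1) ^ 2)))) = Real.exp (-u i) := by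
      simp only [hu, hrdef, hδdef]; congr 2; ring
    rw [hexpi]
    simp only [Function.comp, hu, hA, hrdef, hδdef]
    ring

end DivergenceExpansion

/-! ### Moments of the scores and of their derivatives -/

section ScoreMoments

variable {β : ℝ}

lemma integral_locScore (hβ : 0 ≤ β) : Integrable (locScore β) (gaussianReal 0 1) ∧
    ∫ z, locScore β z ∂gaussianReal 0 1 = 0 := by
  have h := integral_stdGaussian_quartic hβ 0 1 0 0 0
  have he : locScore β = fun z : ℝ => (0 + 1 * z + 0 * z ^ 2 + 0 * z ^ 3 + 0 * z ^ 4) *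
      Real.exp (-(β * z ^ 2 / 2)) := by
    ext z; rw [locScore]; ring
  rw [he]
  exact ⟨h.1, h.2.trans (by simp)⟩

lemma integral_locScore_sq (hβ : 0 ≤ β) :
    Integrable (fun z => locScore β z ^ 2) (gaussianReal 0 1) ∧
    ∫ z, locScore β z ^ 2 ∂gaussianReal 0 1 = 1 / (1 + 2 * β) / √(1 + 2 * β) := by
  have h := integral_stdGaussian_quartic (β := 2 * β) (by linarith) 0 0 1 0 0
  have he : (fun z => locScore β z ^ 2) = fun z : ℝ =>
      (0 + 0 * z + 1 * z ^ 2 + 0 * z ^ 3 + 0 * z ^ 4) * Real.exp (-(2 * β * z ^ 2 / 2)) := by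
    ext z
    rw [locScore, mul_pow, ← Real.exp_nat_mul]
    push_cast; ring_nf
  rw [he]
  simpa using h

lemma integral_scaleScore (hβ : 0 ≤ β) : Integrable (scaleScore β) (gaussianReal 0 1) ∧
    ∫ z, scaleScore β z ∂gaussianReal 0 1 = 0 := by
  have h := integral_stdGaussian_quartic hβ (-1) 0 1 0 0
  have he : (fun z : ℝ => (-1 + 0 * z + 1 * z ^ 2 + 0 * z ^ 3 + 0 * z ^ 4) *
      Real.exp (-(β * z ^ 2 / 2))) = fun z => (z ^ 2 - 1) * Real.exp (-(β * z ^ 2 / 2)) := by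
    ext z; ring
  rw [he] at h
  refine ⟨h.1.add (integrable_const _), ?_⟩
  simp only [scaleScore]
  rw [integral_add h.1 (integrable_const _), h.2]
  have : 0 < 1 + β := by linarith
  simp
  field_simp; ring

lemma integrable_scaleScore_sq (hβ : 0 ≤ β) :
    Integrable (fun z => scaleScore β z ^ 2) (gaussianReal 0 1) := by
  set c : ℝ := β / (1 + β) / √(1 + β) with hc
  have h1 := (integral_stdGaussian_quartic (β := 2 * β) (by linarith) 1 0 (-2) 0 1).1
  have h2 := (integral_stdGaussian_quartic hβ (-(2 * c)) 0 (2 * c) 0 0).1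
  refine ((h1.add h2).add (integrable_const (c ^ 2))).congr (Eventually.of_forall fun z => ?_)
  simp only [Pi.add_apply, scaleScore, ← hc]
  have : Real.exp (-(2 * β * z ^ 2 / 2)) = Real.exp (-(β * z ^ 2 / 2)) ^ 2 := by
    rw [← Real.exp_nat_mul]; push_cast; ring_nf
  rw [this]; ring

lemma integral_locScoreDeriv (hβ : 0 ≤ β) : Integrable (locScoreDeriv β) (gaussianReal 0 1) ∧
    ∫ z, locScoreDeriv β z ∂gaussianReal 0 1 = 1 / (1 + β) / √(1 + β) := by
  have h := integral_stdGaussian_quartic hβ 1 0 (-β) 0 0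
  have he : locScoreDeriv β = fun z : ℝ => (1 + 0 * z + -β * z ^ 2 + 0 * z ^ 3 + 0 * z ^ 4) *
      Real.exp (-(β * z ^ 2 / 2)) := by
    ext z; rw [locScoreDeriv]; ring
  rw [he]
  refine ⟨h.1, h.2.trans ?_⟩
  have : 0 < 1 + β := by linarith
  field_simp; ring

/-- The integrand is odd. Together with `integral_scaleScoreDeriv` this decouples the linearized
location and scale equations. -/
lemma integral_mul_locScoreDeriv (hβ : 0 ≤ β) :
    Integrable (fun z => z * locScoreDeriv β z) (gaussianReal 0 1) ∧
    ∫ z, z * locScoreDeriv β z ∂gaussianReal 0 1 = 0 := by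
  have h := integral_stdGaussian_quartic hβ 0 1 0 (-β) 0
  have he : (fun z => z * locScoreDeriv β z) = fun z : ℝ =>
      (0 + 1 * z + 0 * z ^ 2 + -β * z ^ 3 + 0 * z ^ 4) * Real.exp (-(β * z ^ 2 / 2)) := by
    ext z; rw [locScoreDeriv]; ring
  rw [he]
  exact ⟨h.1, h.2.trans (by simp)⟩

lemma integral_scaleScoreDeriv (hβ : 0 ≤ β) :
    Integrable (scaleScoreDeriv β) (gaussianReal 0 1) ∧
    ∫ z, scaleScoreDeriv β z ∂gaussianReal 0 1 = 0 := by
  have h := integral_stdGaussian_quartic hβ 0 (2 + β) 0 (-β) 0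
  have he : scaleScoreDeriv β = fun z : ℝ =>
      (0 + (2 + β) * z + 0 * z ^ 2 + -β * z ^ 3 + 0 * z ^ 4) * Real.exp (-(β * z ^ 2 / 2)) := by
    ext z; rw [scaleScoreDeriv]; ring
  rw [he]
  exact ⟨h.1, h.2.trans (by simp)⟩

lemma integral_mul_scaleScoreDeriv (hβ : 0 ≤ β) :
    Integrable (fun z => z * scaleScoreDeriv β z) (gaussianReal 0 1) ∧
    ∫ z, z * scaleScoreDeriv β z ∂gaussianReal 0 1 = (2 + β ^ 2) / (1 + β) ^ 2 / √(1 + β) := by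
  have h := integral_stdGaussian_quartic hβ 0 0 (2 + β) 0 (-β)
  have he : (fun z => z * scaleScoreDeriv β z) = fun z : ℝ =>
      (0 + 0 * z + (2 + β) * z ^ 2 + 0 * z ^ 3 + -β * z ^ 4) * Real.exp (-(β * z ^ 2 / 2)) := by
    ext z; rw [scaleScoreDeriv]; ring
  rw [he]
  refine ⟨h.1, h.2.trans ?_⟩
  have : 0 < 1 + β := by linarith
  field_simp; ring

lemma measurable_locScore : Measurable (locScore β) := by unfold locScore; fun_prop

lemma measurable_scaleScore : Measurable (scaleScore β) := by unfold scaleScore; fun_prop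

lemma measurable_locScoreDeriv : Measurable (locScoreDeriv β) := by unfold locScoreDeriv; fun_prop

lemma measurable_scaleScoreDeriv : Measurable (scaleScoreDeriv β) := by
  unfold scaleScoreDeriv; fun_prop

end ScoreMoments

/-! ### Solving the decoupled linear system -/

section Linearized

variable {ι : Type*} {l : Filter ι}

/-- The solution of a linearized pair of equations is of the order of the inhomogeneity. -/
lemma isBigO_of_linearized {a b S₁ S₂ : ι → ℝ} {D₁ D₂ : ℝ} (hD₁ : 0 < D₁) (hD₂ : 0 < D₂)
    (h₁ : (fun i => S₁ i + b i * D₁) =o[l] fun i => |a i| + |b i|)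
    (h₂ : (fun i => S₂ i + a i * D₂) =o[l] fun i => |a i| + |b i|) :
    (fun i => |a i| + |b i|) =O[l] fun i => |S₁ i| + |S₂ i| := by
  set D := min D₁ D₂ with hD
  have hDpos : 0 < D := lt_min hD₁ hD₂
  -- Two errors of size D / 4 times |a| + |b| absorb half of the lower bound D (|a| + |b|), whence 2
  -- / D.
  refine Asymptotics.IsBigO.of_bound (2 / D) ?_
  filter_upwards [h₁.def (by positivity : 0 < D / 4), h₂.def (by positivity : 0 < D / 4)]
    with i hi₁ hi₂
  have hR : 0 ≤ |a i| + |b i| := by positivity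
  rw [Real.norm_of_nonneg hR, Real.norm_eq_abs] at hi₁ hi₂
  rw [Real.norm_of_nonneg hR, Real.norm_of_nonneg (by positivity), div_mul_eq_mul_div,
    le_div_iff₀ hDpos]
  have e₁ : |b i| * D₁ ≤ |S₁ i + b i * D₁| + |S₁ i| := by
    have := abs_sub (S₁ i + b i * D₁) (S₁ i)
    rwa [add_sub_cancel_left, abs_mul, abs_of_pos hD₁] at this
  have e₂ : |a i| * D₂ ≤ |S₂ i + a i * D₂| + |S₂ i| := by
    have := abs_sub (S₂ i + a i * D₂) (S₂ i)
    rwa [add_sub_cancel_left, abs_mul, abs_of_pos hD₂] at this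
  have f₁ : |b i| * D ≤ |b i| * D₁ := by gcongr; exact min_le_left _ _
  have f₂ : |a i| * D ≤ |a i| * D₂ := by gcongr; exact min_le_right _ _
  linarith

lemma tendsto_ratio_sub_one {ι : Type*} {σ : ℝ} (hσ : 0 < σ) {l : Filter ι} {s : ι → ℝ}
    (hs : Tendsto s l (𝓝 σ)) : Tendsto (fun p => σ / s p - 1) l (𝓝 0) := by
  have := ((tendsto_const_nhds (x := σ)).div hs hσ.ne').sub_const 1
  rwa [div_self hσ.ne', sub_self] at this

end Linearized

/-! ### Asymptotic distribution of the test statistic -/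

section TestStatistic

variable {Ω : Type*} [MeasurableSpace Ω] {P : Measure Ω} [IsProbabilityMeasure P]
  {Z : ℕ → Ω → ℝ} {β γ μ₀ σ : ℝ} {est est₀ : ℕ → Ω → Fin 2 → ℝ}

/-- Residuals at the parameter (m, s) are affine perturbations of the true ones; the coefficients
σ/s - 1 and (μ₀ - m)/s are the small quantities of the linearization. -/
lemma avg_affine (x : ℕ → ℝ) (n : ℕ) (g : ℝ → ℝ) {m s : ℝ} (hs : 0 < s) :
    avg (fun k => μ₀ + σ * x k) n (fun y => g ((y - m) / s)) =
      avg x n fun z => g (z + ((σ / s - 1) * z + (μ₀ - m) / s)) := by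
  unfold avg
  congr 2; ext k; beta_reduce; congr 1; field_simp; ring

variable (hZ : ∀ k, Measurable (Z k)) (hindep : iIndepFun Z P)
  (hlaw : ∀ k, P.map (Z k) = gaussianReal 0 1)

include hZ hindep hlaw

lemma isLittleO_locScore (hβ : 0 ≤ β) {a b : ℕ × Ω → ℝ} (ha : Tendsto a (inProb P) (𝓝 0))
    (hb : Tendsto b (inProb P) (𝓝 0))
    (hroot : ∀ᶠ p in inProb P,
      avg (fun k => Z k p.2) p.1 (fun z => locScore β (z + (a p * z + b p))) = 0) :
    (fun p => avg (fun k => Z k p.2) p.1 (locScore β) + b p * (1 / (1 + β) / √(1 + β)))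
      =o[inProb P] fun p => |a p| + |b p| := by
  have hm2 := integral_stdGaussian_quartic le_rfl 0 0 1 0 0
  simp only [zero_mul, add_zero, zero_add, one_mul, zero_div, neg_zero, Real.exp_zero,
    mul_one] at hm2
  have h := isLittleO_avg_add (h := locScore β) (h' := locScoreDeriv β)
    (abs_taylor_remainder_le hasDerivAt_locScore hasDerivAt_locScoreDeriv
      (abs_locScoreDeriv_deriv_le hβ))
    (tendsto_avg hZ hindep hlaw (measurable_id'.pow_const 2) hm2.1)
    (tendsto_avg hZ hindep hlaw (measurable_id'.mul measurable_locScoreDeriv)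
      (integral_mul_locScoreDeriv hβ).1)
    (tendsto_avg hZ hindep hlaw measurable_locScoreDeriv (integral_locScoreDeriv hβ).1)
    ha hb hroot
  rw [(integral_mul_locScoreDeriv hβ).2, (integral_locScoreDeriv hβ).2] at h
  simpa using h

lemma isLittleO_scaleScore (hβ : 0 ≤ β) {a b : ℕ × Ω → ℝ} (ha : Tendsto a (inProb P) (𝓝 0))
    (hb : Tendsto b (inProb P) (𝓝 0))
    (hroot : ∀ᶠ p in inProb P,
      avg (fun k => Z k p.2) p.1 (fun z => scaleScore β (z + (a p * z + b p))) = 0) :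
    (fun p => avg (fun k => Z k p.2) p.1 (scaleScore β) +
      a p * ((2 + β ^ 2) / (1 + β) ^ 2 / √(1 + β))) =o[inProb P] fun p => |a p| + |b p| := by
  have hm2 := integral_stdGaussian_quartic le_rfl 0 0 1 0 0
  simp only [zero_mul, add_zero, zero_add, one_mul, zero_div, neg_zero, Real.exp_zero,
    mul_one] at hm2
  have h := isLittleO_avg_add (h := scaleScore β) (h' := scaleScoreDeriv β)
    (abs_taylor_remainder_le hasDerivAt_scaleScore hasDerivAt_scaleScoreDeriv
      (abs_scaleScoreDeriv_deriv_le hβ))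
    (tendsto_avg hZ hindep hlaw (measurable_id'.pow_const 2) hm2.1)
    (tendsto_avg hZ hindep hlaw (measurable_id'.mul measurable_scaleScoreDeriv)
      (integral_mul_scaleScoreDeriv hβ).1)
    (tendsto_avg hZ hindep hlaw measurable_scaleScoreDeriv (integral_scaleScoreDeriv hβ).1)
    ha hb hroot
  rw [(integral_mul_scaleScoreDeriv hβ).2, (integral_scaleScoreDeriv hβ).2] at h
  simpa using h

/-- The divergence between the two estimated densities is asymptotically a multiple of the squared
average location score. -/
lemma isLittleO_divergence (hσ : 0 < σ) (hβ : 0 ≤ β) (hγ : 0 ≤ γ)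
    (h : IsMDPDE P β normalModel normalSpace ![μ₀, σ] (fun k ω => μ₀ + σ * Z k ω) est)
    (h₀ : IsRMDPDE P β normalModel normalSpace (normalNull μ₀) ![μ₀, σ]
      (fun k ω => μ₀ + σ * Z k ω) est₀) :
    (fun p : ℕ × Ω => 2 * divergence γ (normalModel (est p.1 p.2)) (normalModel (est₀ p.1 p.2)) -
      (√(2 * Real.pi) * σ) ^ (-γ) / √(1 + γ) *
        (avg (fun k => Z k p.2) p.1 (locScore β) / (1 / (1 + β) / √(1 + β))) ^ 2)
      =o[inProb P] fun p => avg (fun k => Z k p.2) p.1 (locScore β) ^ 2 +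
        avg (fun k => Z k p.2) p.1 (scaleScore β) ^ 2 := by
  obtain ⟨hm, hs, hroot⟩ := h.consistent_root hZ hindep hlaw hσ hβ
  obtain ⟨hs₀, hroot₀⟩ := h₀.consistent_root hZ hindep hlaw hσ hβ
  have h1β : 0 < 1 + β := by linarith
  set F := inProb P with hF
  set S₁ : ℕ × Ω → ℝ := fun p => avg (fun k => Z k p.2) p.1 (locScore β) with hS₁
  set S₂ : ℕ × Ω → ℝ := fun p => avg (fun k => Z k p.2) p.1 (scaleScore β) with hS₂
  set D₁ : ℝ := 1 / (1 + β) / √(1 + β) with hD₁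
  set D₂ : ℝ := (2 + β ^ 2) / (1 + β) ^ 2 / √(1 + β) with hD₂
  have hD₁pos : 0 < D₁ := by positivity
  have hD₂pos : 0 < D₂ := by positivity
  set a : ℕ × Ω → ℝ := fun p => σ / est p.1 p.2 1 - 1 with ha
  set b : ℕ × Ω → ℝ := fun p => (μ₀ - est p.1 p.2 0) / est p.1 p.2 1 with hb
  set a₀ : ℕ × Ω → ℝ := fun p => σ / est₀ p.1 p.2 1 - 1 with ha₀
  have halim : Tendsto a F (𝓝 0) := tendsto_ratio_sub_one hσ hs
  have ha₀lim : Tendsto a₀ F (𝓝 0) := tendsto_ratio_sub_one hσ hs₀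
  have hblim : Tendsto b F (𝓝 0) := by
    have := (hm.const_sub μ₀).div hs hσ.ne'
    rwa [sub_self, zero_div] at this
  have e₁ : (fun p => S₁ p + b p * D₁) =o[F] fun p => |a p| + |b p| := by
    refine isLittleO_locScore hZ hindep hlaw hβ halim hblim ?_
    filter_upwards [hroot] with p hp
    rw [← avg_affine _ _ _ hp.1]; exact hp.2.1
  have e₂ : (fun p => S₂ p + a p * D₂) =o[F] fun p => |a p| + |b p| := by
    refine isLittleO_scaleScore hZ hindep hlaw hβ halim hblim ?_
    filter_upwards [hroot] with p hp
    rw [← avg_affine _ _ _ hp.1]; exact hp.2.2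
  have e₀ : (fun p => S₂ p + a₀ p * D₂) =o[F] fun p => |a₀ p| + |(0 : ℝ)| := by
    refine isLittleO_scaleScore hZ hindep hlaw hβ ha₀lim tendsto_const_nhds ?_
    filter_upwards [hroot₀] with p hp
    have := avg_affine (μ₀ := μ₀) (σ := σ) (fun k => Z k p.2) p.1 (scaleScore β)
      (m := est₀ p.1 p.2 0) hp.1
    rw [hp.2.2, hp.2.1, sub_self, zero_div] at this
    exact this.symm
  set R : ℕ × Ω → ℝ := fun p => |S₁ p| + |S₂ p| with hR
  have hρ : (fun p => |a p| + |b p|) =O[F] R := isBigO_of_linearized hD₁pos hD₂pos e₁ e₂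
  have hρ₀ : (fun p => |a₀ p| + |(0 : ℝ)|) =O[F] R := by
    -- The restricted estimator has no location error, so the first equation is taken to be trivial.
    have := isBigO_of_linearized (S₁ := fun _ => 0) (b := fun _ => 0) hD₁pos hD₂pos
      (by simp) e₀
    refine this.trans (Asymptotics.IsBigO.of_bound 1 (Eventually.of_forall fun p => ?_))
    rw [one_mul, Real.norm_of_nonneg (by positivity), Real.norm_of_nonneg (by positivity)]
    simp only [hR, abs_zero, zero_add]
    linarith [abs_nonneg (S₁ p)]
  have f₁ := e₁.trans_isBigO hρ
  have f₂ := e₂.trans_isBigO hρ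
  have f₀ := e₀.trans_isBigO hρ₀
  have hbR : b =O[F] R := by
    refine Asymptotics.IsBigO.trans (Asymptotics.IsBigO.of_bound 1 (Eventually.of_forall
      fun p => ?_)) hρ
    rw [one_mul, Real.norm_eq_abs, Real.norm_of_nonneg (by positivity)]
    linarith [abs_nonneg (a p)]
  have hS₁R : S₁ =O[F] R := by
    refine Asymptotics.IsBigO.of_bound 1 (Eventually.of_forall fun p => ?_)
    rw [one_mul, Real.norm_eq_abs, Real.norm_of_nonneg (by positivity)]
    linarith [abs_nonneg (S₂ p)]
  -- Both estimators solve the scale equation with the same S₂ and D₂, so their scale errors cancel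
  -- to first order.
  have hdiff : (fun p => a₀ p - a p) =o[F] R := by
    refine ((f₀.sub f₂).const_mul_left D₂⁻¹).congr_left fun p => ?_
    field_simp; ring
  have hRQ : (fun p => R p * R p) =O[F] fun p => S₁ p ^ 2 + S₂ p ^ 2 := by
    refine Asymptotics.IsBigO.of_bound 2 (Eventually.of_forall fun p => ?_)
    rw [Real.norm_of_nonneg (by positivity), Real.norm_of_nonneg (by positivity)]
    simp only [hR]
    nlinarith [sq_nonneg (|S₁ p| - |S₂ p|), sq_abs (S₁ p), sq_abs (S₂ p)]
  -- the standardized differences of the two estimators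
  set r : ℕ × Ω → ℝ := fun p => est p.1 p.2 1 / est₀ p.1 p.2 1 with hr
  set δ : ℕ × Ω → ℝ := fun p => (est p.1 p.2 0 - est₀ p.1 p.2 0) / est₀ p.1 p.2 1 with hδ
  have hrlim : Tendsto r F (𝓝 1) := by
    have := hs.div hs₀ hσ.ne'
    rwa [div_self hσ.ne'] at this
  have hδeq : ∀ᶠ p in F, δ p = -(b p * r p) := by
    filter_upwards [hroot, hroot₀] with p hp hp₀
    simp only [hδ, hb, hr, hp₀.2.1]
    have := hp.1; have := hp₀.1
    field_simp; ring
  have hδlim : Tendsto δ F (𝓝 0) := by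
    have := (hblim.mul hrlim).neg
    rw [zero_mul, neg_zero] at this
    exact this.congr' (hδeq.mono fun p hp => hp.symm)
  -- Here r - 1 is a₀ - a multiplied by the bounded factor σ̂ / σ.
  have hrR : (fun p => r p - 1) =o[F] R := by
    have hbd : (fun p : ℕ × Ω => est p.1 p.2 1 / σ) =O[F] fun _ => (1 : ℝ) :=
      (hs.div_const σ).isBigO_one ℝ
    have := hdiff.mul_isBigO hbd
    simp only [mul_one] at this
    refine this.congr' ?_ EventuallyEq.rfl
    filter_upwards [hroot, hroot₀] with p hp hp₀
    simp only [ha, ha₀, hr]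
    have := hp.1; have := hp₀.1
    field_simp; ring
  have hδR : δ =O[F] R := by
    have := (hbR.mul (hrlim.isBigO_one ℝ)).neg_left
    simp only [mul_one] at this
    exact this.congr' (hδeq.mono fun p hp => hp.symm) EventuallyEq.rfl
  have hexp := divergence_expansion (γ := γ) hσ hγ (hroot.mono fun p hp => hp.1)
    (hroot₀.mono fun p hp => hp.1) hs₀ hrlim hδlim
    (Asymptotics.IsBigO.trans (by simpa only [← sq] using hδR.mul hδR) hRQ)
    (Asymptotics.IsLittleO.trans_isBigO (by simpa only [← sq] using hrR.mul hrR) hRQ)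
  have hδS : (fun p => δ p - S₁ p / D₁) =o[F] R := by
    have h1 : (fun p => b p * (r p - 1)) =o[F] R := by
      have h2 : (fun p => r p - 1) =o[F] fun _ => (1 : ℝ) := by
        rw [Asymptotics.isLittleO_one_iff]
        simpa using hrlim.sub_const 1
      simpa using hbR.mul_isLittleO h2
    refine ((f₁.const_mul_left D₁⁻¹).neg_left.sub h1).congr' ?_ EventuallyEq.rfl
    filter_upwards [hδeq] with p hp
    rw [hp]; field_simp; ring
  have hsum : (fun p => δ p + S₁ p / D₁) =O[F] R := by
    refine hδR.add ((hS₁R.const_mul_left D₁⁻¹).congr_left fun p => ?_)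
    rw [div_eq_inv_mul]
  -- The difference of the squares of δ and S₁ / D₁ factors as (small) times (bounded), both
  -- relative to R.
  have hsq := ((hδS.mul_isBigO hsum).trans_isBigO hRQ).const_mul_left
    ((√(2 * Real.pi) * σ) ^ (-γ) / √(1 + γ))
  refine (hexp.add hsq).congr_left fun p => ?_
  simp only [hδ]
  ring

/-- The error is negligible against S₁² + S₂², and n times the expectation of that sum is bounded by
the variances of the two scores. -/
lemma tendsto_testStat_sub (hσ : 0 < σ) (hβ : 0 ≤ β) (hγ : 0 ≤ γ)
    (h : IsMDPDE P β normalModel normalSpace ![μ₀, σ] (fun k ω => μ₀ + σ * Z k ω) est)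
    (h₀ : IsRMDPDE P β normalModel normalSpace (normalNull μ₀) ![μ₀, σ]
      (fun k ω => μ₀ + σ * Z k ω) est₀) :
    Tendsto (fun p : ℕ × Ω => testStat γ normalModel est est₀ p.1 p.2 -
      p.1 * ((√(2 * Real.pi) * σ) ^ (-γ) / √(1 + γ) *
        (avg (fun k => Z k p.2) p.1 (locScore β) / (1 / (1 + β) / √(1 + β))) ^ 2))
      (inProb P) (𝓝 0) := by
  have i₁ := integral_avg_sq hZ hindep hlaw measurable_locScore (integral_locScore_sq hβ).1
    (integral_locScore hβ).2
  have i₂ := integral_avg_sq hZ hindep hlaw measurable_scaleScore (integrable_scaleScore_sq hβ)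
    (integral_scaleScore hβ).2
  have := tendsto_mul_of_isLittleO
    (R := fun p : ℕ × Ω => avg (fun k => Z k p.2) p.1 (locScore β) ^ 2 +
        avg (fun k => Z k p.2) p.1 (scaleScore β) ^ 2)
    (V := ∫ z, locScore β z ^ 2 ∂gaussianReal 0 1 + ∫ z, scaleScore β z ^ 2 ∂gaussianReal 0 1)
    (fun p => by positivity) (fun n => (i₁ n).1.add (i₂ n).1)
    (fun n => by
      simp only
      rw [integral_add (i₁ n).1 (i₂ n).1, mul_add]
      exact add_le_add (i₁ n).2 (i₂ n).2)
    (isLittleO_divergence hZ hindep hlaw hσ hβ hγ h h₀)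
  refine this.congr fun p => ?_
  rw [testStat]; ring

/-- The central limit theorem for the location score scaled to unit variance, followed by the
continuous map z ↦ c v z². -/
lemma tendstoInDistribution_sq_avg_locScore (hβ : 0 ≤ β) (c : ℝ) :
    TendstoInDistribution (fun (n : ℕ) ω =>
        (n : ℝ) * (c * avg (fun k => Z k ω) n (locScore β) ^ 2)) atTop
      (fun z : ℝ => c * (1 / (1 + 2 * β) / √(1 + 2 * β)) * z ^ 2) (fun _ => P)
      (gaussianReal 0 1) := by
  set v : ℝ := 1 / (1 + 2 * β) / √(1 + 2 * β) with hv
  have hvpos : 0 < v := by positivity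
  have hg : Measurable fun z => locScore β z / √v := measurable_locScore.div_const _
  have hlim := tendstoInDistribution_inv_sqrt_mul_sum (P := P) (P' := gaussianReal 0 1)
    (Y := id) (X := fun k ω => locScore β (Z k ω) / √v) HasLaw.id
    (by
      rw [integral_comp_sample hZ hlaw hg, integral_div, (integral_locScore hβ).2, zero_div])
    (by
      have := integral_comp_sample hZ hlaw (hg.pow_const 2) 0
      simp only [Pi.pow_apply]
      rw [this]
      simp only [div_pow, Real.sq_sqrt hvpos.le]
      rw [integral_div, (integral_locScore_sq hβ).2, ← hv, div_self hvpos.ne'])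
    (hindep.comp (fun _ z => locScore β z / √v) fun _ => hg)
    (identDistrib_of_map_eq hZ hlaw hg)
  have h := hlim.continuous_comp (g := fun z : ℝ => c * v * z ^ 2) (by fun_prop)
  convert! h using 1
  ext n ω
  simp only [Function.comp, avg, ← Finset.sum_div, mul_pow, div_pow, Real.sq_sqrt hvpos.le, inv_pow,
    Real.sq_sqrt (Nat.cast_nonneg n : (0 : ℝ) ≤ n)]
  rcases eq_or_ne n 0 with rfl | hn
  · simp
  · have : (n : ℝ) ≠ 0 := by exact_mod_cast hn
    field_simp

-- Identifies the constant produced by the expansion, namely the divergence curvature times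
-- Var(`locScore`) / D₁², with the corner entry of the matrix product.
omit hZ hindep hlaw [IsProbabilityMeasure P] in
lemma normalEigenvalue_eq (hσ : 0 < σ) (hβ : 0 ≤ β) (hγ : 0 ≤ γ) :
    (√(2 * Real.pi) * σ) ^ (-γ) / √(1 + γ) / (1 / (1 + β) / √(1 + β)) ^ 2 *
      (1 / (1 + 2 * β) / √(1 + 2 * β)) = normalEigenvalue σ β γ := by
  have hpi : 0 < √(2 * Real.pi) := by have := Real.pi_pos; positivity
  have e1 : (√(2 * Real.pi) * σ) ^ (-γ) = ((2 * Real.pi) ^ (γ / 2))⁻¹ * (σ ^ γ)⁻¹ := by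
    rw [Real.rpow_neg (by positivity), Real.mul_rpow hpi.le hσ.le, Real.sqrt_eq_rpow,
      ← Real.rpow_mul (by positivity), show (1 / 2 * γ) = γ / 2 by ring, mul_inv]
  have e4 : (2 * β + 1) ^ (3 / 2 : ℝ) = (2 * β + 1) * √(1 + 2 * β) := by
    rw [show (3 / 2 : ℝ) = 1 + 1 / 2 by norm_num, Real.rpow_add (by positivity), Real.rpow_one,
      ← Real.sqrt_eq_rpow, add_comm 1]
  have hpp : 0 < (2 * Real.pi) ^ (γ / 2) := by have := Real.pi_pos; positivity
  have hs := Real.rpow_pos_of_pos hσ γ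
  have hq := Real.sq_sqrt (show 0 ≤ 1 + β by positivity)
  rw [normalEigenvalue, e1, e4, add_comm γ 1, add_comm β 1, add_comm (2 * β) 1]
  generalize (2 * Real.pi) ^ (γ / 2) = w at hpp
  rw [div_pow, hq]
  field_simp

/-- Slutsky's theorem: the difference from the squared location score tends to zero in probability.
-/
lemma tendstoInDistribution_testStat (hσ : 0 < σ) (hβ : 0 ≤ β) (hγ : 0 ≤ γ)
    (h : IsMDPDE P β normalModel normalSpace ![μ₀, σ] (fun k ω => μ₀ + σ * Z k ω) est)
    (h₀ : IsRMDPDE P β normalModel normalSpace (normalNull μ₀) ![μ₀, σ]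
      (fun k ω => μ₀ + σ * Z k ω) est₀) :
    TendstoInDistribution (testStat γ normalModel est est₀) atTop
      (fun z : ℝ => normalEigenvalue σ β γ * z ^ 2) (fun _ => P) (gaussianReal 0 1) := by
  have hlim := tendstoInDistribution_sq_avg_locScore hZ hindep hlaw hβ
    ((√(2 * Real.pi) * σ) ^ (-γ) / √(1 + γ) / (1 / (1 + β) / √(1 + β)) ^ 2)
  rw [normalEigenvalue_eq hσ hβ hγ] at hlim
  refine tendstoInDistribution_of_tendstoInMeasure_sub _ _ hlim ?_
    fun n => (measurable_testStat h.1 h₀.1 n).aemeasurable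
  have := tendsto_inProb_iff.1 (tendsto_testStat_sub hZ hindep hlaw hσ hβ hγ h h₀)
  convert! this using 1
  ext n ω
  simp only [Pi.sub_apply]
  ring

end TestStatistic

end

end DPD

/-! ### The eigenvalue and the limit law for a general normal sample -/

open DPD in
theorem corollary4 (μ₀ σ β γ : ℝ) (hσ : 0 < σ) (hβ : 0 ≤ β) (hγ : 0 ≤ γ) :
    -- the matrix `A_γ B_β K_β B_β` at the true parameter `(μ₀, σ)`
    DPD.matA γ DPD.normalModel ![μ₀, σ] *
        DPD.matB β DPD.normalModel (DPD.normalNull μ₀) ![μ₀, σ] *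
        DPD.matK β DPD.normalModel ![μ₀, σ] *
        DPD.matB β DPD.normalModel (DPD.normalNull μ₀) ![μ₀, σ] =
      !![DPD.normalEigenvalue σ β γ, 0; 0, 0] ∧
    -- its only nonzero eigenvalue
    DPD.normalEigenvalue σ β γ ≠ 0 ∧
    (∀ r : ℝ, r ≠ 0 →
      (Module.End.HasEigenvalue
        (Matrix.toLin' (DPD.matA γ DPD.normalModel ![μ₀, σ] *
          DPD.matB β DPD.normalModel (DPD.normalNull μ₀) ![μ₀, σ] *
          DPD.matK β DPD.normalModel ![μ₀, σ] *
          DPD.matB β DPD.normalModel (DPD.normalNull μ₀) ![μ₀, σ])) r ↔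
        r = DPD.normalEigenvalue σ β γ)) ∧
    (β = 0 → γ = 0 → DPD.normalEigenvalue σ β γ = 1) ∧
    -- the asymptotic null distribution of the test statistic
    (∀ {Ω : Type*} [MeasurableSpace Ω] (P : Measure Ω) [IsProbabilityMeasure P]
      (X : ℕ → Ω → ℝ) (est est₀ : ℕ → Ω → Fin 2 → ℝ),
      (∀ k, Measurable (X k)) → iIndepFun X P →
      (∀ k, P.map (X k) = gaussianReal μ₀ (Real.toNNReal (σ ^ 2))) →
      DPD.IsMDPDE P β DPD.normalModel DPD.normalSpace ![μ₀, σ] X est →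
      DPD.IsRMDPDE P β DPD.normalModel DPD.normalSpace (DPD.normalNull μ₀) ![μ₀, σ] X est₀ →
      TendstoInDistribution (DPD.testStat γ DPD.normalModel est est₀) atTop
          (fun z : ℝ => DPD.normalEigenvalue σ β γ * z ^ 2) (fun _ => P) (gaussianReal 0 1) ∧
        (β = 0 → γ = 0 →
          TendstoInDistribution (DPD.testStat γ DPD.normalModel est est₀) atTop
            (fun z : ℝ => z ^ 2) (fun _ => P) (gaussianReal 0 1))) := by
  have hne := (normalEigenvalue_pos hσ hβ hγ).ne'
  have hone : β = 0 → γ = 0 → normalEigenvalue σ β γ = 1 := by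
    rintro rfl rfl
    simp [normalEigenvalue]
  refine ⟨matA_matB_matK_matB hσ hβ hγ, hne, fun r hr => ?_, hone, ?_⟩
  · rw [matA_matB_matK_matB hσ hβ hγ]
    exact hasEigenvalue_toLin'_single hne hr
  intro Ω _ P _ X est est₀ hX hindep hlaw h h₀
  -- Standardizing the sample makes all moment computations independent of μ₀ and σ.
  set Z : ℕ → Ω → ℝ := fun k ω => (X k ω - μ₀) / σ with hZ
  have hXZ : X = fun k ω => μ₀ + σ * Z k ω := by
    ext k ω; simp only [hZ]; field_simp; ring
  have hmeas : Measurable fun x : ℝ => (x - μ₀) / σ := by fun_prop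
  have hZm : ∀ k, Measurable (Z k) := fun k => hmeas.comp (hX k)
  have hZi : iIndepFun Z P := hindep.comp (fun _ x => (x - μ₀) / σ) fun _ => hmeas
  have hZl : ∀ k, P.map (Z k) = gaussianReal 0 1 := fun k => by
    have h1 : HasLaw (X k) (gaussianReal μ₀ (Real.toNNReal (σ ^ 2))) P :=
      ⟨(hX k).aemeasurable, hlaw k⟩
    have h2 := gaussianReal_div_const (gaussianReal_sub_const h1 μ₀) σ
    rw [h2.map_eq, sub_self, zero_div]
    congr 1
    ext
    simp [hσ.ne', sq_nonneg]
  rw [hXZ] at h h₀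
  have key := tendstoInDistribution_testStat hZm hZi hZl hσ hβ hγ h h₀
  refine ⟨key, fun h1 h2 => ?_⟩
  simpa only [hone h1 h2, one_mul] using key
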